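/- Let $R$ be a commutative ring. A \emph{ternary quadratic module} over $R$ is a triple $(M,I,q)$, where $M$ is a finitely generated projective $R$-module of constant rank $3$, $I$ is an invertible $R$-module (projective of rank $1$), and $q:M\to I$ is a quadratic map, i.e. $q(rx)=r^2q(x)$ for $r\in R$, $x\in M$, and $T(x,y)=q(x+y)-q(x)-q(y)$ is $R$-bilinear. An \emph{isometry} $(M,I,q)\to(M',I',q')$ is a pair of $R$-module isomorphisms $f:M\to M'$, $g:I\to I'$ with $q'(f(x))=g(q(x))$ for all $x\in M$. A \emph{twisted discriminant module} is a triple $(P,Q,d)$, where $P,Q$ are invertible $R$-modules and $d:P\otimes P\to Q$ is an $R$-module isomorphism. The \emph{twist} of $(M,I,q)$ by $(P,Q,d)$ is $(M\otimes P,\,I\otimes Q,\,q\otimes d)$, where $q\otimes d$ is the unique quadratic map with $(q\otimes d)(m\otimes p)=q(m)\otimes d(p\otimes p)$ whose polarization sends $(m\otimes p,\,m'\otimes p')$ to $T(m,m')\otimes d(p\otimes p')$. Two ternary quadratic modules are \emph{twisted isometric} if some twist of the first is isometric to the second; this is an equivalence relation. Let $I^\vee=\mathrm{Hom}_R(I,R)$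 and let $L[I]=\bigoplus_{d\in\mathbb Z}I^{\otimes d}$ (with $I^{\otimes(-d)}=(I^\vee)^{\otimes d}$ for $d>0$), a commutative $R$-algebra via the tensor product and the evaluation $I\otimes I^\vee\to R$. The \emph{even Clifford algebra} $C^0(M,I,q)$ is the subalgebra of elements of degree $0$ in the $\mathbb Z$-graded algebra $(\mathrm{Ten}(M)\otimes L[I])/J(q)$, where $\mathrm{Ten}(M)$ is the tensor algebra of $M$, where $J(q)$ is the two-sided ideal generated by the elements $x\otimes x\otimes 1-1\otimes q(x)$ with $x\in M$, and where $M$, $I$, $I^\vee$ are placed in degrees $1$, $2$, $-2$. A \emph{quaternion ring} over $R$ is an $R$-algebra isomorphic to $C^0(M,I,q)$ for some ternary quadratic module $(M,I,q)$ over $R$. \textbf{Corollary.} For every commutative ring $R$, the assignment $(M,I,q)\mapsto C^0(M,I,q)$ induces a bijection $$\{\text{twisted isometry classes of ternary quadratic modules over }R\}\;\longleftrightarrow\;\{\text{isomorphism classes of quaternion rings over }R\}.$$ This bijection is functorial in $R$: for every homomorphism $R\to S$ of commutative rings, extension of scalars $(M,I,q)\mapsto (S\otimes_R M,\,S\otimes_R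 I,\,q_S)$ and $B\mapsto S\otimes_R B$ induces well-defined maps on the two sets of classes (in particular $S\otimes_R B$ is a quaternion ring over $S$ whenever $B$ is one over $R$), and the bijections over $R$ and over $S$ commute with these maps. Here $q_S$ is the unique quadratic map over $S$ with $q_S(s\otimes m)=s^2\otimes q(m)$ whose polarization sends $(s\otimes m,\,s'\otimes m')$ to $ss'\otimes T(m,m')$. -/

import Mathlib

open scoped TensorProduct

universe u v

noncomputable section

namespace QuaternionRings

/-! ### Quadratic maps: uniqueness, base change, tensor product -/

section Quadratic

/-- Two quadratic maps on a tensor product agree if they agree on pure tensors and if their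
polarizations agree on pairs of pure tensors. -/
theorem quadraticMap_tensor_ext {R A M P N : Type*} [CommRing R] [CommRing A] [Algebra R A]
    [AddCommGroup M] [Module R M] [Module A M] [IsScalarTower R A M]
    [AddCommGroup P] [Module R P] [AddCommGroup N] [Module A N]
    {q₁ q₂ : QuadraticMap A (M ⊗[R] P) N}
    (h : ∀ m p, q₁ (m ⊗ₜ p) = q₂ (m ⊗ₜ p))
    (hp : ∀ m p m' p', QuadraticMap.polar q₁ (m ⊗ₜ p) (m' ⊗ₜ p') =
      QuadraticMap.polar q₂ (m ⊗ₜ p) (m' ⊗ₜ p')) : q₁ = q₂ := by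
  have hB : ∀ x y, q₁.polarBilin x y = q₂.polarBilin x y := by
    intro x y
    induction x with
    | zero => simp
    | add x₁ x₂ h₁ h₂ => rw [map_add, map_add, LinearMap.add_apply, LinearMap.add_apply, h₁, h₂]
    | tmul m p =>
      induction y with
      | zero => simp
      | add y₁ y₂ h₁ h₂ => rw [map_add, map_add, h₁, h₂]
      | tmul m' p' => exact hp m p m' p'
  ext x
  induction x with
  | zero => simp
  | tmul m p => exact h m p
  | add x y hx hy =>
    have hxy := hB x y
    simp only [QuadraticMap.polarBilin_apply_apply, QuadraticMap.polar, hx, hy] at hxy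
    exact sub_left_injective (sub_left_injective hxy)

theorem polar_comp_linear {R M N L : Type*} [CommRing R] [AddCommGroup M] [Module R M]
    [AddCommGroup N] [Module R N] [AddCommGroup L] [Module R L] (q : QuadraticMap R M N)
    (f : L →ₗ[R] M) (x y : L) :
    QuadraticMap.polar (q.comp f) x y = QuadraticMap.polar q (f x) (f y) := by
  simp [QuadraticMap.polar]

theorem polar_compQuadraticMap {R M N L : Type*} [CommRing R] [AddCommGroup M] [Module R M]
    [AddCommGroup N] [Module R N] [AddCommGroup L] [Module R L] (q : QuadraticMap R M N)
    (g : N →ₗ[R] L) (x y : M) :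
    QuadraticMap.polar (g.compQuadraticMap q) x y = g (QuadraticMap.polar q x y) := by
  simp [QuadraticMap.polar]

/-- The analogue of `quadraticMap_tensor_ext` for triple tensor products. -/
theorem quadraticMap_tensor_ext₃ {R M P E N : Type*} [CommRing R]
    [AddCommGroup M] [Module R M] [AddCommGroup P] [Module R P] [AddCommGroup E] [Module R E]
    [AddCommGroup N] [Module R N] {q₁ q₂ : QuadraticMap R ((M ⊗[R] P) ⊗[R] E) N}
    (h : ∀ m p e, q₁ ((m ⊗ₜ p) ⊗ₜ e) = q₂ ((m ⊗ₜ p) ⊗ₜ e))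
    (hp : ∀ m p e m' p' e', QuadraticMap.polar q₁ ((m ⊗ₜ p) ⊗ₜ e) ((m' ⊗ₜ p') ⊗ₜ e') =
      QuadraticMap.polar q₂ ((m ⊗ₜ p) ⊗ₜ e) ((m' ⊗ₜ p') ⊗ₜ e')) : q₁ = q₂ := by
  have hB : q₁.polarBilin = q₂.polarBilin :=
    TensorProduct.ext_threefold fun m p e => TensorProduct.ext_threefold fun m' p' e' =>
      hp m p e m' p' e'
  have hpol : ∀ x y, QuadraticMap.polar q₁ x y = QuadraticMap.polar q₂ x y := fun x y =>
    LinearMap.congr_fun₂ hB x y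
  refine quadraticMap_tensor_ext (fun w e => ?_) (fun w e w' e' => hpol _ _)
  have key : q₁.comp ((TensorProduct.mk R (M ⊗[R] P) E).flip e) =
      q₂.comp ((TensorProduct.mk R (M ⊗[R] P) E).flip e) := by
    refine quadraticMap_tensor_ext (fun m p => h m p e) (fun m p m' p' => ?_)
    simp only [polar_comp_linear, hpol]
  exact congrArg (fun Q => Q w) key

/-- On a projective module every quadratic map is `x ↦ b x x` for some bilinear map `b`. -/
theorem exists_bilin {R M N : Type*} [CommRing R] [AddCommGroup M] [Module R M]
    [Module.Projective R M] [AddCommGroup N] [Module R N] (q : QuadraticMap R M N) :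
    ∃ b : LinearMap.BilinMap R M N, ∀ x, b x x = q x := by
  obtain ⟨s, hs⟩ := Module.projective_def'.mp ‹Module.Projective R M›
  obtain ⟨b, hb⟩ := LinearMap.BilinMap.toQuadraticMap_surjective
    (q.comp (Finsupp.linearCombination R (id : M → M)))
  refine ⟨b.compl₁₂ s s, fun x => ?_⟩
  have h1 := congrArg (fun Q => Q (s x)) hb
  have h2 : Finsupp.linearCombination R (id : M → M) (s x) = x := LinearMap.congr_fun hs x
  simpa [h2] using h1

/-- Existence and uniqueness of the extension of scalars of a quadratic map. -/
theorem existsUnique_baseChange {R M N : Type*} (S : Type*) [CommRing R] [CommRing S] [Algebra R S]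
    [AddCommGroup M] [Module R M] [Module.Projective R M] [AddCommGroup N] [Module R N]
    (q : QuadraticMap R M N) :
    ∃! q' : QuadraticMap S (S ⊗[R] M) (S ⊗[R] N),
      (∀ s m, q' (s ⊗ₜ m) = (s * s) ⊗ₜ q m) ∧
      ∀ s m s' m', QuadraticMap.polar q' (s ⊗ₜ m) (s' ⊗ₜ m') =
        (s * s') ⊗ₜ QuadraticMap.polar q m m' := by
  obtain ⟨b, hb⟩ := exists_bilin q
  refine ⟨(b.baseChange S).toQuadraticMap, ⟨fun s m => ?_, fun s m s' m' => ?_⟩, ?_⟩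
  · simp [hb]
  · rw [LinearMap.BilinMap.polar_toQuadraticMap]
    have : QuadraticMap.polar q m m' = b m m' + b m' m := by
      simp only [QuadraticMap.polar, ← hb, map_add, LinearMap.add_apply]; abel
    rw [this, TensorProduct.tmul_add]
    simp [mul_comm]
  · rintro q' ⟨h1, h2⟩
    refine quadraticMap_tensor_ext (fun s m => ?_) (fun s m s' m' => ?_)
    · simp [h1, hb]
    · rw [h2, LinearMap.BilinMap.polar_toQuadraticMap]
      have : QuadraticMap.polar q m m' = b m m' + b m' m := by
        simp only [QuadraticMap.polar, ← hb, map_add, LinearMap.add_apply]; abel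
      rw [this, TensorProduct.tmul_add]
      simp [mul_comm]

/-- The extension of scalars `q_S : S ⊗ M → S ⊗ N` of a quadratic map `q : M → N`, characterized by
`q_S (s ⊗ m) = s² ⊗ q m` and `T_S (s ⊗ m, s' ⊗ m') = s s' ⊗ T (m, m')` for the polarizations. -/
def quadraticBaseChange {R M N : Type*} (S : Type*) [CommRing R] [CommRing S] [Algebra R S]
    [AddCommGroup M] [Module R M] [Module.Projective R M] [AddCommGroup N] [Module R N]
    (q : QuadraticMap R M N) : QuadraticMap S (S ⊗[R] M) (S ⊗[R] N) :=
  (existsUnique_baseChange S q).choose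

/-- A bilinear map on an invertible module is symmetric. -/
theorem invertible_symm {R P Q : Type*} [CommRing R] [AddCommGroup P] [Module R P]
    [Module.Invertible R P] [AddCommGroup Q] [Module R Q] (d : P ⊗[R] P →ₗ[R] Q) (x y : P) :
    d (x ⊗ₜ y) = d (y ⊗ₜ x) := by
  have h := LinearEquiv.congr_fun (Module.Invertible.tensorProductComm_eq_refl R P) (y ⊗ₜ x)
  rw [TensorProduct.comm_tmul, LinearEquiv.refl_apply] at h
  rw [h]

/-- Existence and uniqueness of the tensor product of a quadratic map `q : M → N` with a linear map
`d : P ⊗ P → Q`, where `P` is invertible. -/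
theorem existsUnique_tensor {R M N P Q : Type*} [CommRing R]
    [AddCommGroup M] [Module R M] [Module.Projective R M] [AddCommGroup N] [Module R N]
    [AddCommGroup P] [Module R P] [Module.Invertible R P] [AddCommGroup Q] [Module R Q]
    (q : QuadraticMap R M N) (d : P ⊗[R] P →ₗ[R] Q) :
    ∃! q' : QuadraticMap R (M ⊗[R] P) (N ⊗[R] Q),
      (∀ m p, q' (m ⊗ₜ p) = q m ⊗ₜ d (p ⊗ₜ p)) ∧
      ∀ m p m' p', QuadraticMap.polar q' (m ⊗ₜ p) (m' ⊗ₜ p') =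
        QuadraticMap.polar q m m' ⊗ₜ d (p ⊗ₜ p') := by
  obtain ⟨b, hb⟩ := exists_bilin q
  let D : LinearMap.BilinMap R P Q := TensorProduct.curry d
  have hD : ∀ x y, D x y = d (x ⊗ₜ y) := fun _ _ => rfl
  have hpol : ∀ m m', QuadraticMap.polar q m m' = b m m' + b m' m := fun m m' => by
    simp only [QuadraticMap.polar, ← hb, map_add, LinearMap.add_apply]; abel
  refine ⟨(b.tmul D).toQuadraticMap, ⟨fun m p => ?_, fun m p m' p' => ?_⟩, ?_⟩
  · simp [hb, hD]
  · rw [LinearMap.BilinMap.polar_toQuadraticMap, hpol, TensorProduct.add_tmul]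
    simp [hD, invertible_symm d p' p]
  · rintro q' ⟨h1, h2⟩
    refine quadraticMap_tensor_ext (fun m p => ?_) (fun m p m' p' => ?_)
    · simp [h1, hb, hD]
    · rw [h2, LinearMap.BilinMap.polar_toQuadraticMap, hpol, TensorProduct.add_tmul]
      simp [hD, invertible_symm d p' p]

/-- The tensor product `q ⊗ d : M ⊗ P → N ⊗ Q` of a quadratic map `q : M → N` with the quadratic map
`p ↦ d (p ⊗ p)`, characterized by `(q ⊗ d) (m ⊗ p) = q m ⊗ d (p ⊗ p)` and by the polarization being
`(m ⊗ p, m' ⊗ p') ↦ T (m, m') ⊗ d (p ⊗ p')`. -/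
def quadraticTensor {R M N P Q : Type*} [CommRing R]
    [AddCommGroup M] [Module R M] [Module.Projective R M] [AddCommGroup N] [Module R N]
    [AddCommGroup P] [Module R P] [Module.Invertible R P] [AddCommGroup Q] [Module R Q]
    (q : QuadraticMap R M N) (d : P ⊗[R] P →ₗ[R] Q) :
    QuadraticMap R (M ⊗[R] P) (N ⊗[R] Q) :=
  (existsUnique_tensor q d).choose

theorem quadraticTensor_tmul {R M N P Q : Type*} [CommRing R]
    [AddCommGroup M] [Module R M] [Module.Projective R M] [AddCommGroup N] [Module R N]
    [AddCommGroup P] [Module R P] [Module.Invertible R P] [AddCommGroup Q] [Module R Q]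
    (q : QuadraticMap R M N) (d : P ⊗[R] P →ₗ[R] Q) (m : M) (p : P) :
    quadraticTensor q d (m ⊗ₜ p) = q m ⊗ₜ d (p ⊗ₜ p) :=
  (existsUnique_tensor q d).choose_spec.1.1 m p

theorem polar_quadraticTensor_tmul {R M N P Q : Type*} [CommRing R]
    [AddCommGroup M] [Module R M] [Module.Projective R M] [AddCommGroup N] [Module R N]
    [AddCommGroup P] [Module R P] [Module.Invertible R P] [AddCommGroup Q] [Module R Q]
    (q : QuadraticMap R M N) (d : P ⊗[R] P →ₗ[R] Q) (m m' : M) (p p' : P) :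
    QuadraticMap.polar (quadraticTensor q d) (m ⊗ₜ p) (m' ⊗ₜ p') =
      QuadraticMap.polar q m m' ⊗ₜ d (p ⊗ₜ p') :=
  (existsUnique_tensor q d).choose_spec.1.2 m p m' p'

theorem quadraticTensor_congr {R M M' N N' P Q : Type*} [CommRing R]
    [AddCommGroup M] [Module R M] [Module.Projective R M] [AddCommGroup N] [Module R N]
    [AddCommGroup M'] [Module R M'] [Module.Projective R M'] [AddCommGroup N'] [Module R N']
    [AddCommGroup P] [Module R P] [Module.Invertible R P] [AddCommGroup Q] [Module R Q]
    (q : QuadraticMap R M N) (q' : QuadraticMap R M' N') (d : P ⊗[R] P →ₗ[R] Q)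
    (f : M ≃ₗ[R] M') (g : N ≃ₗ[R] N') (h : ∀ x, q' (f x) = g (q x)) (x : M ⊗[R] P) :
    quadraticTensor q' d (TensorProduct.congr f (.refl R P) x) =
      TensorProduct.congr g (.refl R Q) (quadraticTensor q d x) := by
  have key : (quadraticTensor q' d).comp (TensorProduct.congr f (.refl R P)).toLinearMap =
      (TensorProduct.congr g (.refl R Q)).toLinearMap.compQuadraticMap (quadraticTensor q d) := by
    refine quadraticMap_tensor_ext (fun m p => ?_) (fun m p m' p' => ?_)
    · simp [quadraticTensor_tmul, h]
    · rw [polar_comp_linear, polar_compQuadraticMap, polar_quadraticTensor_tmul]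
      simp only [LinearEquiv.coe_coe, TensorProduct.congr_tmul, polar_quadraticTensor_tmul]
      simp [QuadraticMap.polar, ← h, map_add]
  exact congrArg (fun Q => Q x) key

theorem quadraticTensor_rid {R M N : Type*} [CommRing R]
    [AddCommGroup M] [Module R M] [Module.Projective R M] [AddCommGroup N] [Module R N]
    (q : QuadraticMap R M N) (x : M ⊗[R] R) :
    q (TensorProduct.rid R M x) =
      TensorProduct.rid R N (quadraticTensor q (TensorProduct.lid R R).toLinearMap x) := by
  have key : q.comp (TensorProduct.rid R M).toLinearMap =
      (TensorProduct.rid R N).toLinearMap.compQuadraticMap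
        (quadraticTensor q (TensorProduct.lid R R).toLinearMap) := by
    refine quadraticMap_tensor_ext (fun m p => ?_) (fun m p m' p' => ?_)
    · simp [quadraticTensor_tmul, QuadraticMap.map_smul]
    · rw [polar_comp_linear, polar_compQuadraticMap, polar_quadraticTensor_tmul]
      simp [QuadraticMap.polar_smul_left, QuadraticMap.polar_smul_right, mul_smul, smul_comm p p']
  exact congrArg (fun Q => Q x) key

theorem quadraticTensor_assoc {R M N P Q P' Q' : Type*} [CommRing R]
    [AddCommGroup M] [Module R M] [Module.Projective R M] [AddCommGroup N] [Module R N]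
    [AddCommGroup P] [Module R P] [Module.Invertible R P] [AddCommGroup Q] [Module R Q]
    [AddCommGroup P'] [Module R P'] [Module.Invertible R P'] [AddCommGroup Q'] [Module R Q']
    (q : QuadraticMap R M N) (d : P ⊗[R] P ≃ₗ[R] Q) (d' : P' ⊗[R] P' ≃ₗ[R] Q')
    (x : (M ⊗[R] P) ⊗[R] P') :
    quadraticTensor q ((TensorProduct.tensorTensorTensorComm R P P' P P').trans
        (TensorProduct.congr d d')).toLinearMap (TensorProduct.assoc R M P P' x) =
      TensorProduct.assoc R N Q Q'
        (quadraticTensor (quadraticTensor q d.toLinearMap) d'.toLinearMap x) := by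
  have key : (quadraticTensor q ((TensorProduct.tensorTensorTensorComm R P P' P P').trans
        (TensorProduct.congr d d')).toLinearMap).comp (TensorProduct.assoc R M P P').toLinearMap =
      (TensorProduct.assoc R N Q Q').toLinearMap.compQuadraticMap
        (quadraticTensor (quadraticTensor q d.toLinearMap) d'.toLinearMap) := by
    refine quadraticMap_tensor_ext₃ (fun m p e => ?_) (fun m p e m' p' e' => ?_)
    · simp [quadraticTensor_tmul]
    · rw [polar_comp_linear, polar_compQuadraticMap, polar_quadraticTensor_tmul,
        polar_quadraticTensor_tmul]
      simp [polar_quadraticTensor_tmul]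
  exact congrArg (fun Q => Q x) key

/-- The contraction `(M ⊗ P) ⊗ P^∨ ≃ M`. -/
def contract (R M P : Type*) [CommRing R] [AddCommGroup M] [Module R M]
    [AddCommGroup P] [Module R P] [Module.Invertible R P] :
    (M ⊗[R] P) ⊗[R] Module.Dual R P ≃ₗ[R] M :=
  (TensorProduct.assoc R M P (Module.Dual R P)).trans <|
    (TensorProduct.congr (.refl R M)
      ((TensorProduct.comm R P (Module.Dual R P)).trans (Module.Invertible.linearEquiv R P))).trans
    (TensorProduct.rid R M)

theorem contract_tmul {R M P : Type*} [CommRing R] [AddCommGroup M] [Module R M]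
    [AddCommGroup P] [Module R P] [Module.Invertible R P] (m : M) (p : P) (f : Module.Dual R P) :
    contract R M P ((m ⊗ₜ[R] p) ⊗ₜ[R] f) = f p • m := rfl

/-- The contraction `(N ⊗ Q) ⊗ (P^∨ ⊗ P^∨) ≃ N` for `d : P ⊗ P ≃ Q`. -/
def contract₂ {R P Q : Type*} (N : Type*) [CommRing R] [AddCommGroup N] [Module R N]
    [AddCommGroup P] [Module R P] [Module.Invertible R P] [AddCommGroup Q] [Module R Q]
    (d : P ⊗[R] P ≃ₗ[R] Q) :
    (N ⊗[R] Q) ⊗[R] (Module.Dual R P ⊗[R] Module.Dual R P) ≃ₗ[R] N :=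
  (TensorProduct.assoc R N Q _).trans <|
    (TensorProduct.congr (.refl R N)
      ((TensorProduct.congr d.symm (.refl R _)).trans
        ((TensorProduct.tensorTensorTensorComm R P P _ _).trans
          ((TensorProduct.congr
            ((TensorProduct.comm R P _).trans (Module.Invertible.linearEquiv R P))
            ((TensorProduct.comm R P _).trans (Module.Invertible.linearEquiv R P))).trans
          (TensorProduct.lid R R))))).trans
    (TensorProduct.rid R N)

theorem contract₂_tmul {R N P Q : Type*} [CommRing R] [AddCommGroup N] [Module R N]
    [AddCommGroup P] [Module R P] [Module.Invertible R P] [AddCommGroup Q] [Module R Q]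
    (d : P ⊗[R] P ≃ₗ[R] Q) (n : N) (p p' : P) (f f' : Module.Dual R P) :
    contract₂ N d ((n ⊗ₜ[R] d (p ⊗ₜ[R] p')) ⊗ₜ[R] (f ⊗ₜ[R] f')) = (f p * f' p') • n := by
  simp [contract₂, Module.Invertible.linearEquiv]

theorem quadraticTensor_dual {R M N P Q : Type*} [CommRing R]
    [AddCommGroup M] [Module R M] [Module.Projective R M] [AddCommGroup N] [Module R N]
    [AddCommGroup P] [Module R P] [Module.Invertible R P] [AddCommGroup Q] [Module R Q]
    (q : QuadraticMap R M N) (d : P ⊗[R] P ≃ₗ[R] Q) (x : (M ⊗[R] P) ⊗[R] Module.Dual R P) :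
    q (contract R M P x) = contract₂ N d
      (quadraticTensor (Q := Module.Dual R P ⊗[R] Module.Dual R P)
        (quadraticTensor q d.toLinearMap) (LinearEquiv.refl R (Module.Dual R P ⊗[R] Module.Dual R P)).toLinearMap x) := by
  have key : q.comp (contract R M P).toLinearMap = (contract₂ N d).toLinearMap.compQuadraticMap
      (quadraticTensor (Q := Module.Dual R P ⊗[R] Module.Dual R P)
        (quadraticTensor q d.toLinearMap) (LinearEquiv.refl R (Module.Dual R P ⊗[R] Module.Dual R P)).toLinearMap) := by
    refine quadraticMap_tensor_ext₃ (fun m p e => ?_) (fun m p e m' p' e' => ?_)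
    · simp [quadraticTensor_tmul, contract_tmul, contract₂_tmul, QuadraticMap.map_smul]
    · rw [polar_comp_linear, polar_compQuadraticMap, polar_quadraticTensor_tmul,
        polar_quadraticTensor_tmul]
      simp [contract_tmul, contract₂_tmul, QuadraticMap.polar_smul_left,
        QuadraticMap.polar_smul_right, smul_smul, mul_comm]
  exact congrArg (fun Q => Q x) key

end Quadratic

/-! ### The even Clifford algebra -/

section Clifford

/-- The Rees algebra `L[I] = ⨁_{d ∈ ℤ} I^{⊗ d}` of an invertible module `I` (where
`I^{⊗ (-d)} = (I^∨)^{⊗ d}`), with the product given by the tensor product and by the evaluation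
`I ⊗ I^∨ → R`: the commutative `R`-algebra generated by `I` (in degree `1`) and by its dual (in
degree `-1`), subject only to the relations `x f = f x` for `x` in `I` and `f` in the dual. -/
def ReesAlgebra (R : Type u) (I : Type v) [CommRing R] [AddCommGroup I] [Module R I] :
    Type (max u v) :=
  SymmetricAlgebra R (I × Module.Dual R I) ⧸
    Ideal.span (Set.range fun xf : I × Module.Dual R I =>
      SymmetricAlgebra.ι R (I × Module.Dual R I) (xf.1, 0) *
        SymmetricAlgebra.ι R (I × Module.Dual R I) (0, xf.2) -
      algebraMap R (SymmetricAlgebra R (I × Module.Dual R I)) (xf.2 xf.1))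

instance (R : Type u) (I : Type v) [CommRing R] [AddCommGroup I] [Module R I] :
    CommRing (ReesAlgebra R I) :=
  inferInstanceAs (CommRing (_ ⧸ Ideal.span (Set.range fun xf : I × Module.Dual R I =>
    SymmetricAlgebra.ι R (I × Module.Dual R I) (xf.1, 0) *
      SymmetricAlgebra.ι R (I × Module.Dual R I) (0, xf.2) -
    algebraMap R (SymmetricAlgebra R (I × Module.Dual R I)) (xf.2 xf.1))))

instance (R : Type u) (I : Type v) [CommRing R] [AddCommGroup I] [Module R I] :
    Algebra R (ReesAlgebra R I) :=
  inferInstanceAs (Algebra R (_ ⧸ Ideal.span (Set.range fun xf : I × Module.Dual R I =>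
    SymmetricAlgebra.ι R (I × Module.Dual R I) (xf.1, 0) *
      SymmetricAlgebra.ι R (I × Module.Dual R I) (0, xf.2) -
    algebraMap R (SymmetricAlgebra R (I × Module.Dual R I)) (xf.2 xf.1))))

/-- The presentation of the Rees algebra as a quotient of a symmetric algebra. -/
def ReesAlgebra.mk (R : Type u) (I : Type v) [CommRing R] [AddCommGroup I] [Module R I] :
    SymmetricAlgebra R (I × Module.Dual R I) →ₐ[R] ReesAlgebra R I :=
  Ideal.Quotient.mkₐ R _

variable {R : Type u} {M I : Type v} [CommRing R] [AddCommGroup M] [Module R M]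
  [AddCommGroup I] [Module R I]

/-- The inclusion of the component `I` of degree `1` of the Rees algebra. -/
def ReesAlgebra.ofModule (R : Type u) (I : Type v) [CommRing R] [AddCommGroup I] [Module R I] :
    I →ₗ[R] ReesAlgebra R I :=
  (ReesAlgebra.mk R I).toLinearMap ∘ₗ SymmetricAlgebra.ι R (I × Module.Dual R I) ∘ₗ
    LinearMap.inl R I (Module.Dual R I)

/-- The inclusion of the component `I^∨` of degree `-1` of the Rees algebra. -/
def ReesAlgebra.ofDual (R : Type u) (I : Type v) [CommRing R] [AddCommGroup I] [Module R I] :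
    Module.Dual R I →ₗ[R] ReesAlgebra R I :=
  (ReesAlgebra.mk R I).toLinearMap ∘ₗ SymmetricAlgebra.ι R (I × Module.Dual R I) ∘ₗ
    LinearMap.inr R I (Module.Dual R I)

/-- The generators `x ⊗ x ⊗ 1 - 1 ⊗ q x` of the ideal `J(q)` of `Ten(M) ⊗ L[I]`, as relations. -/
inductive CliffordRel (q : QuadraticMap R M I) :
    TensorAlgebra R M ⊗[R] ReesAlgebra R I → TensorAlgebra R M ⊗[R] ReesAlgebra R I → Prop
  | of (x : M) : CliffordRel q
      ((TensorAlgebra.ι R x * TensorAlgebra.ι R x) ⊗ₜ[R] 1)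
      (1 ⊗ₜ[R] ReesAlgebra.ofModule R I (q x))

/-- The Clifford algebra `C(M, I, q) = (Ten(M) ⊗ L[I]) / J(q)`. -/
def Clifford (q : QuadraticMap R M I) : Type (max u v) := RingQuot (CliffordRel q)

instance (q : QuadraticMap R M I) : Ring (Clifford q) :=
  inferInstanceAs (Ring (RingQuot (CliffordRel q)))

instance (q : QuadraticMap R M I) : Algebra R (Clifford q) :=
  inferInstanceAs (Algebra R (RingQuot (CliffordRel q)))

/-- The quotient map `Ten(M) ⊗ L[I] → C(M, I, q)`. -/
def Clifford.mk (q : QuadraticMap R M I) :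
    TensorAlgebra R M ⊗[R] ReesAlgebra R I →ₐ[R] Clifford q :=
  RingQuot.mkAlgHom R (CliffordRel q)

/-- The map `M → C(M, I, q)`. -/
def Clifford.ofVector (q : QuadraticMap R M I) : M →ₗ[R] Clifford q :=
  (Clifford.mk q).toLinearMap ∘ₗ
    (Algebra.TensorProduct.includeLeft :
      TensorAlgebra R M →ₐ[R] TensorAlgebra R M ⊗[R] ReesAlgebra R I).toLinearMap ∘ₗ
    TensorAlgebra.ι R

/-- The map `L[I] → C(M, I, q)`. -/
def Clifford.ofRees (q : QuadraticMap R M I) : ReesAlgebra R I →ₐ[R] Clifford q :=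
  (Clifford.mk q).comp
    (Algebra.TensorProduct.includeRight :
      ReesAlgebra R I →ₐ[R] TensorAlgebra R M ⊗[R] ReesAlgebra R I)

/-- The component of degree `n` of `C(M, I, q)`, where `M`, `I`, `I^∨` have degrees `1`, `2`, `-2`:
the span of all products `x₁ ⋯ x_i a₁ ⋯ a_j f₁ ⋯ f_k` with `x` in `M`, `a` in `I`, `f` in the dual
of `I`, and `i + 2 j - 2 k = n`. -/
def Clifford.component (q : QuadraticMap R M I) (n : ℤ) : Submodule R (Clifford q) :=
  ⨆ t : {t : ℕ × ℕ × ℕ // (t.1 : ℤ) + 2 * t.2.1 - 2 * t.2.2 = n},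
    LinearMap.range (Clifford.ofVector q) ^ t.1.1 *
      (((LinearMap.range (ReesAlgebra.ofModule R I)).map (Clifford.ofRees q).toLinearMap) ^ t.1.2.1 *
        ((LinearMap.range (ReesAlgebra.ofDual R I)).map (Clifford.ofRees q).toLinearMap) ^ t.1.2.2)

theorem Clifford.commute_ofVector_ofRees (q : QuadraticMap R M I) (x : M) (a : ReesAlgebra R I) :
    Commute (Clifford.ofVector q x) (Clifford.ofRees q a) := by
  change Clifford.mk q _ * Clifford.mk q _ = Clifford.mk q _ * Clifford.mk q _
  rw [← map_mul, ← map_mul]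
  simp

theorem Clifford.commute_range_map (q : QuadraticMap R M I) (V : Submodule R (ReesAlgebra R I)) :
    Commute (LinearMap.range (Clifford.ofVector q)) (V.map (Clifford.ofRees q).toLinearMap) := by
  apply le_antisymm
  · rw [Submodule.mul_le]
    rintro _ ⟨x, rfl⟩ _ ⟨a, ha, rfl⟩
    change Clifford.ofVector q x * Clifford.ofRees q a ∈ _
    rw [(Clifford.commute_ofVector_ofRees q x a).eq]
    exact Submodule.mul_mem_mul ⟨a, ha, rfl⟩ ⟨x, rfl⟩
  · rw [Submodule.mul_le]
    rintro _ ⟨a, ha, rfl⟩ _ ⟨x, rfl⟩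
    change Clifford.ofRees q a * Clifford.ofVector q x ∈ _
    rw [← (Clifford.commute_ofVector_ofRees q x a).eq]
    exact Submodule.mul_mem_mul ⟨x, rfl⟩ ⟨a, ha, rfl⟩

theorem Clifford.commute_map_map (q : QuadraticMap R M I) (V W : Submodule R (ReesAlgebra R I)) :
    Commute (V.map (Clifford.ofRees q).toLinearMap) (W.map (Clifford.ofRees q).toLinearMap) := by
  change _ * _ = _ * _
  rw [← Submodule.map_mul, ← Submodule.map_mul, mul_comm]

theorem iSup_pow_mul_le {A : Type*} [Ring A] [Algebra R A] {X Y Z : Submodule R A}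
    (h1 : Commute X Y) (h2 : Commute X Z) (h3 : Commute Y Z) (m n : ℤ) :
    (⨆ t : {t : ℕ × ℕ × ℕ // (t.1 : ℤ) + 2 * t.2.1 - 2 * t.2.2 = m},
        X ^ t.1.1 * (Y ^ t.1.2.1 * Z ^ t.1.2.2)) *
      (⨆ t : {t : ℕ × ℕ × ℕ // (t.1 : ℤ) + 2 * t.2.1 - 2 * t.2.2 = n},
        X ^ t.1.1 * (Y ^ t.1.2.1 * Z ^ t.1.2.2)) ≤
      ⨆ t : {t : ℕ × ℕ × ℕ // (t.1 : ℤ) + 2 * t.2.1 - 2 * t.2.2 = m + n},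
        X ^ t.1.1 * (Y ^ t.1.2.1 * Z ^ t.1.2.2) := by
  rw [Submodule.iSup_mul]
  refine iSup_le fun s => ?_
  rw [Submodule.mul_iSup]
  refine iSup_le fun t => ?_
  refine le_trans (le_of_eq ?_) (le_iSup (f := fun t : {t : ℕ × ℕ × ℕ //
    (t.1 : ℤ) + 2 * t.2.1 - 2 * t.2.2 = m + n} => X ^ t.1.1 * (Y ^ t.1.2.1 * Z ^ t.1.2.2))
    ⟨(s.1.1 + t.1.1, s.1.2.1 + t.1.2.1, s.1.2.2 + t.1.2.2), by
      have := s.2; have := t.2; push_cast; linarith⟩)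
  rw [pow_add, pow_add, pow_add,
    ((h1.pow_pow t.1.1 s.1.2.1).mul_right (h2.pow_pow t.1.1 s.1.2.2)).symm.mul_mul_mul_comm,
    (h3.pow_pow t.1.2.1 s.1.2.2).symm.mul_mul_mul_comm]

theorem Clifford.component_mul_le (q : QuadraticMap R M I) (m n : ℤ) :
    Clifford.component q m * Clifford.component q n ≤ Clifford.component q (m + n) :=
  iSup_pow_mul_le (Clifford.commute_range_map q _) (Clifford.commute_range_map q _)
    (Clifford.commute_map_map q _ _) m n

theorem Clifford.one_mem_component (q : QuadraticMap R M I) : 1 ∈ Clifford.component q 0 := by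
  refine (le_iSup (f := fun t : {t : ℕ × ℕ × ℕ // (t.1 : ℤ) + 2 * t.2.1 - 2 * t.2.2 = 0} =>
    LinearMap.range (Clifford.ofVector q) ^ t.1.1 *
      (((LinearMap.range (ReesAlgebra.ofModule R I)).map (Clifford.ofRees q).toLinearMap) ^ t.1.2.1 *
        ((LinearMap.range (ReesAlgebra.ofDual R I)).map
          (Clifford.ofRees q).toLinearMap) ^ t.1.2.2)) ⟨(0, 0, 0), by simp⟩) ?_
  simp only [pow_zero, mul_one]
  exact Submodule.one_le.mp le_rfl

/-- The even Clifford algebra `C⁰(M, I, q)`: the elements of degree `0` of `C(M, I, q)`. -/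
def evenClifford (q : QuadraticMap R M I) : Subalgebra R (Clifford q) :=
  (Clifford.component q 0).toSubalgebra (Clifford.one_mem_component q)
    (fun x y hx hy => by
      simpa using Clifford.component_mul_le q 0 0 (Submodule.mul_mem_mul hx hy))

end Clifford

/-! ### Ternary quadratic modules and quaternion rings -/

/-- A ternary quadratic module `(M, I, q)` over `R`: a finitely generated projective module `M` of
constant rank `3`, an invertible module `I`, and a quadratic map `q : M → I`. -/
structure TernaryQuadraticModule (R : Type u) [CommRing R] where
  M : Type u
  I : Type u
  [addCommGroupM : AddCommGroup M]
  [moduleM : Module R M]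
  [addCommGroupI : AddCommGroup I]
  [moduleI : Module R I]
  [finiteM : Module.Finite R M]
  [projectiveM : Module.Projective R M]
  [invertibleI : Module.Invertible R I]
  rank_eq : ∀ p : PrimeSpectrum R, Module.rankAtStalk (R := R) M p = 3
  q : QuadraticMap R M I

attribute [instance] TernaryQuadraticModule.addCommGroupM TernaryQuadraticModule.moduleM
  TernaryQuadraticModule.addCommGroupI TernaryQuadraticModule.moduleI
  TernaryQuadraticModule.finiteM TernaryQuadraticModule.projectiveM
  TernaryQuadraticModule.invertibleI

/-- A twisted discriminant module `(P, Q, d)`: invertible modules `P` and `Q` together with an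
isomorphism `d : P ⊗ P ≃ Q`. -/
structure TwistedDiscriminantModule (R : Type u) [CommRing R] where
  P : Type u
  Q : Type u
  [addCommGroupP : AddCommGroup P]
  [moduleP : Module R P]
  [addCommGroupQ : AddCommGroup Q]
  [moduleQ : Module R Q]
  [invertibleP : Module.Invertible R P]
  [invertibleQ : Module.Invertible R Q]
  d : P ⊗[R] P ≃ₗ[R] Q

attribute [instance] TwistedDiscriminantModule.addCommGroupP TwistedDiscriminantModule.moduleP
  TwistedDiscriminantModule.addCommGroupQ TwistedDiscriminantModule.moduleQ
  TwistedDiscriminantModule.invertibleP TwistedDiscriminantModule.invertibleQ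

theorem rankAtStalk_invertible {R P : Type*} [CommRing R] [AddCommGroup P] [Module R P]
    [Module.Invertible R P] (p : PrimeSpectrum R) : Module.rankAtStalk (R := R) P p = 1 := by
  have : Nontrivial R := p.nontrivial
  let _ : AddCommGroup (Module.Dual R P ⊗[R] P) := TensorProduct.addCommGroup
  have h := Module.rankAtStalk_eq_of_equiv (Module.Invertible.linearEquiv R P)
  rw [Module.rankAtStalk_tensorProduct, Module.rankAtStalk_self] at h
  exact Nat.eq_one_of_mul_eq_one_left (congrFun h p)

namespace TernaryQuadraticModule

variable {R : Type u} [CommRing R]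

/-- `(M, I, q)` and `(M', I', q')` are isometric if there are module isomorphisms `f : M ≃ M'` and
`g : I ≃ I'` with `q' ∘ f = g ∘ q`. -/
def Isometric (X Y : TernaryQuadraticModule R) : Prop :=
  ∃ (f : X.M ≃ₗ[R] Y.M) (g : X.I ≃ₗ[R] Y.I), ∀ x, Y.q (f x) = g (X.q x)

/-- The twist `(M ⊗ P, I ⊗ Q, q ⊗ d)` of `(M, I, q)` by `(P, Q, d)`. -/
def twist (X : TernaryQuadraticModule R) (D : TwistedDiscriminantModule R) :
    TernaryQuadraticModule R where
  M := X.M ⊗[R] D.P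
  I := X.I ⊗[R] D.Q
  rank_eq p := by
    rw [Module.rankAtStalk_tensorProduct, Pi.mul_apply, X.rank_eq, rankAtStalk_invertible]
  q := quadraticTensor X.q D.d.toLinearMap

/-- `X` and `Y` are twisted isometric if some twist of `X` is isometric to `Y`. -/
def TwistedIsometric (X Y : TernaryQuadraticModule R) : Prop :=
  ∃ D : TwistedDiscriminantModule R, (X.twist D).Isometric Y

theorem Isometric.symm {X Y : TernaryQuadraticModule R} (h : X.Isometric Y) : Y.Isometric X := by
  obtain ⟨f, g, h⟩ := h
  refine ⟨f.symm, g.symm, fun x => ?_⟩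
  rw [LinearEquiv.eq_symm_apply, ← h, LinearEquiv.apply_symm_apply]

theorem Isometric.trans {X Y Z : TernaryQuadraticModule R} (h : X.Isometric Y)
    (h' : Y.Isometric Z) : X.Isometric Z := by
  obtain ⟨f, g, h⟩ := h
  obtain ⟨f', g', h'⟩ := h'
  exact ⟨f.trans f', g.trans g', fun x => by simp [h, h']⟩

theorem Isometric.twist {X Y : TernaryQuadraticModule R} (h : X.Isometric Y)
    (D : TwistedDiscriminantModule R) : (X.twist D).Isometric (Y.twist D) := by
  obtain ⟨f, g, h⟩ := h
  exact ⟨TensorProduct.congr f (.refl R _), TensorProduct.congr g (.refl R _),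
    quadraticTensor_congr X.q Y.q D.d.toLinearMap f g h⟩

theorem twist_unit (X : TernaryQuadraticModule R) :
    (X.twist { P := R, Q := R, d := TensorProduct.lid R R }).Isometric X :=
  ⟨TensorProduct.rid R X.M, TensorProduct.rid R X.I, quadraticTensor_rid X.q⟩

/-- The tensor product of two twisted discriminant modules. -/
def _root_.QuaternionRings.TwistedDiscriminantModule.tensor (D E : TwistedDiscriminantModule R) :
    TwistedDiscriminantModule R where
  P := D.P ⊗[R] E.P
  Q := D.Q ⊗[R] E.Q
  d := (TensorProduct.tensorTensorTensorComm R D.P E.P D.P E.P).trans (TensorProduct.congr D.d E.d)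

/-- The dual `(P^∨, P^∨ ⊗ P^∨, id)`, inverse to `(P, Q, d)` up to isomorphism. -/
def _root_.QuaternionRings.TwistedDiscriminantModule.dual (D : TwistedDiscriminantModule R) :
    TwistedDiscriminantModule R where
  P := Module.Dual R D.P
  Q := Module.Dual R D.P ⊗[R] Module.Dual R D.P
  d := .refl R _

theorem twist_twist (X : TernaryQuadraticModule R) (D E : TwistedDiscriminantModule R) :
    ((X.twist D).twist E).Isometric (X.twist (D.tensor E)) :=
  ⟨TensorProduct.assoc R X.M D.P E.P, TensorProduct.assoc R X.I D.Q E.Q,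
    quadraticTensor_assoc X.q D.d E.d⟩

theorem twist_dual (X : TernaryQuadraticModule R) (D : TwistedDiscriminantModule R) :
    ((X.twist D).twist D.dual).Isometric X :=
  ⟨contract R X.M D.P, contract₂ X.I D.d, quadraticTensor_dual X.q D.d⟩

theorem twistedIsometric_equivalence :
    Equivalence (TwistedIsometric : TernaryQuadraticModule R → TernaryQuadraticModule R → Prop) where
  refl X := ⟨_, X.twist_unit⟩
  symm := fun {X _} ⟨D, h⟩ => ⟨D.dual, (h.symm.twist D.dual).trans (X.twist_dual D)⟩
  trans := fun {X _ _} ⟨D, h⟩ ⟨E, h'⟩ =>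
    ⟨D.tensor E, (X.twist_twist D E).symm.trans ((h.twist E).trans h')⟩

/-- Twisted isometry of ternary quadratic modules, as an equivalence relation. -/
instance twistedSetoid (R : Type u) [CommRing R] : Setoid (TernaryQuadraticModule R) where
  r := TwistedIsometric
  iseqv := twistedIsometric_equivalence

/-- The extension of scalars `(S ⊗ M, S ⊗ I, q_S)` of `(M, I, q)` along `R → S`. -/
def baseChange (X : TernaryQuadraticModule R) (S : Type u) [CommRing S] [Algebra R S] :
    TernaryQuadraticModule S where
  M := S ⊗[R] X.M
  I := S ⊗[R] X.I
  rank_eq p := by rw [Module.rankAtStalk_baseChange, X.rank_eq]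
  q := quadraticBaseChange S X.q

end TernaryQuadraticModule

/-- An `R`-algebra `B` is a quaternion ring if it is isomorphic to the even Clifford algebra of some
ternary quadratic module over `R`. -/
def IsQuaternionRing (R : Type u) [CommRing R] (B : Type u) [Ring B] [Algebra R B] : Prop :=
  ∃ X : TernaryQuadraticModule R, Nonempty (B ≃ₐ[R] evenClifford X.q)

/-- A quaternion ring over `R`. -/
structure QuaternionRing (R : Type u) [CommRing R] where
  B : Type u
  [ring : Ring B]
  [algebra : Algebra R B]
  isQuaternionRing : IsQuaternionRing R B

attribute [instance] QuaternionRing.ring QuaternionRing.algebra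

/-- Isomorphism of quaternion rings as `R`-algebras. -/
instance quaternionRingSetoid (R : Type u) [CommRing R] : Setoid (QuaternionRing R) where
  r B C := Nonempty (B.B ≃ₐ[R] C.B)
  iseqv := ⟨fun _ => ⟨.refl⟩, fun ⟨e⟩ => ⟨e.symm⟩, fun ⟨e⟩ ⟨f⟩ => ⟨e.trans f⟩⟩

/-- The quaternion ring `C⁰(M, I, q)`. -/
def TernaryQuadraticModule.evenCliffordRing {R : Type u} [CommRing R]
    (X : TernaryQuadraticModule R) : QuaternionRing R where
  B := evenClifford X.q
  isQuaternionRing := ⟨X, ⟨.refl⟩⟩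

/-- The set of twisted isometry classes of ternary quadratic modules over `R`. -/
abbrev TwistedIsometryClasses (R : Type u) [CommRing R] :=
  Quotient (TernaryQuadraticModule.twistedSetoid R)

/-- The set of isomorphism classes of quaternion rings over `R`. -/
abbrev QuaternionRingClasses (R : Type u) [CommRing R] :=
  Quotient (quaternionRingSetoid R)

end QuaternionRings

end

open QuaternionRings

namespace QuaternionRings

/-! ### Local-global principles and frames -/

section LocalGlobal

/-! Surjectivity is the definition of a quaternion ring, so the content is that two ternary modules
are twisted isometric exactly when their even Clifford algebras are isomorphic, and that $C^0$
commutes with extension of scalars.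

Twisting does not change $C^0$ (`evenClifford_twist`). Where $P$ has a generator the twist is a
rescaling, and the local isomorphisms match the canonical generators $x\,y\,\alpha$ on both sides.
The subalgebra of the product generated by the matching pairs is therefore the graph of a global
isomorphism.

Conversely, call $M$ oriented if it carries an alternating trilinear map $\omega$ to $I$ identifying
$\Lambda^3M$ with $I$. Every module has an oriented twist (`exists_oriented_twist`): twist by
$P=\mathrm{Alt}^3(M,I)\cong(\Lambda^3M)^\vee\otimes I$ and $Q=P\otimes P$, because then
$\Lambda^3(M\otimes P)\cong\Lambda^3M\otimes P^{\otimes3}\cong I\otimes Q$. An oriented module is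
recovered from $C^0$ up to isometry (`IsOrientation.exists_isometry`). Sending $x$ to the functional
$1\mapsto0$, $y\,z\,\alpha\mapsto\alpha(\omega(x,y,z))$ identifies $M$ with $(C^0/R)^\vee$; the
orientation then gives $I$; and $q$ is read off from the product
$(x\,y\,\alpha)(y\,z\,\beta)=\alpha(q(y))\,x\,z\,\beta$.

Two facts make the functionals available. In rank three, $1$ and the elements $x\,y\,\alpha$ already
span $C^0$ (`evenClifford_toSubmodule`), since a four-fold alternating product vanishes. They
satisfy no relation incompatible with an alternating form (`exists_functional`), which follows by
deforming a classical Clifford algebra by that form.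

For extension of scalars (`evenClifford_baseChange`) the Clifford algebras are compared by their
universal properties. Since $C^0$ is a direct summand, the comparison restricts to even parts even
if $S$ is not flat. Local freeness is used throughout as a statement up to multiplication by a
scalar outside a given maximal ideal. -/

theorem mem_of_local {R N : Type*} [CommRing R] [AddCommGroup N] [Module R N]
    (K : Submodule R N) {z : N}
    (h : ∀ m : Ideal R, m.IsMaximal → ∃ s, s ∉ m ∧ s • z ∈ K) : z ∈ K := by
  by_contra hz
  -- The scalars carrying `z` into `K` form an ideal; by hypothesis no maximal ideal contains it.
  let J : Ideal R := K.comap (LinearMap.toSpanSingleton R N z)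
  have hJ : J ≠ ⊤ := fun hJ => hz <| by
    have : (1 : R) ∈ J := hJ ▸ Submodule.mem_top
    simpa [J] using this
  obtain ⟨m, hm, hle⟩ := Ideal.exists_le_maximal J hJ
  obtain ⟨s, hs, hsz⟩ := h m hm
  exact hs (hle (by simpa [J] using hsz))

theorem eq_zero_of_local {R N : Type*} [CommRing R] [AddCommGroup N] [Module R N] {z : N}
    (h : ∀ m : Ideal R, m.IsMaximal → ∃ s, s ∉ m ∧ s • z = 0) : z = 0 := by
  simpa using mem_of_local (⊥ : Submodule R N) (z := z) (by simpa using h)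

theorem pow_notMem {R : Type*} [CommRing R] {m : Ideal R} (hm : m.IsMaximal) {s : R} (hs : s ∉ m)
    (n : ℕ) : s ^ n ∉ m :=
  fun h => hs (hm.isPrime.mem_of_pow_mem n h)

theorem mul_notMem {R : Type*} [CommRing R] {m : Ideal R} (hm : m.IsMaximal) {s t : R} (hs : s ∉ m)
    (ht : t ∉ m) : s * t ∉ m :=
  fun h => (hm.isPrime.mem_or_mem h).elim hs ht

end LocalGlobal

section Invertible

variable {R P : Type*} [CommRing R] [AddCommGroup P] [Module R P] [Module.Invertible R P]

/-- The swap on `P ⊗ P` is the identity for an invertible module, so every bilinear map on `P` is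
symmetric, in particular `(x, y) ↦ f x • y`. This is the form in which rank one enters most later
computations. -/
theorem dual_smul_comm (f : Module.Dual R P) (x y : P) : f x • y = f y • x := by
  simpa using invertible_symm (TensorProduct.lift
    ((LinearMap.lsmul R P).comp f)) x y

theorem dual_apply_smul (f g : Module.Dual R P) (x : P) : g x • f = f x • g := by
  ext y
  have := congrArg f (dual_smul_comm g x y)
  simp only [map_smul, smul_eq_mul] at this
  simp [this, mul_comm]

theorem exists_sum_dual_eq_one : ∃ (ι : Finset (Module.Dual R P × P)),
    ∑ i ∈ ι, i.1 i.2 = 1 := by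
  obtain ⟨ι, hι⟩ := TensorProduct.exists_finset ((Module.Invertible.linearEquiv R P).symm 1)
  refine ⟨ι, ?_⟩
  have h := (LinearEquiv.symm_apply_eq _).mp hι
  rw [map_sum] at h
  exact h.symm

/-- The values `f x` generate the unit ideal, because evaluation `P^∨ ⊗ P → R` is onto. A value
outside `m` makes `x` a generator of `P` near `m`, with `f` as its coordinate up to a unit. -/
theorem exists_dual_notMem {m : Ideal R} (hm : m.IsMaximal) :
    ∃ (f : Module.Dual R P) (x : P), f x ∉ m := by
  by_contra! h
  refine hm.ne_top (m.eq_top_iff_one.mpr ?_)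
  obtain ⟨ι, hι⟩ := exists_sum_dual_eq_one (R := R) (P := P)
  rw [← hι]
  exact m.sum_mem fun i _ => h _ _

end Invertible

section Frame

variable {R : Type*} [CommRing R] {M : Type*} [AddCommGroup M] [Module R M]

/-- Vectors `e` and functionals `c` that become dual bases of `M` once `s` is inverted. -/
structure Frame (M : Type*) [AddCommGroup M] [Module R M] (s : R) where
  e : Fin 3 → M
  c : Fin 3 → Module.Dual R M
  sum_smul : ∀ x, c 0 x • e 0 + c 1 x • e 1 + c 2 x • e 2 = s • x
  apply_self : ∀ i j, c i (e j) = if i = j then s else 0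

/-- Lift a basis of `M / mM` and its coordinates to `M`. The adjugate of the pairing matrix makes
the lifted functionals dual to the lifted vectors up to a determinant, and Nakayama's lemma makes
the vectors span up to a scalar that is `1` modulo `m`. -/
theorem exists_frame [Module.Finite R M] [Module.Projective R M]
    (hM : ∀ p : PrimeSpectrum R, Module.rankAtStalk (R := R) M p = 3)
    {m : Ideal R} (hm : m.IsMaximal) : ∃ s, s ∉ m ∧ Nonempty (Frame M s) := by
  let κ := R ⧸ m
  let _ : Field κ := Ideal.Quotient.field m
  have hr : Module.finrank κ (κ ⊗[R] M) = 3 := by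
    have h1 := Module.rankAtStalk_baseChange (R := R) (M := M) (S := κ) (⊥ : PrimeSpectrum κ)
    rw [hM, Module.rankAtStalk_eq_finrank_of_free] at h1
    simpa using h1
  let b : Module.Basis (Fin 3) κ (κ ⊗[R] M) := Module.finBasisOfFinrankEq κ _ hr
  have hsurj : ∀ z : κ ⊗[R] M, ∃ x : M, (1 : κ) ⊗ₜ[R] x = z := by
    intro z
    induction z with
    | zero => exact ⟨0, by simp⟩
    | add x y hx hy =>
      obtain ⟨x, rfl⟩ := hx
      obtain ⟨y, rfl⟩ := hy
      exact ⟨x + y, TensorProduct.tmul_add _ _ _⟩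
    | tmul a x =>
      obtain ⟨r, rfl⟩ := Ideal.Quotient.mk_surjective a
      refine ⟨r • x, ?_⟩
      rw [← TensorProduct.smul_tmul, Algebra.smul_def, mul_one]; rfl
  choose e he using fun i => hsurj (b i)
  have hlift : ∀ i, ∃ f : Module.Dual R M, ∀ x, Ideal.Quotient.mk m (f x) =
      b.coord i ((1 : κ) ⊗ₜ x) := by
    intro i
    obtain ⟨f, hf⟩ := Module.projective_lifting_property (Algebra.linearMap R κ)
      ((b.coord i).restrictScalars R ∘ₗ TensorProduct.mk R κ M 1) Ideal.Quotient.mk_surjective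
    exact ⟨f, fun x => LinearMap.congr_fun hf x⟩
  choose f hf using hlift
  let G : Matrix (Fin 3) (Fin 3) R := Matrix.of fun i j => f i (e j)
  have hG : Ideal.Quotient.mk m G.det = 1 := by
    rw [RingHom.map_det]
    convert Matrix.det_one (n := Fin 3) (R := κ)
    ext i j
    simp [G, hf, he, Matrix.one_apply, Finsupp.single_apply, eq_comm]
  let c : Fin 3 → Module.Dual R M := fun i => ∑ k, G.adjugate i k • f k
  have hc : ∀ i j, c i (e j) = if i = j then G.det else 0 := by
    intro i j
    have := congrFun (congrFun G.adjugate_mul i) j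
    simp only [Matrix.mul_apply, Matrix.smul_apply, Matrix.one_apply, smul_eq_mul, mul_ite,
      mul_one, mul_zero] at this
    simpa [c, G] using this
  -- `E` measures the failure of the `e i` to span. It kills each `e j`, and every `x` is congruent
  -- modulo `mM` to a combination of them; hence the image of `E` lies in `m` times itself.
  let E : M →ₗ[R] M := G.det • LinearMap.id - ∑ i, (c i).smulRight (e i)
  have hE : ∀ j, E (e j) = 0 := fun j => by simp [E, hc, ite_smul]
  have hrange : LinearMap.range E ≤ m • LinearMap.range E := by
    rintro _ ⟨x, rfl⟩
    have hx : x - ∑ i, f i x • e i ∈ m • (⊤ : Submodule R M) := by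
      rw [← Submodule.Quotient.mk_eq_zero,
        ← (TensorProduct.quotTensorEquivQuotSMul M m).symm.map_eq_zero_iff]
      change (1 : κ) ⊗ₜ[R] (x - ∑ i, f i x • e i) = 0
      rw [TensorProduct.tmul_sub, TensorProduct.tmul_sum, sub_eq_zero]
      nth_rw 1 [← b.sum_repr ((1 : κ) ⊗ₜ[R] x)]
      refine Finset.sum_congr rfl fun i _ => ?_
      rw [← TensorProduct.smul_tmul, Algebra.smul_def, mul_one, ← he, TensorProduct.smul_tmul']
      congr 1
      rw [smul_eq_mul, mul_one]
      exact (hf i x).symm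
    have h2 : E x = E (x - ∑ i, f i x • e i) := by simp [hE]
    rw [h2, ← Submodule.map_top, ← Submodule.map_smul'']
    exact Submodule.mem_map_of_mem hx
  obtain ⟨r, hr1, hr2⟩ := Submodule.exists_sub_one_mem_and_smul_eq_zero_of_fg_of_le_smul m
    (LinearMap.range E) (Module.Finite.iff_fg.mp (Module.Finite.range E)) hrange
  have h1m : (1 : R) ∉ m := fun h => hm.ne_top (m.eq_top_iff_one.mpr h)
  refine ⟨r * G.det, fun h => ?_, ⟨⟨e, fun i => r • c i, fun x => ?_, fun i j => ?_⟩⟩⟩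
  · have h3 : Ideal.Quotient.mk m r = 1 := by
      rw [← map_one (Ideal.Quotient.mk m)]
      exact Ideal.Quotient.eq.mpr hr1
    have h4 := Ideal.Quotient.eq_zero_iff_mem.mpr h
    rw [map_mul, hG, h3, mul_one, ← map_one (Ideal.Quotient.mk m)] at h4
    exact h1m (Ideal.Quotient.eq_zero_iff_mem.mp h4)
  · have := hr2 (E x) ⟨x, rfl⟩
    simp only [E, Fin.sum_univ_three, LinearMap.sub_apply, LinearMap.smul_apply, LinearMap.id_apply,
      LinearMap.add_apply, LinearMap.smulRight_apply, smul_sub, smul_add, sub_eq_zero] at this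
    simp [mul_smul, this]
  · simp [hc]

end Frame

/-! ### Alternating maps on modules of rank three -/

section Alternating

variable {R : Type*} [CommRing R] {M : Type*} [AddCommGroup M] [Module R M]
  {N : Type*} [AddCommGroup N] [Module R N] {s : R}

/-- Each argument of a multilinear map is expanded in the frame at the cost of one factor `s`; this
is the source of the powers of `s` below. -/
theorem Frame.mem₁ (fr : Frame M s) (K : Submodule R N) (g : M →ₗ[R] N)
    (h : ∀ i, g (fr.e i) ∈ K) (x : M) : s • g x ∈ K := by
  rw [← map_smul, ← fr.sum_smul]
  simp only [map_add, map_smul]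
  exact K.add_mem (K.add_mem (K.smul_mem _ (h _)) (K.smul_mem _ (h _))) (K.smul_mem _ (h _))

theorem Frame.mem₂ (fr : Frame M s) (K : Submodule R N) (F : M →ₗ[R] M →ₗ[R] N)
    (h : ∀ i j, F (fr.e i) (fr.e j) ∈ K) (x y : M) : s ^ 2 • F x y ∈ K := by
  have h1 : ∀ j, s • F x (fr.e j) ∈ K := fun j => fr.mem₁ K (F.flip (fr.e j)) (fun i => h i j) x
  have h2 := fr.mem₁ K (s • F x) h1 y
  rwa [LinearMap.smul_apply, smul_smul, ← sq] at h2

theorem Frame.mem₄ (fr : Frame M s) (K : Submodule R N)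
    (F : M →ₗ[R] M →ₗ[R] M →ₗ[R] M →ₗ[R] N)
    (h : ∀ i j k l, F (fr.e i) (fr.e j) (fr.e k) (fr.e l) ∈ K) (x y z w : M) :
    s ^ 4 • F x y z w ∈ K := by
  have h1 : ∀ k l, s ^ 2 • F x y (fr.e k) (fr.e l) ∈ K := fun k l =>
    fr.mem₂ K (F.compr₂ ((LinearMap.applyₗ (fr.e l) : (M →ₗ[R] N) →ₗ[R] N) ∘ₗ
      (LinearMap.applyₗ (fr.e k) : (M →ₗ[R] M →ₗ[R] N) →ₗ[R] M →ₗ[R] N)))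
      (fun i j => h i j k l) x y
  have h2 := fr.mem₂ K (s ^ 2 • F x y) h1 z w
  rwa [LinearMap.smul_apply, LinearMap.smul_apply, smul_smul, ← pow_add] at h2

/-- A trilinear map that vanishes when two neighbouring arguments agree. -/
def IsAlt₃ (θ : M →ₗ[R] M →ₗ[R] M →ₗ[R] N) : Prop :=
  (∀ x y, θ x x y = 0) ∧ ∀ x y, θ x y y = 0

theorem IsAlt₃.swap_left {θ : M →ₗ[R] M →ₗ[R] M →ₗ[R] N} (h : IsAlt₃ θ) (x y z : M) :
    θ y x z = -θ x y z := by
  have := h.1 (x + y) z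
  simp only [map_add, LinearMap.add_apply, h.1, zero_add, add_zero] at this
  exact eq_neg_of_add_eq_zero_left (by rwa [add_comm] at this ⊢)

theorem IsAlt₃.swap_right {θ : M →ₗ[R] M →ₗ[R] M →ₗ[R] N} (h : IsAlt₃ θ) (x y z : M) :
    θ x z y = -θ x y z := by
  have := h.2 x (y + z)
  simp only [map_add, LinearMap.add_apply, h.2, zero_add, add_zero] at this
  exact eq_neg_of_add_eq_zero_left (by rwa [add_comm] at this ⊢)

theorem IsAlt₃.self_mid {θ : M →ₗ[R] M →ₗ[R] M →ₗ[R] N} (h : IsAlt₃ θ) (x y : M) :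
    θ x y x = 0 := by
  rw [h.swap_right x x y, h.1, neg_zero]

/-- Expanding three vectors in three frame vectors leaves only the six permutations: up to `s`, the
third exterior power is generated by the wedge of the frame. -/
theorem Frame.alt₃ (fr : Frame M s) {θ : M →ₗ[R] M →ₗ[R] M →ₗ[R] N} (h : IsAlt₃ θ) (x y z : M) :
    s ^ 3 • θ x y z = (Matrix.det !![fr.c 0 x, fr.c 1 x, fr.c 2 x; fr.c 0 y, fr.c 1 y, fr.c 2 y;
      fr.c 0 z, fr.c 1 z, fr.c 2 z]) • θ (fr.e 0) (fr.e 1) (fr.e 2) := by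
  have h1 : s ^ 3 • θ x y z = θ (s • x) (s • y) (s • z) := by
    simp only [map_smul, LinearMap.smul_apply, smul_smul]; congr 1; ring
  have h102 := h.swap_left (fr.e 0) (fr.e 1) (fr.e 2)
  have h021 := h.swap_right (fr.e 0) (fr.e 1) (fr.e 2)
  have h120 := h.swap_right (fr.e 1) (fr.e 0) (fr.e 2)
  have h201 := h.swap_left (fr.e 0) (fr.e 2) (fr.e 1)
  have h210 := h.swap_right (fr.e 2) (fr.e 0) (fr.e 1)
  rw [h1, ← fr.sum_smul, ← fr.sum_smul, ← fr.sum_smul, Matrix.det_fin_three]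
  simp only [map_add, map_smul, LinearMap.add_apply, LinearMap.smul_apply, h.1, h.2, h.self_mid,
    h210, h201, h120, h021, h102, smul_zero, add_zero, zero_add]
  simp
  module

variable [Module.Finite R M] [Module.Projective R M]

/-- Up to powers of `s`, both forms are multiples of the same determinant of coordinates, so they
are proportional. -/
theorem alt₃_smul_comm (hM : ∀ p : PrimeSpectrum R, Module.rankAtStalk (R := R) M p = 3)
    {θ : M →ₗ[R] M →ₗ[R] M →ₗ[R] N} {κ : M →ₗ[R] M →ₗ[R] M →ₗ[R] R}
    (hθ : IsAlt₃ θ) (hκ : IsAlt₃ κ) (x y z x' y' z' : M) :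
    κ x' y' z' • θ x y z = κ x y z • θ x' y' z' := by
  rw [← sub_eq_zero]
  refine eq_zero_of_local (R := R) fun m hm => ?_
  obtain ⟨s, hs, ⟨fr⟩⟩ := exists_frame hM hm
  refine ⟨s ^ 6, pow_notMem hm hs 6, ?_⟩
  have h1 : s ^ 6 • (κ x' y' z' • θ x y z) = (s ^ 3 • κ x' y' z') • (s ^ 3 • θ x y z) := by
    simp only [smul_eq_mul, smul_smul]; congr 1; ring
  have h2 : s ^ 6 • (κ x y z • θ x' y' z') = (s ^ 3 • κ x y z) • (s ^ 3 • θ x' y' z') := by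
    simp only [smul_eq_mul, smul_smul]; congr 1; ring
  rw [smul_sub, h1, h2, fr.alt₃ hθ, fr.alt₃ hκ, fr.alt₃ hθ, fr.alt₃ hκ]
  simp only [smul_eq_mul]
  module

theorem alt₄_eq_zero (hM : ∀ p : PrimeSpectrum R, Module.rankAtStalk (R := R) M p = 3)
    (F : M →ₗ[R] M →ₗ[R] M →ₗ[R] M →ₗ[R] N)
    (h1 : ∀ x z w, F x x z w = 0) (h2 : ∀ x y w, F x y y w = 0) (h3 : ∀ x y z, F x y z z = 0)
    (x y z w : M) : F x y z w = 0 := by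
  have s1 : ∀ x y z w, F y x z w = -F x y z w := fun x y z w => by
    have := h1 (x + y) z w
    simp only [map_add, LinearMap.add_apply, h1, zero_add, add_zero] at this
    exact eq_neg_of_add_eq_zero_left (by rwa [add_comm] at this ⊢)
  have s3 : ∀ x y z w, F x y w z = -F x y z w := fun x y z w => by
    have := h3 x y (z + w)
    simp only [map_add, LinearMap.add_apply, h3, zero_add, add_zero] at this
    exact eq_neg_of_add_eq_zero_left (by rwa [add_comm] at this ⊢)
  refine eq_zero_of_local (R := R) fun m hm => ?_
  obtain ⟨s, hs, ⟨fr⟩⟩ := exists_frame hM hm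
  refine ⟨s ^ 4, pow_notMem hm hs 4, ?_⟩
  refine (Submodule.mem_bot R).mp (fr.mem₄ ⊥ F (fun i j k l => (Submodule.mem_bot R).mpr ?_) x y z w)
  -- Four indices among three values must repeat; swapping the outer pairs moves any repetition into
  -- neighbouring places.
  have : ∀ i j k l : Fin 3, i = j ∨ j = k ∨ k = l ∨ i = k ∨ j = l ∨ i = l := by decide
  rcases this i j k l with rfl | rfl | rfl | rfl | rfl | rfl
  · exact h1 _ _ _
  · exact h2 _ _ _
  · exact h3 _ _ _
  · rw [s1, h2, neg_zero]
  · rw [s3, h2, neg_zero]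
  · rw [s1, s3, h2, neg_zero, neg_zero]

end Alternating

/-! ### The Clifford algebra: universal property, generators, grading -/

section CliffordBasic

variable {R : Type u} {M I : Type v} [CommRing R] [AddCommGroup M] [Module R M]
  [AddCommGroup I] [Module R I]

/-- The image of `I` in the Clifford algebra. -/
noncomputable def Clifford.ofModule (q : QuadraticMap R M I) : I →ₗ[R] Clifford q :=
  (Clifford.ofRees q).toLinearMap ∘ₗ ReesAlgebra.ofModule R I

/-- The image of `I^∨` in the Clifford algebra. -/
noncomputable def Clifford.ofDual (q : QuadraticMap R M I) : Module.Dual R I →ₗ[R] Clifford q :=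
  (Clifford.ofRees q).toLinearMap ∘ₗ ReesAlgebra.ofDual R I

theorem ReesAlgebra.ofModule_mul_ofDual (a : I) (α : Module.Dual R I) :
    ReesAlgebra.ofModule R I a * ReesAlgebra.ofDual R I α = algebraMap R _ (α a) :=
  Ideal.Quotient.eq.mpr (Ideal.subset_span ⟨(a, α), rfl⟩)

theorem Clifford.ofModule_mul_ofDual (q : QuadraticMap R M I) (a : I) (α : Module.Dual R I) :
    Clifford.ofModule q a * Clifford.ofDual q α = algebraMap R _ (α a) := by
  change Clifford.ofRees q _ * Clifford.ofRees q _ = _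
  rw [← map_mul, ReesAlgebra.ofModule_mul_ofDual, AlgHom.commutes]

theorem Clifford.ofVector_mul_self (q : QuadraticMap R M I) (x : M) :
    Clifford.ofVector q x * Clifford.ofVector q x = Clifford.ofModule q (q x) := by
  have := RingQuot.mkAlgHom_rel R (CliffordRel.of (q := q) x)
  change Clifford.mk q _ = Clifford.mk q _ at this
  change Clifford.mk q _ * Clifford.mk q _ = _
  rw [← map_mul]
  refine Eq.trans ?_ this
  simp

theorem ReesAlgebra.induction {motive : ReesAlgebra R I → Prop}
    (scalar : ∀ r, motive (algebraMap R _ r)) (ofModule : ∀ a, motive (ofModule R I a))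
    (ofDual : ∀ α, motive (ofDual R I α)) (mul : ∀ a b, motive a → motive b → motive (a * b))
    (add : ∀ a b, motive a → motive b → motive (a + b)) (l : ReesAlgebra R I) : motive l := by
  obtain ⟨l, rfl⟩ := Ideal.Quotient.mk_surjective l
  induction l using SymmetricAlgebra.induction with
  | algebraMap r => exact scalar r
  | ι x =>
    have h := add _ _ (ofModule x.1) (ofDual x.2)
    have h2 : ReesAlgebra.ofModule R I x.1 + ReesAlgebra.ofDual R I x.2 =
        ReesAlgebra.mk R I (SymmetricAlgebra.ι R (I × Module.Dual R I) x) := by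
      change ReesAlgebra.mk R I (SymmetricAlgebra.ι R _ (x.1, 0)) +
        ReesAlgebra.mk R I (SymmetricAlgebra.ι R _ (0, x.2)) = _
      rw [← map_add, ← map_add]
      simp
    rw [h2] at h
    exact h
  | mul a b ha hb => rw [map_mul]; exact mul _ _ ha hb
  | add a b ha hb => rw [map_add]; exact add _ _ ha hb

theorem Clifford.induction {q : QuadraticMap R M I} {motive : Clifford q → Prop}
    (scalar : ∀ r, motive (algebraMap R _ r))
    (ofVector : ∀ x, motive (Clifford.ofVector q x)) (ofModule : ∀ a, motive (Clifford.ofModule q a))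
    (ofDual : ∀ α, motive (Clifford.ofDual q α))
    (mul : ∀ a b, motive a → motive b → motive (a * b))
    (add : ∀ a b, motive a → motive b → motive (a + b)) (c : Clifford q) : motive c := by
  have hR : ∀ l, motive (Clifford.ofRees q l) := fun l => by
    induction l using ReesAlgebra.induction with
    | scalar r => rw [AlgHom.commutes]; exact scalar r
    | ofModule a => exact ofModule a
    | ofDual α => exact ofDual α
    | mul a b ha hb => rw [map_mul]; exact mul _ _ ha hb
    | add a b ha hb => rw [map_add]; exact add _ _ ha hb
  have hT : ∀ t : TensorAlgebra R M, motive (Clifford.mk q (t ⊗ₜ 1)) := fun t => by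
    induction t using TensorAlgebra.induction with
    | algebraMap r =>
      have : (algebraMap R (TensorAlgebra R M) r) ⊗ₜ[R] (1 : ReesAlgebra R I) =
        algebraMap R _ r := rfl
      rw [this, AlgHom.commutes]
      exact scalar r
    | ι x => exact ofVector x
    | mul a b ha hb =>
      rw [← mul_one (1 : ReesAlgebra R I), ← Algebra.TensorProduct.tmul_mul_tmul, map_mul]
      exact mul _ _ ha hb
    | add a b ha hb => rw [TensorProduct.add_tmul, map_add]; exact add _ _ ha hb
  obtain ⟨c, rfl⟩ := RingQuot.mkAlgHom_surjective R (CliffordRel q) c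
  change motive (Clifford.mk q c)
  induction c with
  | zero => simpa using scalar 0
  | add a b ha hb => rw [map_add]; exact add _ _ ha hb
  | tmul t l =>
    rw [← mul_one t, ← one_mul l, ← Algebra.TensorProduct.tmul_mul_tmul, map_mul]
    exact mul _ _ (hT t) (hR l)

theorem Clifford.ofRees_mem_center (q : QuadraticMap R M I) (l : ReesAlgebra R I) :
    Clifford.ofRees q l ∈ Subalgebra.center R (Clifford q) := by
  rw [Subalgebra.mem_center_iff]
  intro c
  have hcomm : ∀ l', Clifford.ofRees q l' * Clifford.ofRees q l =
      Clifford.ofRees q l * Clifford.ofRees q l' := fun l' => by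
    rw [← map_mul, mul_comm, map_mul]
  induction c using Clifford.induction with
  | scalar r => exact Algebra.commutes r _
  | ofVector x => exact Clifford.commute_ofVector_ofRees q x l
  | ofModule a => exact hcomm _
  | ofDual α => exact hcomm _
  | mul a b ha hb => rw [mul_assoc, hb, ← mul_assoc, ha, mul_assoc]
  | add a b ha hb => rw [add_mul, mul_add, ha, hb]

theorem Clifford.ofModule_mem_center (q : QuadraticMap R M I) (a : I) :
    Clifford.ofModule q a ∈ Subalgebra.center R (Clifford q) :=
  Clifford.ofRees_mem_center q _

theorem Clifford.ofDual_mem_center (q : QuadraticMap R M I) (α : Module.Dual R I) :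
    Clifford.ofDual q α ∈ Subalgebra.center R (Clifford q) :=
  Clifford.ofRees_mem_center q _

theorem Clifford.ofDual_comm (q : QuadraticMap R M I) (α : Module.Dual R I) (c : Clifford q) :
    c * Clifford.ofDual q α = Clifford.ofDual q α * c :=
  Subalgebra.mem_center_iff.mp (Clifford.ofDual_mem_center q α) c

theorem Clifford.algHom_ext {A : Type*} [Semiring A] [Algebra R A] {q : QuadraticMap R M I}
    {F G : Clifford q →ₐ[R] A} (h1 : ∀ x, F (Clifford.ofVector q x) = G (Clifford.ofVector q x))
    (h2 : ∀ a, F (Clifford.ofModule q a) = G (Clifford.ofModule q a))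
    (h3 : ∀ α, F (Clifford.ofDual q α) = G (Clifford.ofDual q α)) : F = G := by
  ext c
  induction c using Clifford.induction with
  | scalar r => rw [AlgHom.commutes, AlgHom.commutes]
  | ofVector x => exact h1 x
  | ofModule a => exact h2 a
  | ofDual α => exact h3 α
  | mul a b ha hb => rw [map_mul, map_mul, ha, hb]
  | add a b ha hb => rw [map_add, map_add, ha, hb]

section Lift

variable {A : Type*} [Ring A] [Algebra R A] (q : QuadraticMap R M I)
  (j : M →ₗ[R] A) (w : I →ₗ[R] A) (w' : Module.Dual R I →ₗ[R] A)
  (hw : ∀ a, w a ∈ Subalgebra.center R A) (hw' : ∀ α, w' α ∈ Subalgebra.center R A)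
  (hww' : ∀ a α, w a * w' α = algebraMap R A (α a)) (hj : ∀ x, j x * j x = w (q x))

/-- The extension of a pair of linear maps on `I` and `I^∨` to the Rees algebra. -/
noncomputable def ReesAlgebra.lift : ReesAlgebra R I →ₐ[R] Subalgebra.center R A :=
  Ideal.Quotient.liftₐ _ (SymmetricAlgebra.lift
    (LinearMap.coprod (w.codRestrict (Subalgebra.center R A).toSubmodule hw)
      (w'.codRestrict (Subalgebra.center R A).toSubmodule hw'))) (by
    intro a ha
    induction ha using Submodule.span_induction with
    | mem x hx =>
      obtain ⟨⟨a, α⟩, rfl⟩ := hx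
      rw [map_sub, map_mul, AlgHom.commutes, SymmetricAlgebra.lift_ι_apply,
        SymmetricAlgebra.lift_ι_apply, sub_eq_zero]
      apply Subtype.ext
      rw [LinearMap.coprod_apply, LinearMap.coprod_apply, map_zero, map_zero, add_zero, zero_add]
      exact hww' a α
    | zero => exact map_zero _
    | add x y _ _ hx hy => rw [map_add, hx, hy, add_zero]
    | smul r x _ hx => rw [smul_eq_mul, map_mul, hx, mul_zero])

theorem ReesAlgebra.lift_ofModule (a : I) :
    (ReesAlgebra.lift w w' hw hw' hww' (ReesAlgebra.ofModule R I a) : A) = w a := by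
  have : ReesAlgebra.lift w w' hw hw' hww' (ReesAlgebra.ofModule R I a) =
    SymmetricAlgebra.lift (LinearMap.coprod (w.codRestrict (Subalgebra.center R A).toSubmodule hw)
      (w'.codRestrict (Subalgebra.center R A).toSubmodule hw'))
      (SymmetricAlgebra.ι R (I × Module.Dual R I) (a, 0)) := rfl
  rw [this, SymmetricAlgebra.lift_ι_apply, LinearMap.coprod_apply, map_zero]
  rw [add_zero]; rfl

theorem ReesAlgebra.lift_ofDual (α : Module.Dual R I) :
    (ReesAlgebra.lift w w' hw hw' hww' (ReesAlgebra.ofDual R I α) : A) = w' α := by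
  have : ReesAlgebra.lift w w' hw hw' hww' (ReesAlgebra.ofDual R I α) =
    SymmetricAlgebra.lift (LinearMap.coprod (w.codRestrict (Subalgebra.center R A).toSubmodule hw)
      (w'.codRestrict (Subalgebra.center R A).toSubmodule hw'))
      (SymmetricAlgebra.ι R (I × Module.Dual R I) (0, α)) := rfl
  rw [this, SymmetricAlgebra.lift_ι_apply, LinearMap.coprod_apply, map_zero]
  rw [zero_add]; rfl

include hw hw' hww' hj in
/-- The universal property of the Clifford algebra, for maps that send `I` and `I^∨` to the
center. -/
theorem Clifford.exists_lift : ∃ F : Clifford q →ₐ[R] A,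
    (∀ x, F (Clifford.ofVector q x) = j x) ∧ (∀ a, F (Clifford.ofModule q a) = w a) ∧
      ∀ α, F (Clifford.ofDual q α) = w' α := by
  let L : ReesAlgebra R I →ₐ[R] A :=
    -- Landing in the center gives the commutative target that the symmetric algebra requires and
    -- the commutation with the vectors that the tensor product requires.
    (Subalgebra.center R A).val.comp (ReesAlgebra.lift w w' hw hw' hww')
  let G : TensorAlgebra R M ⊗[R] ReesAlgebra R I →ₐ[R] A :=
    Algebra.TensorProduct.lift (TensorAlgebra.lift R j) L
      fun t l => Subalgebra.mem_center_iff.mp (ReesAlgebra.lift w w' hw hw' hww' l).2 _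
  have hG : ∀ t l, G (t ⊗ₜ l) = TensorAlgebra.lift R j t * L l := fun t l =>
    Algebra.TensorProduct.lift_tmul _ _ _ _ _
  have hL : ∀ a, L (ReesAlgebra.ofModule R I a) = w a :=
    ReesAlgebra.lift_ofModule w w' hw hw' hww'
  have hL' : ∀ α, L (ReesAlgebra.ofDual R I α) = w' α :=
    ReesAlgebra.lift_ofDual w w' hw hw' hww'
  let F : Clifford q →ₐ[R] A := RingQuot.liftAlgHom R ⟨G, by
    rintro _ _ ⟨x⟩
    rw [hG, hG, map_mul, TensorAlgebra.lift_ι_apply, map_one, map_one, one_mul, mul_one, hL, hj]⟩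
  have hF : ∀ z, F (Clifford.mk q z) = G z := fun z =>
    RingQuot.liftAlgHom_mkAlgHom_apply R _ _ _
  refine ⟨F, fun x => ?_, fun a => ?_, fun α => ?_⟩
  · refine (hF _).trans ((hG _ _).trans ?_)
    rw [map_one, mul_one, TensorAlgebra.lift_ι_apply]
  · refine (hF _).trans ((hG _ _).trans ?_)
    rw [map_one, one_mul, hL]
  · refine (hF _).trans ((hG _ _).trans ?_)
    rw [map_one, one_mul, hL']

end Lift

end CliffordBasic

/-! ### Generators and a spanning set of the even Clifford algebra -/

section EvenPart

variable {R : Type u} {M I : Type v} [CommRing R] [AddCommGroup M] [Module R M]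
  [AddCommGroup I] [Module R I] (q : QuadraticMap R M I)

/-- The element `x y α` of degree `0` of the Clifford algebra. -/
noncomputable def Clifford.bivector (x y : M) (α : Module.Dual R I) : Clifford q :=
  Clifford.ofVector q x * Clifford.ofVector q y * Clifford.ofDual q α

theorem Clifford.ofVector_polar (x y : M) :
    Clifford.ofVector q x * Clifford.ofVector q y + Clifford.ofVector q y * Clifford.ofVector q x =
      Clifford.ofModule q (QuadraticMap.polar q x y) := by
  rw [QuadraticMap.polar, map_sub, map_sub, ← ofVector_mul_self, ← ofVector_mul_self,
    ← ofVector_mul_self, map_add]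
  noncomm_ring

theorem Clifford.bivector_self (x : M) (α : Module.Dual R I) :
    Clifford.bivector q x x α = algebraMap R _ (α (q x)) := by
  rw [bivector, ofVector_mul_self, ofModule_mul_ofDual]

/-- The central `α` moves next to `y y`, and `y y α` collapses to the scalar `α (q y)`. The
quadratic map is later recovered from the algebra through this rule. -/
theorem Clifford.bivector_mul (x y z : M) (α β : Module.Dual R I) :
    Clifford.bivector q x y α * Clifford.bivector q y z β =
      α (q y) • Clifford.bivector q x z β := by
  calc Clifford.bivector q x y α * Clifford.bivector q y z β
      = ofVector q x * (ofVector q y * ofVector q y * ofDual q α) * ofVector q z * ofDual q β := by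
        have := ofDual_comm q α (ofVector q y * ofVector q z * ofDual q β)
        simp only [bivector]
        rw [mul_assoc (ofVector q x * ofVector q y), ← this,
          mul_assoc (ofVector q x) (ofVector q y * ofVector q y * _),
          mul_assoc (ofVector q y * ofVector q y), ← ofDual_comm q α (ofVector q z)]
        simp only [mul_assoc]
        rw [ofDual_comm q α (ofDual q β)]
    _ = _ := by
      rw [ofVector_mul_self, ofModule_mul_ofDual, ← Algebra.commutes, Algebra.smul_def, bivector]
      simp only [mul_assoc]

theorem Clifford.bivector_mem (x y : M) (α : Module.Dual R I) :
    Clifford.bivector q x y α ∈ evenClifford q := by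
  refine (le_iSup (f := fun t : {t : ℕ × ℕ × ℕ // (t.1 : ℤ) + 2 * t.2.1 - 2 * t.2.2 = 0} =>
    LinearMap.range (Clifford.ofVector q) ^ t.1.1 *
      (((LinearMap.range (ReesAlgebra.ofModule R I)).map (Clifford.ofRees q).toLinearMap) ^ t.1.2.1 *
        ((LinearMap.range (ReesAlgebra.ofDual R I)).map
          (Clifford.ofRees q).toLinearMap) ^ t.1.2.2)) ⟨(2, 0, 1), by simp⟩) ?_
  simp only [pow_zero, one_mul, pow_one, sq]
  exact Submodule.mul_mem_mul (Submodule.mul_mem_mul ⟨x, rfl⟩ ⟨y, rfl⟩) ⟨_, ⟨α, rfl⟩, rfl⟩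

/-- The set of all elements `x y α`. -/
def Clifford.bivectors : Set (Clifford q) :=
  {c | ∃ x y α, Clifford.bivector q x y α = c}

/-- In degree `0` a product of `i` vectors, `j` elements of `I` and `k` functionals has `k = j + n`
and `i = 2 n`. By centrality it regroups into `j` factors `a α`, which are scalars, and `n` factors
`x y α`. -/
theorem evenClifford_eq_adjoin :
    evenClifford q = Algebra.adjoin R (Clifford.bivectors q) := by
  refine le_antisymm ?_ (Algebra.adjoin_le ?_)
  · set T := Algebra.adjoin R (Clifford.bivectors q)
    have hX := Clifford.commute_range_map q (LinearMap.range (ReesAlgebra.ofDual R I))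
    have hYZ := Clifford.commute_map_map q (LinearMap.range (ReesAlgebra.ofModule R I))
      (LinearMap.range (ReesAlgebra.ofDual R I))
    change Clifford.component q 0 ≤ Subalgebra.toSubmodule T
    refine iSup_le ?_
    rintro ⟨⟨i, j, k⟩, h⟩
    dsimp only at h ⊢
    set X := LinearMap.range (Clifford.ofVector q)
    set Y := (LinearMap.range (ReesAlgebra.ofModule R I)).map (Clifford.ofRees q).toLinearMap
    set Z := (LinearMap.range (ReesAlgebra.ofDual R I)).map (Clifford.ofRees q).toLinearMap
    obtain ⟨n, rfl⟩ : ∃ n, k = j + n := ⟨k - j, by lia⟩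
    obtain rfl : i = 2 * n := by lia
    have h1 : Y * Z ≤ 1 := by
      rw [Submodule.mul_le]
      rintro _ ⟨_, ⟨a, rfl⟩, rfl⟩ _ ⟨_, ⟨α, rfl⟩, rfl⟩
      exact Submodule.mem_one.mpr ⟨α a, (Clifford.ofModule_mul_ofDual q a α).symm⟩
    have h2 : X ^ 2 * Z ≤ Subalgebra.toSubmodule T := by
      rw [sq, Submodule.mul_le]
      intro c hc _ hd
      obtain ⟨_, ⟨α, rfl⟩, rfl⟩ := hd
      induction hc using Submodule.mul_induction_on' with
      | mem_mul_mem a ha b hb =>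
        obtain ⟨x, rfl⟩ := ha
        obtain ⟨y, rfl⟩ := hb
        exact Algebra.subset_adjoin ⟨x, y, α, rfl⟩
      | add a _ b _ ha hb => rw [add_mul]; exact add_mem ha hb
    have h3 : ∀ n, (Subalgebra.toSubmodule T) ^ n ≤ Subalgebra.toSubmodule T := by
      intro n
      induction n with
      | zero => rw [pow_zero, Submodule.one_le]; exact T.one_mem
      | succ n ih =>
        rw [pow_succ]
        exact (mul_le_mul_left ih _).trans (Subalgebra.mul_toSubmodule_le T T |>.trans (by simp))
    calc X ^ (2 * n) * (Y ^ j * Z ^ (j + n)) = (Y * Z) ^ j * (X ^ 2 * Z) ^ n := by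
          rw [hYZ.mul_pow, (hX.pow_left 2).mul_pow, pow_add, ← pow_mul, ← mul_assoc, ← mul_assoc,
            ← mul_assoc, mul_assoc (X ^ _)]
          rw [(((Clifford.commute_range_map q (LinearMap.range (ReesAlgebra.ofModule R I))).pow_pow
            (2 * n) j).mul_right (hX.pow_pow (2 * n) j)).eq]
      _ ≤ 1 ^ j * (Subalgebra.toSubmodule T) ^ n :=
          mul_le_mul' (pow_le_pow_left' h1 j) (pow_le_pow_left' h2 n)
      _ ≤ Subalgebra.toSubmodule T := by rw [one_pow, one_mul]; exact h3 n
  · rintro _ ⟨x, y, α, rfl⟩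
    exact Clifford.bivector_mem q x y α

/-- The span of `1` and of the elements `x y α`. -/
def Clifford.evenSpan : Submodule R (Clifford q) :=
  Submodule.span R (insert 1 (Clifford.bivectors q))

variable {q}

theorem Clifford.bivector_mem_evenSpan (x y : M) (α : Module.Dual R I) :
    Clifford.bivector q x y α ∈ Clifford.evenSpan q :=
  Submodule.subset_span (Or.inr ⟨x, y, α, rfl⟩)

theorem Clifford.one_mem_evenSpan : 1 ∈ Clifford.evenSpan q :=
  Submodule.subset_span (Or.inl rfl)

variable [Module.Finite R M] [Module.Projective R M]

/-- Modulo the span, the product `x y z w α β` is alternating in its four vectors: a repeated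
neighbour turns it into a multiple of a shorter product. In rank three such a form vanishes. -/
theorem Clifford.bivector_mul_mem (hM : ∀ p : PrimeSpectrum R, Module.rankAtStalk (R := R) M p = 3)
    (x y z w : M) (α β : Module.Dual R I) :
    Clifford.bivector q x y α * Clifford.bivector q z w β ∈ Clifford.evenSpan q := by
  let V := Clifford.ofVector q
  let γ := Clifford.ofDual q α * Clifford.ofDual q β
  let F : M →ₗ[R] M →ₗ[R] M →ₗ[R] M →ₗ[R] (Clifford q ⧸ Clifford.evenSpan q) :=
    LinearMap.mk₂ R (fun x y => LinearMap.mk₂ R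
      (fun z w => (Clifford.evenSpan q).mkQ (V x * V y * (V z * V w) * γ))
      (by simp [mul_add, add_mul]) (by simp) (by simp [mul_add, add_mul]) (by simp))
      (by intros; ext; simp [add_mul]) (by intros; ext; simp)
      (by intros; ext; simp [mul_add, add_mul]) (by intros; ext; simp)
  have hF : ∀ x y z w, F x y z w =
      (Clifford.evenSpan q).mkQ (Clifford.bivector q x y α * Clifford.bivector q z w β) := by
    intro x y z w
    have := Clifford.ofDual_comm q α (V z * V w)
    change (Clifford.evenSpan q).mkQ (V x * V y * (V z * V w) * (Clifford.ofDual q α * _)) =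
      (Clifford.evenSpan q).mkQ (V x * V y * Clifford.ofDual q α * (V z * V w * _))
    rw [mul_assoc (V x * V y) (Clifford.ofDual q α), ← mul_assoc (Clifford.ofDual q α), ← this]
    simp only [mul_assoc]
  have h0 := alt₄_eq_zero hM F (fun x z w => ?_) (fun x y w => ?_) (fun x y z => ?_) x y z w
  · rw [hF] at h0
    exact (Submodule.Quotient.mk_eq_zero _).mp h0
  all_goals
    rw [hF]
    refine (Submodule.Quotient.mk_eq_zero _).mpr ?_
  · rw [bivector_self, ← Algebra.smul_def]
    exact Submodule.smul_mem _ _ (bivector_mem_evenSpan _ _ _)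
  · rw [bivector_mul]
    exact Submodule.smul_mem _ _ (bivector_mem_evenSpan _ _ _)
  · rw [bivector_self, ← Algebra.commutes, ← Algebra.smul_def]
    exact Submodule.smul_mem _ _ (bivector_mem_evenSpan _ _ _)

theorem evenClifford_toSubmodule (hM : ∀ p : PrimeSpectrum R, Module.rankAtStalk (R := R) M p = 3) :
    Subalgebra.toSubmodule (evenClifford q) = Clifford.evenSpan q := by
  apply le_antisymm
  · have hmul : ∀ a b, a ∈ Clifford.evenSpan q → b ∈ Clifford.evenSpan q →
        a * b ∈ Clifford.evenSpan q := by
      intro a b ha hb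
      refine Submodule.mul_le.mp ?_ a ha b hb
      rw [Clifford.evenSpan, Submodule.span_mul_span, Submodule.span_le]
      rintro _ ⟨a, ha, b, hb, rfl⟩
      dsimp only
      rcases ha with rfl | ⟨x, y, α, rfl⟩
      · rw [one_mul]; exact Submodule.subset_span hb
      · rcases hb with rfl | ⟨z, w, β, rfl⟩
        · rw [mul_one]; exact Clifford.bivector_mem_evenSpan x y α
        · exact Clifford.bivector_mul_mem hM x y z w α β
    have hle : evenClifford q ≤
        (Clifford.evenSpan q).toSubalgebra Clifford.one_mem_evenSpan hmul := by
      rw [evenClifford_eq_adjoin]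
      exact Algebra.adjoin_le fun c hc => Submodule.subset_span (Or.inr hc)
    exact fun c hc => hle hc
  · rw [Clifford.evenSpan, Submodule.span_le]
    rintro _ (rfl | ⟨x, y, α, rfl⟩)
    · exact (evenClifford q).one_mem
    · exact Clifford.bivector_mem q x y α

end EvenPart

/-! ### The projection onto degree zero -/

section Grading

variable {R : Type u} {M I : Type v} [CommRing R] [AddCommGroup M] [Module R M]
  [AddCommGroup I] [Module R I] (q : QuadraticMap R M I)

theorem Clifford.ofVector_mem_component (x : M) :
    Clifford.ofVector q x ∈ Clifford.component q 1 := by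
  refine (le_iSup (f := fun t : {t : ℕ × ℕ × ℕ // (t.1 : ℤ) + 2 * t.2.1 - 2 * t.2.2 = 1} =>
    LinearMap.range (Clifford.ofVector q) ^ t.1.1 *
      (((LinearMap.range (ReesAlgebra.ofModule R I)).map (Clifford.ofRees q).toLinearMap) ^ t.1.2.1 *
        ((LinearMap.range (ReesAlgebra.ofDual R I)).map
          (Clifford.ofRees q).toLinearMap) ^ t.1.2.2)) ⟨(1, 0, 0), by simp⟩) ?_
  simp only [pow_zero, mul_one, pow_one]
  exact ⟨x, rfl⟩

theorem Clifford.ofModule_mem_component (a : I) :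
    Clifford.ofModule q a ∈ Clifford.component q 2 := by
  refine (le_iSup (f := fun t : {t : ℕ × ℕ × ℕ // (t.1 : ℤ) + 2 * t.2.1 - 2 * t.2.2 = 2} =>
    LinearMap.range (Clifford.ofVector q) ^ t.1.1 *
      (((LinearMap.range (ReesAlgebra.ofModule R I)).map (Clifford.ofRees q).toLinearMap) ^ t.1.2.1 *
        ((LinearMap.range (ReesAlgebra.ofDual R I)).map
          (Clifford.ofRees q).toLinearMap) ^ t.1.2.2)) ⟨(0, 1, 0), by simp⟩) ?_
  simp only [pow_zero, mul_one, one_mul, pow_one]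
  exact ⟨_, ⟨a, rfl⟩, rfl⟩

theorem Clifford.ofDual_mem_component (α : Module.Dual R I) :
    Clifford.ofDual q α ∈ Clifford.component q (-2) := by
  refine (le_iSup (f := fun t : {t : ℕ × ℕ × ℕ // (t.1 : ℤ) + 2 * t.2.1 - 2 * t.2.2 = -2} =>
    LinearMap.range (Clifford.ofVector q) ^ t.1.1 *
      (((LinearMap.range (ReesAlgebra.ofModule R I)).map (Clifford.ofRees q).toLinearMap) ^ t.1.2.1 *
        ((LinearMap.range (ReesAlgebra.ofDual R I)).map
          (Clifford.ofRees q).toLinearMap) ^ t.1.2.2)) ⟨(0, 0, 1), by simp⟩) ?_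
  simp only [pow_zero, one_mul, pow_one]
  exact ⟨_, ⟨α, rfl⟩, rfl⟩

/-- The even Clifford algebra is a direct summand of the Clifford algebra. -/
theorem evenClifford_exists_retraction :
    ∃ ρ : Clifford q →ₗ[R] evenClifford q, ∀ c : evenClifford q, ρ c = c := by
  -- `A` is the ring of Laurent polynomials over the Clifford algebra. The map `G` below multiplies
  -- a generator of degree `n` by the `n`-th power of the variable, so its constant coefficient is
  -- the projection onto degree `0`; independence of the components need not be known beforehand.
  let A := AddMonoidAlgebra (Clifford q) ℤ
  let σ : ℤ → Clifford q →ₗ[R] A := fun n => AddMonoidAlgebra.lsingle n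
  have hσ : ∀ n m c d, σ n c * σ m d = σ (n + m) (c * d) := fun n m c d =>
    AddMonoidAlgebra.single_mul_single n m c d
  have hcent : ∀ n c, c ∈ Subalgebra.center R (Clifford q) → σ n c ∈ Subalgebra.center R A := by
    intro n c hc
    rw [Subalgebra.mem_center_iff]
    intro p
    induction p using AddMonoidAlgebra.induction_linear with
    | zero => rw [zero_mul, mul_zero]
    | add a b ha hb => rw [add_mul, mul_add, ha, hb]
    | single m d =>
      refine (hσ m n d c).trans (Eq.trans ?_ (hσ n m c d).symm)
      rw [add_comm, Subalgebra.mem_center_iff.mp hc]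
  obtain ⟨G, h1, h2, h3⟩ := Clifford.exists_lift q (σ 1 ∘ₗ Clifford.ofVector q)
    (σ 2 ∘ₗ Clifford.ofModule q) (σ (-2) ∘ₗ Clifford.ofDual q)
    (fun a => hcent _ _ (Clifford.ofModule_mem_center q a))
    (fun a => hcent _ _ (Clifford.ofDual_mem_center q a))
    (fun a α => by
      simp only [LinearMap.comp_apply]
      rw [hσ, Clifford.ofModule_mul_ofDual]
      rfl)
    (fun x => by
      simp only [LinearMap.comp_apply]
      rw [hσ, Clifford.ofVector_mul_self]
      rfl)
  have hmem : ∀ c n, (G c).coeff n ∈ Clifford.component q n := by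
    classical
    have hsingle : ∀ m c, c ∈ Clifford.component q m → ∀ n,
        (σ m c).coeff n ∈ Clifford.component q n := by
      intro m c hc n
      change (AddMonoidAlgebra.single m c).coeff n ∈ _
      rw [AddMonoidAlgebra.coeff_single, Finsupp.single_apply]
      split_ifs with h
      · exact h ▸ hc
      · exact Submodule.zero_mem _
    intro c
    induction c using Clifford.induction with
    | scalar r =>
      rw [AlgHom.commutes]
      exact hsingle 0 _ (by
        rw [Algebra.algebraMap_eq_smul_one]
        exact Submodule.smul_mem _ _ (Clifford.one_mem_component q))
    | ofVector x => rw [h1]; exact hsingle 1 _ (Clifford.ofVector_mem_component q x)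
    | ofModule a => rw [h2]; exact hsingle 2 _ (Clifford.ofModule_mem_component q a)
    | ofDual α => rw [h3]; exact hsingle (-2) _ (Clifford.ofDual_mem_component q α)
    | add a b ha hb =>
      intro n
      rw [map_add, AddMonoidAlgebra.coeff_add, Finsupp.add_apply]
      exact Submodule.add_mem _ (ha n) (hb n)
    | mul a b ha hb =>
      intro n
      rw [map_mul, AddMonoidAlgebra.coeff_mul]
      refine Submodule.sum_mem _ fun k _ => Submodule.sum_mem _ fun l _ => ?_
      dsimp only
      split_ifs with h
      · rw [← h]
        exact Clifford.component_mul_le q k l (Submodule.mul_mem_mul (ha k) (hb l))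
      · exact Submodule.zero_mem _
  have hG : ∀ c ∈ evenClifford q, G c = σ 0 c := by
    intro c hc
    rw [evenClifford_eq_adjoin] at hc
    induction hc using Algebra.adjoin_induction with
    | mem c hc =>
      obtain ⟨x, y, α, rfl⟩ := hc
      rw [Clifford.bivector, map_mul, map_mul, h1, h1, h3]
      simp only [LinearMap.comp_apply, hσ]
      norm_num
    | algebraMap r => rw [AlgHom.commutes]; rfl
    | add a b _ _ ha hb => rw [map_add, map_add, ha, hb]
    | mul a b _ _ ha hb => rw [map_mul, ha, hb, hσ, add_zero]
  let ρ : Clifford q →ₗ[R] Clifford q :=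
    { toFun := fun c => (G c).coeff 0
      map_add' := fun a b => by rw [map_add]; rfl
      map_smul' := fun r a => by rw [map_smul]; rfl }
  refine ⟨ρ.codRestrict (Subalgebra.toSubmodule (evenClifford q)) fun c => hmem c 0, fun c => ?_⟩
  apply Subtype.ext
  change (G c).coeff 0 = _
  rw [hG c c.2]
  exact Finsupp.single_eq_same

end Grading

/-! ### Extension of scalars -/

section BaseChange

theorem quadraticBaseChange_tmul {R M N : Type*} (S : Type*) [CommRing R] [CommRing S] [Algebra R S]
    [AddCommGroup M] [Module R M] [Module.Projective R M] [AddCommGroup N] [Module R N]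
    (q : QuadraticMap R M N) (s : S) (m : M) :
    quadraticBaseChange S q (s ⊗ₜ m) = (s * s) ⊗ₜ q m :=
  (existsUnique_baseChange S q).choose_spec.1.1 s m

theorem polar_quadraticBaseChange_tmul {R M N : Type*} (S : Type*) [CommRing R] [CommRing S]
    [Algebra R S] [AddCommGroup M] [Module R M] [Module.Projective R M] [AddCommGroup N]
    [Module R N] (q : QuadraticMap R M N) (s s' : S) (m m' : M) :
    QuadraticMap.polar (quadraticBaseChange S q) (s ⊗ₜ m) (s' ⊗ₜ m') =
      (s * s') ⊗ₜ QuadraticMap.polar q m m' :=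
  (existsUnique_baseChange S q).choose_spec.1.2 s m s' m'

/-- The square of a linear map to an algebra, as a quadratic map. -/
noncomputable def linearSq {R M A : Type*} [CommRing R] [AddCommGroup M] [Module R M] [Ring A]
    [Algebra R A] (j : M →ₗ[R] A) : QuadraticMap R M A :=
  LinearMap.BilinMap.toQuadraticMap ((LinearMap.mul R A).compl₁₂ j j)

theorem linearSq_apply {R M A : Type*} [CommRing R] [AddCommGroup M] [Module R M] [Ring A]
    [Algebra R A] (j : M →ₗ[R] A) (x : M) : linearSq j x = j x * j x := rfl

theorem polar_linearSq {R M A : Type*} [CommRing R] [AddCommGroup M] [Module R M] [Ring A]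
    [Algebra R A] (j : M →ₗ[R] A) (x y : M) :
    QuadraticMap.polar (linearSq j) x y = j x * j y + j y * j x := by
  simp only [QuadraticMap.polar, linearSq_apply, map_add]
  noncomm_ring

theorem tmul_mem_center {R S A : Type*} [CommRing R] [CommRing S] [Algebra R S] [Ring A]
    [Algebra R A] {c : A} (hc : c ∈ Subalgebra.center R A) (s : S) :
    s ⊗ₜ[R] c ∈ Subalgebra.center S (S ⊗[R] A) := by
  rw [Subalgebra.mem_center_iff]
  intro z
  induction z with
  | zero => rw [zero_mul, mul_zero]
  | add a b ha hb => rw [add_mul, mul_add, ha, hb]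
  | tmul t d =>
    rw [Algebra.TensorProduct.tmul_mul_tmul, Algebra.TensorProduct.tmul_mul_tmul, mul_comm,
      Subalgebra.mem_center_iff.mp hc]

variable {R : Type u} {M I : Type u} [CommRing R] [AddCommGroup M] [Module R M]
  [Module.Projective R M] [AddCommGroup I] [Module R I] [Module.Invertible R I]
  (S : Type u) [CommRing S] [Algebra R S] (q : QuadraticMap R M I)

/-- The extension of scalars of a functional. -/
noncomputable def dualBaseChange : Module.Dual R I →ₗ[R] Module.Dual S (S ⊗[R] I) where
  toFun α := (Algebra.linearMap R S ∘ₗ α).liftBaseChange S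
  map_add' α β := by ext; simp
  map_smul' r α := by ext; simp [Algebra.smul_def]

omit [Module.Invertible R I] in
theorem dualBaseChange_tmul (α : Module.Dual R I) (s : S) (a : I) :
    dualBaseChange S α (s ⊗ₜ a) = s * algebraMap R S (α a) := by
  simp [dualBaseChange]

omit [Module.Invertible R I] in
theorem Clifford.exists_lift_baseChange {A : Type*} [Ring A] [Algebra S A]
    (j : S ⊗[R] M →ₗ[S] A) (w : S ⊗[R] I →ₗ[S] A) (w' : Module.Dual S (S ⊗[R] I) →ₗ[S] A)
    (hw : ∀ z, w z ∈ Subalgebra.center S A) (hw' : ∀ h, w' h ∈ Subalgebra.center S A)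
    (hww' : ∀ z h, w z * w' h = algebraMap S A (h z))
    (hj : ∀ z, j z * j z = w (quadraticBaseChange S q z)) :
    ∃ F : S ⊗[R] Clifford q →ₐ[S] A,
      (∀ s x, F (s ⊗ₜ ofVector q x) = j (s ⊗ₜ x)) ∧
      (∀ s a, F (s ⊗ₜ ofModule q a) = w (s ⊗ₜ a)) ∧
      (∀ α, F (1 ⊗ₜ ofDual q α) = w' (dualBaseChange S α)) := by
  let _ : Algebra R A := Algebra.compHom A (algebraMap R S)
  have _ : IsScalarTower R S A := .of_algebraMap_eq fun _ => rfl
  obtain ⟨F, h1, h2, h3⟩ := Clifford.exists_lift q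
    (j.restrictScalars R ∘ₗ TensorProduct.mk R S M 1)
    (w.restrictScalars R ∘ₗ TensorProduct.mk R S I 1)
    (w'.restrictScalars R ∘ₗ dualBaseChange S)
    (fun a => Subalgebra.mem_center_iff.mpr (Subalgebra.mem_center_iff.mp (hw (1 ⊗ₜ a))))
    (fun a => Subalgebra.mem_center_iff.mpr
      (Subalgebra.mem_center_iff.mp (hw' (dualBaseChange S a))))
    (fun a α => by
      refine (hww' _ _).trans ?_
      rw [TensorProduct.mk_apply, dualBaseChange_tmul, one_mul, ← IsScalarTower.algebraMap_apply])
    (fun x => by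
      refine (hj _).trans ?_
      rw [TensorProduct.mk_apply, quadraticBaseChange_tmul, one_mul]
      rfl)
  let E : S ⊗[R] Clifford q →ₐ[S] A :=
    Algebra.TensorProduct.lift (Algebra.ofId S _) F (fun s c => Algebra.commutes s _)
  have hE : ∀ s c, E (s ⊗ₜ c) = s • F c := fun s c => by
    rw [Algebra.smul_def]
    exact Algebra.TensorProduct.lift_tmul _ _ _ _ _
  refine ⟨E, fun s x => ?_, fun s a => ?_, fun α => ?_⟩
  · rw [hE, h1]
    change s • j (1 ⊗ₜ x) = _
    rw [← map_smul, TensorProduct.smul_tmul', smul_eq_mul, mul_one]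
  · rw [hE, h2]
    change s • w (1 ⊗ₜ a) = _
    rw [← map_smul, TensorProduct.smul_tmul', smul_eq_mul, mul_one]
  · rw [hE, h3, one_smul]
    rfl

omit [Module.Invertible R I] in
theorem Clifford.exists_toBaseChange :
    ∃ F : S ⊗[R] Clifford q →ₐ[S] Clifford (quadraticBaseChange S q),
      (∀ s x, F (s ⊗ₜ ofVector q x) = ofVector _ (s ⊗ₜ x)) ∧
      (∀ s a, F (s ⊗ₜ ofModule q a) = ofModule _ (s ⊗ₜ a)) ∧
      (∀ α, F (1 ⊗ₜ ofDual q α) = ofDual _ (dualBaseChange S α)) :=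
  exists_lift_baseChange S q (ofVector _) (ofModule _) (ofDual _) (ofModule_mem_center _)
    (ofDual_mem_center _) (ofModule_mul_ofDual _) (ofVector_mul_self _)

/-- The delicate point is where to send a functional `h` on `S ⊗ I`. Elements with `∑ αᵢ (aᵢ) = 1`
also satisfy `∑ αᵢ (a) aᵢ = a`, by rank one, so `h` is the combination of the extended `αᵢ` with
coefficients `h (1 ⊗ aᵢ)`. This dictates its image. -/
theorem Clifford.exists_ofBaseChange :
    ∃ G : Clifford (quadraticBaseChange S q) →ₐ[S] S ⊗[R] Clifford q,
      (∀ s x, G (ofVector _ (s ⊗ₜ x)) = s ⊗ₜ ofVector q x) ∧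
      (∀ s a, G (ofModule _ (s ⊗ₜ a)) = s ⊗ₜ ofModule q a) ∧
      (∀ h, ∃ ι : Finset (Module.Dual R I × I), (∀ a, ∑ i ∈ ι, i.1 a • i.2 = a) ∧
        (∀ h' : Module.Dual S (S ⊗[R] I), h' = ∑ i ∈ ι, h' (1 ⊗ₜ i.2) • dualBaseChange S i.1) ∧
        G (ofDual _ h) = ∑ i ∈ ι, h (1 ⊗ₜ i.2) ⊗ₜ[R] ofDual q i.1) := by
  obtain ⟨ι, hι⟩ := exists_sum_dual_eq_one (R := R) (P := I)
  have hsum : ∀ a : I, ∑ i ∈ ι, i.1 a • i.2 = a := fun a => by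
    simp_rw [fun i : Module.Dual R I × I => dual_smul_comm i.1 a i.2]
    rw [← Finset.sum_smul, hι, one_smul]
  have hexp : ∀ (h : Module.Dual S (S ⊗[R] I)) (s : S) (a : I),
      h (s ⊗ₜ a) = s * ∑ i ∈ ι, i.1 a • h (1 ⊗ₜ i.2) := fun h s a => by
    have h1 : s ⊗ₜ[R] a = s • ∑ i ∈ ι, i.1 a • ((1 : S) ⊗ₜ[R] i.2) := by
      simp_rw [← TensorProduct.tmul_smul]
      rw [← TensorProduct.tmul_sum, hsum, TensorProduct.smul_tmul', smul_eq_mul, mul_one]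
    rw [h1, map_smul, map_sum, smul_eq_mul]
    simp_rw [LinearMap.map_smul_of_tower]
  set qS := quadraticBaseChange S q
  let j := (ofVector q).baseChange S
  let w := (ofModule q).baseChange S
  let w' : Module.Dual S (S ⊗[R] I) →ₗ[S] S ⊗[R] Clifford q :=
    ∑ i ∈ ι, (LinearMap.applyₗ ((1 : S) ⊗ₜ[R] i.2)).smulRight ((1 : S) ⊗ₜ[R] ofDual q i.1)
  have hw' : ∀ h, w' h = ∑ i ∈ ι, h (1 ⊗ₜ i.2) ⊗ₜ[R] ofDual q i.1 := fun h => by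
    simp [w', LinearMap.sum_apply, TensorProduct.smul_tmul']
  have hw : ∀ s a, w (s ⊗ₜ a) = s ⊗ₜ ofModule q a := fun s a => rfl
  have hj : ∀ s x, j (s ⊗ₜ x) = s ⊗ₜ ofVector q x := fun s x => rfl
  have hsq : linearSq j = w.compQuadraticMap qS := by
    refine quadraticMap_tensor_ext (fun s x => ?_) (fun s x s' x' => ?_)
    · rw [linearSq_apply, LinearMap.compQuadraticMap_apply, quadraticBaseChange_tmul, hj, hw,
        Algebra.TensorProduct.tmul_mul_tmul, ofVector_mul_self]
    · rw [polar_linearSq, polar_compQuadraticMap, polar_quadraticBaseChange_tmul, hj, hj, hw,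
        Algebra.TensorProduct.tmul_mul_tmul, Algebra.TensorProduct.tmul_mul_tmul,
        ← ofVector_polar, TensorProduct.tmul_add, mul_comm s' s]
  obtain ⟨G, h1, h2, h3⟩ := Clifford.exists_lift qS j w w'
    (fun z => by
      induction z with
      | zero => rw [map_zero]; exact zero_mem _
      | add a b ha hb => rw [map_add]; exact add_mem ha hb
      | tmul s a => exact tmul_mem_center (ofModule_mem_center q a) s)
    (fun h => by
      rw [hw']
      exact sum_mem fun i _ => tmul_mem_center (ofDual_mem_center q _) _)
    (fun z h => by
      induction z with
      | zero => simp
      | add a b ha hb => rw [map_add, add_mul, ha, hb, map_add, map_add]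
      | tmul s a =>
        rw [hw, hw', Finset.mul_sum]
        simp_rw [Algebra.TensorProduct.tmul_mul_tmul, ofModule_mul_ofDual,
          Algebra.algebraMap_eq_smul_one, ← TensorProduct.smul_tmul]
        rw [← TensorProduct.sum_tmul]
        rw [hexp, Algebra.TensorProduct.one_def,
          TensorProduct.smul_tmul', smul_eq_mul, mul_one, Finset.mul_sum]
        simp_rw [mul_smul_comm])
    (fun z => (linearSq_apply j z).symm.trans (congrArg (fun Q => Q z) hsq))
  refine ⟨G, fun s x => h1 _, fun s a => h2 _, fun h => ⟨ι, hsum, fun h' => ?_, ?_⟩⟩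
  · ext a
    change h' (1 ⊗ₜ a) = (∑ i ∈ ι, h' (1 ⊗ₜ i.2) • dualBaseChange S i.1) (1 ⊗ₜ a)
    rw [hexp, one_mul, LinearMap.sum_apply]
    refine Finset.sum_congr rfl fun i _ => ?_
    rw [LinearMap.smul_apply, dualBaseChange_tmul, one_mul, Algebra.smul_def, smul_eq_mul, mul_comm]
  · rw [h3, hw']

/-- The even Clifford algebra commutes with extension of scalars. -/
theorem evenClifford_baseChange :
    Nonempty (S ⊗[R] evenClifford q ≃ₐ[S] evenClifford (quadraticBaseChange S q)) := by
  obtain ⟨F, F1, F2, F3⟩ := Clifford.exists_toBaseChange S q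
  obtain ⟨G, G1, G2, G3⟩ := Clifford.exists_ofBaseChange S q
  have G4 : ∀ α, G (Clifford.ofDual _ (dualBaseChange S α)) = 1 ⊗ₜ Clifford.ofDual q α := by
    intro α
    obtain ⟨ι, hι, -, h⟩ := G3 (dualBaseChange S α)
    have hα : ∑ i ∈ ι, α i.2 • i.1 = α := by
      ext a
      conv_rhs => rw [← hι a]
      simp [mul_comm]
    rw [h]
    conv_rhs => rw [← hα, map_sum, TensorProduct.tmul_sum]
    refine Finset.sum_congr rfl fun i _ => ?_
    rw [dualBaseChange_tmul, one_mul, map_smul, ← TensorProduct.smul_tmul,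
      Algebra.algebraMap_eq_smul_one]
  -- This one composite suffices: it makes `F` injective, and the image of the even part is computed
  -- directly in `hrange`.
  have hGF : ∀ z, G (F z) = z := by
    have h : ((G.comp F).restrictScalars R).comp Algebra.TensorProduct.includeRight =
        (Algebra.TensorProduct.includeRight : Clifford q →ₐ[R] S ⊗[R] Clifford q) := by
      refine Clifford.algHom_ext (fun x => ?_) (fun a => ?_) (fun α => ?_)
      · exact (congrArg G (F1 _ _)).trans (G1 _ _)
      · exact (congrArg G (F2 _ _)).trans (G2 _ _)
      · exact (congrArg G (F3 _)).trans (G4 _)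
    intro z
    induction z with
    | zero => rw [map_zero, map_zero]
    | add a b ha hb => rw [map_add, map_add, ha, hb]
    | tmul s c =>
      rw [← mul_one s, ← smul_eq_mul, ← TensorProduct.smul_tmul', map_smul, map_smul]
      exact congrArg (s • ·) (AlgHom.congr_fun h c)
  let ν : S ⊗[R] evenClifford q →ₐ[S] S ⊗[R] Clifford q :=
    Algebra.TensorProduct.map (AlgHom.id S S) (evenClifford q).val
  -- The retraction onto the even part survives extension of scalars, so no flatness of `S` is
  -- needed.
  have hν : Function.Injective ν := by
    obtain ⟨ρ, hρ⟩ := evenClifford_exists_retraction q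
    refine Function.LeftInverse.injective (g := ρ.baseChange S) fun z => ?_
    induction z with
    | zero => simp
    | add a b ha hb => rw [map_add, map_add, ha, hb]
    | tmul s c =>
      change s ⊗ₜ[R] ρ c = _
      rw [hρ]
  have hinj : Function.Injective (F.comp ν) :=
    (Function.LeftInverse.injective hGF).comp hν
  have hbiv : ∀ s x y α, F (s ⊗ₜ Clifford.bivector q x y α) =
      Clifford.bivector _ (s ⊗ₜ x) (1 ⊗ₜ y) (dualBaseChange S α) := fun s x y α => by
    have : s ⊗ₜ[R] Clifford.bivector q x y α = (s ⊗ₜ Clifford.ofVector q x) *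
        (1 ⊗ₜ Clifford.ofVector q y) * (1 ⊗ₜ Clifford.ofDual q α) := by
      rw [Algebra.TensorProduct.tmul_mul_tmul, Algebra.TensorProduct.tmul_mul_tmul, mul_one,
        mul_one]
      rfl
    rw [this, map_mul, map_mul, F1, F1, F3]
    rfl
  have hrange : (F.comp ν).range = evenClifford (quadraticBaseChange S q) := by
    apply le_antisymm
    · rintro _ ⟨z, rfl⟩
      change F (ν z) ∈ _
      induction z with
      | zero => rw [map_zero, map_zero]; exact zero_mem _
      | add a b ha hb => rw [map_add, map_add]; exact add_mem ha hb
      | tmul s c =>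
        obtain ⟨c, hc⟩ := c
        change F (s ⊗ₜ c) ∈ _
        rw [← mul_one s, ← smul_eq_mul, ← TensorProduct.smul_tmul', map_smul]
        refine Subalgebra.smul_mem _ ?_ s
        rw [evenClifford_eq_adjoin] at hc
        induction hc using Algebra.adjoin_induction with
        | mem c hc =>
          obtain ⟨x, y, α, rfl⟩ := hc
          rw [hbiv]
          exact Clifford.bivector_mem _ _ _ _
        | algebraMap r =>
          have : (1 : S) ⊗ₜ[R] algebraMap R (Clifford q) r = algebraMap S _ (algebraMap R S r) := by
            rw [Algebra.algebraMap_eq_smul_one, ← TensorProduct.smul_tmul,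
              ← Algebra.algebraMap_eq_smul_one]
            rfl
          rw [this, AlgHom.commutes]
          exact Subalgebra.algebraMap_mem _ _
        | add a b _ _ ha hb => rw [TensorProduct.tmul_add, map_add]; exact add_mem ha hb
        | mul a b _ _ ha hb =>
          rw [← mul_one (1 : S), ← Algebra.TensorProduct.tmul_mul_tmul, map_mul]
          exact mul_mem ha hb
    · rw [evenClifford_eq_adjoin]
      refine Algebra.adjoin_le ?_
      rintro _ ⟨z, z', h, rfl⟩
      obtain ⟨ι, -, hι, -⟩ := G3 h
      have hmem : ∀ s x y α, Clifford.bivector (quadraticBaseChange S q) (s ⊗ₜ x) (1 ⊗ₜ y)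
          (dualBaseChange S α) ∈ (F.comp ν).range := fun s x y α =>
        ⟨s ⊗ₜ ⟨_, Clifford.bivector_mem q x y α⟩, hbiv s x y α⟩
      change _ ∈ (F.comp ν).range
      induction z with
      | zero => rw [Clifford.bivector, map_zero, zero_mul, zero_mul]; exact zero_mem _
      | add a b ha hb =>
        simp only [Clifford.bivector, map_add, add_mul] at ha hb ⊢
        exact add_mem ha hb
      | tmul s x =>
        induction z' with
        | zero => rw [Clifford.bivector, map_zero, mul_zero, zero_mul]; exact zero_mem _
        | add a b ha hb =>
          simp only [Clifford.bivector, map_add, mul_add, add_mul] at ha hb ⊢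
          exact add_mem ha hb
        | tmul s' y =>
          -- The scalar `s'` is pulled out and `h` is expanded in extended functionals, reducing to
          -- bivectors that come from `R`.
          rw [← mul_one s', ← smul_eq_mul, ← TensorProduct.smul_tmul', hι h]
          simp only [Clifford.bivector, map_sum, map_smul, mul_smul_comm, smul_mul_assoc,
            Finset.mul_sum]
          exact sum_mem fun i _ => Subalgebra.smul_mem _ (Subalgebra.smul_mem _ (hmem _ _ _ _) _) _
  exact ⟨(AlgEquiv.ofInjective _ hinj).trans (Subalgebra.equivOfEq _ _ hrange)⟩

end BaseChange

/-! ### Invariance of the even Clifford algebra under twisting -/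

section Twist

theorem eq_zero_of_one_tmul {R C : Type*} [CommRing R] [AddCommGroup C] [Module R C] {c : C}
    (h : ∀ (m : Ideal R) [m.IsPrime], m.IsMaximal →
      (1 : Localization.AtPrime m) ⊗ₜ[R] c = 0) : c = 0 := by
  refine eq_zero_of_local (R := R) fun m hm => ?_
  have := hm.isPrime
  obtain ⟨s, hs⟩ := (IsLocalizedModule.eq_zero_iff m.primeCompl
    (TensorProduct.mk R (Localization.AtPrime m) C 1)).mp (h m hm)
  exact ⟨s, s.2, hs⟩

section Local

variable {R P A : Type*} [CommRing R] [AddCommGroup P] [Module R P] [Module.Invertible R P]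
  [CommRing A] [Algebra R A] {p₀ : P} {f₀ : Module.Dual R P} {t : A}

/-- The trivialization `P → A` determined by a functional `f₀` and a denominator. -/
noncomputable def trivialization (f₀ : Module.Dual R P) (t : A) : P →ₗ[R] A :=
  (LinearMap.mulLeft R t) ∘ₗ Algebra.linearMap R A ∘ₗ f₀

omit [Module.Invertible R P] in
theorem trivialization_apply (p : P) : trivialization f₀ t p = t * algebraMap R A (f₀ p) := rfl

/-- Once `f₀ p₀` is invertible, `p₀` generates `P` and the trivialization is the coordinate: each
argument `p` is that coordinate times `p₀`. -/
theorem bilin_eq_trivialization_smul (ht : t * algebraMap R A (f₀ p₀) = 1) {N : Type*}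
    [AddCommGroup N] [Module R N] [Module A N] [IsScalarTower R A N] (B : P →ₗ[R] P →ₗ[R] N)
    (p p' : P) :
    B p p' = (trivialization f₀ t p * trivialization f₀ t p') • B p₀ p₀ := by
  have key : ∀ (G : P →ₗ[R] N) p, G p = trivialization f₀ t p • G p₀ := fun G p => by
    have h := congrArg G (dual_smul_comm f₀ p p₀)
    rw [map_smul, map_smul] at h
    rw [trivialization_apply, mul_smul, algebraMap_smul, h, ← algebraMap_smul A (f₀ p₀), ← mul_smul,
      ht, one_smul]
  rw [key (B p) p', mul_comm, mul_smul]
  congr 1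
  exact key (B.flip p₀) p

end Local

variable {R : Type u} {M I P Q M' I' : Type v} [CommRing R]
  [AddCommGroup M] [Module R M] [Module.Projective R M] [AddCommGroup I] [Module R I]
  [AddCommGroup P] [Module R P] [Module.Invertible R P] [AddCommGroup Q] [Module R Q]
  [AddCommGroup M'] [Module R M'] [AddCommGroup I'] [Module R I']
  (q : QuadraticMap R M I) (q' : QuadraticMap R M' I') (d : P ⊗[R] P ≃ₗ[R] Q)
  (f : M ⊗[R] P ≃ₗ[R] M') (g : I ⊗[R] Q ≃ₗ[R] I')

/-- The functional `a ↦ h (g (a ⊗ d (p ⊗ p')))`. -/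
noncomputable def dualPull : P →ₗ[R] P →ₗ[R] Module.Dual R I' →ₗ[R] Module.Dual R I :=
  LinearMap.mk₂ R
    (fun p p' => (g.toLinearMap ∘ₗ (TensorProduct.mk R I Q).flip (d (p ⊗ₜ p'))).dualMap)
    (by intros; ext; simp [TensorProduct.add_tmul])
    (by intros; ext; simp [← TensorProduct.smul_tmul'])
    (by intros; ext; simp [TensorProduct.tmul_add])
    (by intros; ext; simp)

omit [Module.Invertible R P] in
theorem dualPull_apply (p p' : P) (h : Module.Dual R I') (a : I) :
    dualPull d g p p' h a = h (g (a ⊗ₜ d (p ⊗ₜ p'))) := rfl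

/-- The pairs of corresponding generators of the even Clifford algebras of a quadratic module and
of a twist of it. -/
def twistPairs : Set (evenClifford q × evenClifford q') :=
  {c | ∃ x y p p' h, (c.1 : Clifford q) = Clifford.bivector q x y (dualPull d g p p' h) ∧
    (c.2 : Clifford q') = Clifford.bivector q' (f (x ⊗ₜ p)) (f (y ⊗ₜ p')) h}

variable {q q' d f g}

/-- Over `A` the twist is undone by replacing `p` with its coordinate `π p`: `x ⊗ p` goes to `π p ⊗
x`, `a ⊗ d (p ⊗ p')` to `π p π p' ⊗ a`, and `h` to its pullback along `a ↦ g (a ⊗ d (p₀ ⊗ p₀))`. The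
map depends on `p₀`, but its effect on the pairs in `twistPairs` does not. -/
theorem exists_untwist (hq : ∀ z, q' (f z) = g (quadraticTensor q d.toLinearMap z))
    {A : Type*} [CommRing A] [Algebra R A]
    {p₀ : P} {f₀ : Module.Dual R P} {t : A} (ht : t * algebraMap R A (f₀ p₀) = 1) :
    ∃ χ : Clifford q' →ₐ[R] A ⊗[R] Clifford q, ∀ c ∈ twistPairs q q' d f g,
      χ c.2 = 1 ⊗ₜ (c.1 : Clifford q) := by
  let π := trivialization (R := R) f₀ t
  have hπ₀ : π p₀ = 1 := ht
  let πQ : Q →ₗ[R] A := LinearMap.mul' R A ∘ₗ TensorProduct.map π π ∘ₗ d.symm.toLinearMap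
  have hπQ : ∀ p p', πQ (d (p ⊗ₜ p')) = π p * π p' := fun p p' => by simp [πQ]
  let j₀ : M ⊗[R] P →ₗ[R] A ⊗[R] Clifford q :=
    TensorProduct.map π (Clifford.ofVector q) ∘ₗ (TensorProduct.comm R M P).toLinearMap
  let w₀ : I ⊗[R] Q →ₗ[R] A ⊗[R] Clifford q :=
    TensorProduct.map πQ (Clifford.ofModule q) ∘ₗ (TensorProduct.comm R I Q).toLinearMap
  let w' : Module.Dual R I' →ₗ[R] A ⊗[R] Clifford q :=
    TensorProduct.mk R A _ 1 ∘ₗ Clifford.ofDual q ∘ₗ dualPull d g p₀ p₀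
  have hj₀ : ∀ x p, j₀ (x ⊗ₜ p) = π p ⊗ₜ Clifford.ofVector q x := fun _ _ => rfl
  have hw₀ : ∀ a δ, w₀ (a ⊗ₜ δ) = πQ δ ⊗ₜ Clifford.ofModule q a := fun _ _ => rfl
  have hsq : linearSq j₀ = w₀.compQuadraticMap (quadraticTensor q d.toLinearMap) := by
    refine quadraticMap_tensor_ext (fun x p => ?_) (fun x p x' p' => ?_)
    · rw [linearSq_apply, LinearMap.compQuadraticMap_apply, quadraticTensor_tmul, hj₀, hw₀,
        Algebra.TensorProduct.tmul_mul_tmul, Clifford.ofVector_mul_self]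
      exact congrArg (· ⊗ₜ _) (hπQ p p).symm
    · rw [polar_linearSq, polar_compQuadraticMap, polar_quadraticTensor_tmul, hj₀, hj₀, hw₀,
        Algebra.TensorProduct.tmul_mul_tmul, Algebra.TensorProduct.tmul_mul_tmul,
        ← Clifford.ofVector_polar, mul_comm (π p'), ← TensorProduct.tmul_add]
      exact congrArg (· ⊗ₜ _) (hπQ p p').symm
  obtain ⟨χ, h1, -, h3⟩ := Clifford.exists_lift q' (j₀ ∘ₗ f.symm.toLinearMap)
    (w₀ ∘ₗ g.symm.toLinearMap) w'
    (fun z => by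
      obtain ⟨z, rfl⟩ := g.surjective z
      rw [LinearMap.comp_apply, LinearEquiv.coe_coe, LinearEquiv.symm_apply_apply]
      induction z with
      | zero => rw [map_zero]; exact zero_mem _
      | add a b ha hb => rw [map_add]; exact add_mem ha hb
      | tmul a δ => exact Subalgebra.mem_center_iff.mpr (Subalgebra.mem_center_iff.mp
          (tmul_mem_center (Clifford.ofModule_mem_center q a) _)))
    (fun h => Subalgebra.mem_center_iff.mpr (Subalgebra.mem_center_iff.mp
      (tmul_mem_center (Clifford.ofDual_mem_center q _) _)))
    (fun z h => by
      obtain ⟨z, rfl⟩ := g.surjective z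
      rw [LinearMap.comp_apply, LinearEquiv.coe_coe, LinearEquiv.symm_apply_apply]
      induction z with
      | zero => simp
      | add a b ha hb => rw [map_add, add_mul, ha, hb, map_add, map_add, map_add]
      | tmul a δ =>
        obtain ⟨τ, rfl⟩ := d.surjective δ
        induction τ with
        | zero => simp
        | add a b ha hb =>
          rw [map_add, TensorProduct.tmul_add, map_add, add_mul, ha, hb, map_add, map_add, map_add]
        | tmul p p' =>
          rw [hw₀, hπQ]
          change (_ ⊗ₜ _) * (1 ⊗ₜ Clifford.ofDual q _) = _
          rw [Algebra.TensorProduct.tmul_mul_tmul, Clifford.ofModule_mul_ofDual, mul_one,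
            Algebra.algebraMap_eq_smul_one, ← TensorProduct.smul_tmul]
          have := bilin_eq_trivialization_smul ht (N := A) ((dualPull d g).compr₂
            (Algebra.linearMap R A ∘ₗ LinearMap.applyₗ a ∘ₗ LinearMap.applyₗ h)) p p'
          change algebraMap R A (h (g (a ⊗ₜ d (p ⊗ₜ p')))) =
            (π p * π p') * algebraMap R A (h (g (a ⊗ₜ d (p₀ ⊗ₜ p₀)))) at this
          rw [Algebra.TensorProduct.algebraMap_apply, this, Algebra.smul_def, mul_comm]
          rfl)
    (fun z => by
      obtain ⟨z, rfl⟩ := f.surjective z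
      rw [hq]
      simp only [LinearMap.comp_apply, LinearEquiv.coe_coe, LinearEquiv.symm_apply_apply]
      exact congrArg (fun Q => Q z) hsq)
  refine ⟨χ, ?_⟩
  rintro ⟨c, c'⟩ ⟨x, y, p, p', h, hc, hc'⟩
  dsimp only at hc hc' ⊢
  rw [hc, hc', Clifford.bivector, map_mul, map_mul, h1, h1, h3]
  simp only [LinearMap.comp_apply, LinearEquiv.coe_coe, LinearEquiv.symm_apply_apply, hj₀]
  have := bilin_eq_trivialization_smul ht (N := A ⊗[R] Clifford q) ((dualPull d g).compr₂
    (TensorProduct.mk R A (Clifford q) 1 ∘ₗ LinearMap.mulLeft R (Clifford.ofVector q x * Clifford.ofVector q y) ∘ₗ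
      Clifford.ofDual q ∘ₗ LinearMap.applyₗ h)) p p'
  refine Eq.trans ?_ this.symm
  change (_ * _) * (1 ⊗ₜ Clifford.ofDual q _) = _ • (1 ⊗ₜ (_ * Clifford.ofDual q _))
  rw [Algebra.TensorProduct.tmul_mul_tmul, Algebra.TensorProduct.tmul_mul_tmul, mul_one,
    TensorProduct.smul_tmul', smul_eq_mul, mul_one]
  rfl

/-- The opposite direction inserts the generator: `x` goes to `f (x ⊗ p₀)` and `a` to `g (a ⊗ d (p₀
⊗ p₀))`. -/
theorem exists_retwist (hq : ∀ z, q' (f z) = g (quadraticTensor q d.toLinearMap z))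
    {A : Type*} [CommRing A] [Algebra R A]
    {p₀ : P} {f₀ : Module.Dual R P} {t : A} (ht : t * algebraMap R A (f₀ p₀) = 1) :
    ∃ φ : Clifford q →ₐ[R] A ⊗[R] Clifford q', ∀ c ∈ twistPairs q q' d f g,
      φ c.1 = 1 ⊗ₜ (c.2 : Clifford q') := by
  let κ : Q →ₗ[R] R := LinearMap.mul' R R ∘ₗ TensorProduct.map f₀ f₀ ∘ₗ d.symm.toLinearMap
  have hκ : ∀ p p', κ (d (p ⊗ₜ p')) = f₀ p * f₀ p' := fun p p' => by simp [κ]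
  let j : M →ₗ[R] A ⊗[R] Clifford q' := TensorProduct.mk R A _ 1 ∘ₗ Clifford.ofVector q' ∘ₗ
    f.toLinearMap ∘ₗ (TensorProduct.mk R M P).flip p₀
  let w : I →ₗ[R] A ⊗[R] Clifford q' := TensorProduct.mk R A _ 1 ∘ₗ Clifford.ofModule q' ∘ₗ
    g.toLinearMap ∘ₗ (TensorProduct.mk R I Q).flip (d (p₀ ⊗ₜ p₀))
  let η : Module.Dual R I →ₗ[R] Module.Dual R I' :=
    { toFun := fun α => LinearMap.mul' R R ∘ₗ TensorProduct.map α κ ∘ₗ g.symm.toLinearMap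
      map_add' := fun α β => by
        rw [TensorProduct.map_add_left, LinearMap.add_comp, LinearMap.comp_add]
      map_smul' := fun r α => by
        rw [TensorProduct.map_smul_left]; ext; simp }
  have hη : ∀ α a δ, η α (g (a ⊗ₜ δ)) = α a * κ δ := fun α a δ => by simp [η]
  -- `η α` takes the value `α a (f₀ p₀)²` on the image of `a`; the factor `t * t` cancels this
  -- square.
  let w' : Module.Dual R I →ₗ[R] A ⊗[R] Clifford q' :=
    TensorProduct.mk R A _ (t * t) ∘ₗ Clifford.ofDual q' ∘ₗ η
  have hw' : ∀ α, w' α = (t * t) ⊗ₜ Clifford.ofDual q' (η α) := fun _ => rfl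
  have hη₀ : ∀ h, η (dualPull d g p₀ p₀ h) = (f₀ p₀ * f₀ p₀) • h := by
    intro h
    ext z
    obtain ⟨z, rfl⟩ := g.surjective z
    induction z with
    | zero => simp
    | add a b ha hb => simp only [map_add, ha, hb]
    | tmul a δ =>
      obtain ⟨τ, rfl⟩ := d.surjective δ
      induction τ with
      | zero => simp
      | add a b ha hb => simp only [map_add, TensorProduct.tmul_add, ha, hb]
      | tmul p p' =>
        have h1 : (f₀ p₀ * f₀ p₀) • (p ⊗ₜ[R] p') = (f₀ p * f₀ p') • (p₀ ⊗ₜ[R] p₀) := by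
          rw [← TensorProduct.smul_tmul_smul, ← TensorProduct.smul_tmul_smul,
            dual_smul_comm f₀ p₀ p, dual_smul_comm f₀ p₀ p']
        rw [hη, hκ, dualPull_apply, LinearMap.smul_apply, ← map_smul, ← map_smul,
          ← TensorProduct.tmul_smul, ← map_smul, h1]
        simp [mul_comm]
  obtain ⟨φ, h1, -, h3⟩ := Clifford.exists_lift q j w w'
    (fun z => Subalgebra.mem_center_iff.mpr (Subalgebra.mem_center_iff.mp
      (tmul_mem_center (Clifford.ofModule_mem_center q' _) _)))
    (fun h => Subalgebra.mem_center_iff.mpr (Subalgebra.mem_center_iff.mp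
      (tmul_mem_center (Clifford.ofDual_mem_center q' _) _)))
    (fun a α => by
      rw [hw']
      change (1 ⊗ₜ Clifford.ofModule q' (g (a ⊗ₜ d (p₀ ⊗ₜ p₀)))) * _ = _
      rw [Algebra.TensorProduct.tmul_mul_tmul, Clifford.ofModule_mul_ofDual, hη, hκ, one_mul,
        Algebra.algebraMap_eq_smul_one, ← TensorProduct.smul_tmul,
        Algebra.TensorProduct.algebraMap_apply]
      congr 1
      rw [Algebra.smul_def, map_mul, map_mul]
      -- With `u = t f₀(p₀)`, the factor `u + 1` turns `u = 1` into `u² = 1`.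
      linear_combination (algebraMap R A (α a) * (t * algebraMap R A (f₀ p₀) + 1)) * ht)
    (fun x => by
      change (1 ⊗ₜ Clifford.ofVector q' (f (x ⊗ₜ p₀))) * (1 ⊗ₜ Clifford.ofVector q' (f (x ⊗ₜ p₀))) =
        1 ⊗ₜ Clifford.ofModule q' (g (q x ⊗ₜ d (p₀ ⊗ₜ p₀)))
      rw [Algebra.TensorProduct.tmul_mul_tmul, Clifford.ofVector_mul_self, one_mul]
      rw [hq, quadraticTensor_tmul]
      rfl)
  refine ⟨φ, ?_⟩
  rintro ⟨c, c'⟩ ⟨x, y, p, p', h, hc, hc'⟩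
  dsimp only at hc hc' ⊢
  rw [hc, hc', Clifford.bivector, map_mul, map_mul, h1, h1, h3]
  have e1 := bilin_eq_trivialization_smul ht (N := A ⊗[R] Clifford q') ((dualPull d g).compr₂
    (LinearMap.mulLeft R (j x * j y) ∘ₗ w' ∘ₗ LinearMap.applyₗ h)) p p'
  refine e1.trans ?_
  let B : P →ₗ[R] P →ₗ[R] A ⊗[R] Clifford q' :=
    (LinearMap.mul R (Clifford q')).compl₁₂
      (Clifford.ofVector q' ∘ₗ f.toLinearMap ∘ₗ TensorProduct.mk R M P x)
      (Clifford.ofVector q' ∘ₗ f.toLinearMap ∘ₗ TensorProduct.mk R M P y) |>.compr₂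
      (TensorProduct.mk R A _ 1 ∘ₗ LinearMap.mulRight R (Clifford.ofDual q' h))
  have e2 := bilin_eq_trivialization_smul ht B p p'
  refine Eq.trans ?_ e2.symm
  congr 1
  change j x * j y * w' (dualPull d g p₀ p₀ h) = 1 ⊗ₜ (Clifford.ofVector q' (f (x ⊗ₜ p₀)) *
    Clifford.ofVector q' (f (y ⊗ₜ p₀)) * Clifford.ofDual q' h)
  rw [hw', hη₀, map_smul, ← TensorProduct.smul_tmul]
  change (1 ⊗ₜ Clifford.ofVector q' (f (x ⊗ₜ p₀))) * (1 ⊗ₜ Clifford.ofVector q' (f (y ⊗ₜ p₀))) * _ = _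
  rw [Algebra.TensorProduct.tmul_mul_tmul, Algebra.TensorProduct.tmul_mul_tmul, one_mul, one_mul]
  congr 1
  rw [Algebra.smul_def, map_mul]
  linear_combination (t * algebraMap R A (f₀ p₀) + 1) * ht

/-- This says that both projections of the generated subalgebra are injective. A local homomorphism
that matches the generators of every pair matches the components of every element of this
subalgebra; if one component is zero, the other vanishes in all localizations. -/
theorem twist_fst_eq_zero_iff (hq : ∀ z, q' (f z) = g (quadraticTensor q d.toLinearMap z))
    {c : evenClifford q × evenClifford q'} (hc : c ∈ Algebra.adjoin R (twistPairs q q' d f g)) :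
    c.1 = 0 ↔ c.2 = 0 := by
  have hloc : ∀ (m : Ideal R) [m.IsPrime], m.IsMaximal → ∃ (p₀ : P) (f₀ : Module.Dual R P)
      (t : Localization.AtPrime m), t * algebraMap R _ (f₀ p₀) = 1 := by
    intro m _ hm
    obtain ⟨f₀, p₀, h⟩ := exists_dual_notMem (R := R) (P := P) hm
    obtain ⟨t, ht⟩ := (IsLocalization.map_units (Localization.AtPrime m)
      (⟨f₀ p₀, h⟩ : m.primeCompl)).exists_left_inv
    exact ⟨p₀, f₀, t, ht⟩
  constructor
  · intro h
    apply Subtype.ext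
    refine eq_zero_of_one_tmul (R := R) fun m _ hm => ?_
    obtain ⟨p₀, f₀, t, ht⟩ := hloc m hm
    obtain ⟨φ, hφ⟩ := exists_retwist hq ht
    have hle : Algebra.adjoin R (twistPairs q q' d f g) ≤ AlgHom.equalizer
        ((φ.comp (evenClifford q).val).comp (AlgHom.fst R _ _))
        ((Algebra.TensorProduct.includeRight.comp (evenClifford q').val).comp (AlgHom.snd R _ _)) :=
      Algebra.adjoin_le fun c hc => hφ c hc
    have := hle hc
    change φ c.1 = 1 ⊗ₜ (c.2 : Clifford q') at this
    rw [← this, h]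
    exact map_zero φ
  · intro h
    apply Subtype.ext
    refine eq_zero_of_one_tmul (R := R) fun m _ hm => ?_
    obtain ⟨p₀, f₀, t, ht⟩ := hloc m hm
    obtain ⟨χ, hχ⟩ := exists_untwist hq ht
    have hle : Algebra.adjoin R (twistPairs q q' d f g) ≤ AlgHom.equalizer
        ((χ.comp (evenClifford q').val).comp (AlgHom.snd R _ _))
        ((Algebra.TensorProduct.includeRight.comp (evenClifford q).val).comp (AlgHom.fst R _ _)) :=
      Algebra.adjoin_le fun c hc => hχ c hc
    have := hle hc
    change χ c.2 = 1 ⊗ₜ (c.1 : Clifford q) at this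
    rw [← this, h]
    exact map_zero χ

omit [Module.Projective R M] in
theorem twist_fst_surjective (c : evenClifford q) :
    ∃ γ ∈ Algebra.adjoin R (twistPairs q q' d f g), γ.1 = c := by
  set Γ := Algebra.adjoin R (twistPairs q q' d f g)
  let T : Subalgebra R (Clifford q) := Γ.map ((evenClifford q).val.comp (AlgHom.fst R _ _))
  have hle : evenClifford q ≤ T := by
    rw [evenClifford_eq_adjoin]
    refine Algebra.adjoin_le ?_
    rintro _ ⟨x, y, α, rfl⟩
    refine mem_of_local (Subalgebra.toSubmodule T) fun m hm => ?_
    obtain ⟨f₀, p₀, h⟩ := exists_dual_notMem (R := R) (P := P) hm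
    refine ⟨f₀ p₀ * f₀ p₀, mul_notMem hm h h, ?_⟩
    let κ : Q →ₗ[R] R := LinearMap.mul' R R ∘ₗ TensorProduct.map f₀ f₀ ∘ₗ d.symm.toLinearMap
    let h : Module.Dual R I' := LinearMap.mul' R R ∘ₗ TensorProduct.map α κ ∘ₗ g.symm.toLinearMap
    -- Every functional `α` on `I` is reached up to the scalar `(f₀ p₀)²`, which lies outside `m`;
    -- surjectivity is a local question.
    have hα : dualPull d g p₀ p₀ h = (f₀ p₀ * f₀ p₀) • α := by
      ext a
      simp [dualPull_apply, h, κ, mul_comm]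
    refine ⟨(⟨_, Clifford.bivector_mem q x y (dualPull d g p₀ p₀ h)⟩,
      ⟨_, Clifford.bivector_mem q' (f (x ⊗ₜ p₀)) (f (y ⊗ₜ p₀)) h⟩),
      Algebra.subset_adjoin ⟨x, y, p₀, p₀, h, rfl, rfl⟩, ?_⟩
    change Clifford.bivector q x y _ = _
    rw [hα, Clifford.bivector, map_smul, mul_smul_comm]
    rfl
  obtain ⟨γ, hγ, h⟩ := hle c.2
  exact ⟨γ, hγ, Subtype.ext h⟩

omit [Module.Projective R M] [Module.Invertible R P] in
theorem twist_snd_surjective (c : evenClifford q') :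
    ∃ γ ∈ Algebra.adjoin R (twistPairs q q' d f g), γ.2 = c := by
  set Γ := Algebra.adjoin R (twistPairs q q' d f g)
  let T : Subalgebra R (Clifford q') := Γ.map ((evenClifford q').val.comp (AlgHom.snd R _ _))
  have hle : evenClifford q' ≤ T := by
    rw [evenClifford_eq_adjoin]
    refine Algebra.adjoin_le ?_
    rintro _ ⟨z, z', h, rfl⟩
    obtain ⟨z, rfl⟩ := f.surjective z
    obtain ⟨z', rfl⟩ := f.surjective z'
    change _ ∈ T
    induction z with
    | zero => rw [Clifford.bivector, map_zero, map_zero, zero_mul, zero_mul]; exact zero_mem _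
    | add a b ha hb =>
      simp only [Clifford.bivector, map_add, add_mul] at ha hb ⊢
      exact add_mem ha hb
    | tmul x p =>
      induction z' with
      | zero => rw [Clifford.bivector, map_zero, map_zero, mul_zero, zero_mul]; exact zero_mem _
      | add a b ha hb =>
        simp only [Clifford.bivector, map_add, mul_add, add_mul] at ha hb ⊢
        exact add_mem ha hb
      | tmul y p' =>
        exact ⟨(⟨_, Clifford.bivector_mem q x y (dualPull d g p p' h)⟩,
          ⟨_, Clifford.bivector_mem q' (f (x ⊗ₜ p)) (f (y ⊗ₜ p')) h⟩),
          Algebra.subset_adjoin ⟨x, y, p, p', h, rfl, rfl⟩, rfl⟩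
  obtain ⟨γ, hγ, h⟩ := hle c.2
  exact ⟨γ, hγ, Subtype.ext h⟩

/-- The even Clifford algebra of a quadratic module is isomorphic to that of a twist. -/
theorem evenClifford_twist (hq : ∀ z, q' (f z) = g (quadraticTensor q d.toLinearMap z)) :
    Nonempty (evenClifford q ≃ₐ[R] evenClifford q') := by
  -- `Γ` is the graph of the isomorphism sought, which avoids gluing local isomorphisms.
  let Γ := Algebra.adjoin R (twistPairs q q' d f g)
  let F₁ : Γ →ₐ[R] evenClifford q := (AlgHom.fst R _ _).comp Γ.val
  let F₂ : Γ →ₐ[R] evenClifford q' := (AlgHom.snd R _ _).comp Γ.val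
  have h₁ : Function.Bijective F₁ := by
    refine ⟨(injective_iff_map_eq_zero F₁).mpr fun γ h => ?_, fun c => ?_⟩
    · exact Subtype.ext (Prod.ext h ((twist_fst_eq_zero_iff hq γ.2).mp h))
    · obtain ⟨γ, hγ, h⟩ := twist_fst_surjective (q' := q') (d := d) (f := f) (g := g) c
      exact ⟨⟨γ, hγ⟩, h⟩
  have h₂ : Function.Bijective F₂ := by
    refine ⟨(injective_iff_map_eq_zero F₂).mpr fun γ h => ?_, fun c => ?_⟩
    · exact Subtype.ext (Prod.ext ((twist_fst_eq_zero_iff hq γ.2).mpr h) h)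
    · obtain ⟨γ, hγ, h⟩ := twist_snd_surjective (q := q) (d := d) (f := f) (g := g) c
      exact ⟨⟨γ, hγ⟩, h⟩
  exact ⟨(AlgEquiv.ofBijective F₁ h₁).symm.trans (AlgEquiv.ofBijective F₂ h₂)⟩

theorem TernaryQuadraticModule.TwistedIsometric.evenClifford {R : Type u} [CommRing R]
    {X Y : TernaryQuadraticModule R} (h : X.TwistedIsometric Y) :
    Nonempty (evenClifford X.q ≃ₐ[R] evenClifford Y.q) := by
  obtain ⟨D, f, g, h⟩ := h
  exact evenClifford_twist (d := D.d) (f := f) (g := g) h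

end Twist

/-! ### Functionals on the even Clifford algebra from alternating forms -/

section Functional

/-- On a projective module the form is the diagonal of a bilinear map, so the Clifford algebra
deforms linearly to the exterior algebra with scalars fixed, and there the scalars are split off. -/
theorem algebraMap_cliffordAlgebra_injective {A V : Type*} [CommRing A] [AddCommGroup V]
    [Module A V] [Module.Projective A V] (Q : QuadraticForm A V) :
    Function.Injective (algebraMap A (CliffordAlgebra Q)) := by
  obtain ⟨b, hb⟩ := exists_bilin (-Q)
  have h : LinearMap.BilinMap.toQuadraticMap b = 0 - Q := by
    ext x
    simpa using hb x
  intro x y hxy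
  have h2 := congrArg (CliffordAlgebra.changeForm h) hxy
  rw [CliffordAlgebra.changeForm_algebraMap, CliffordAlgebra.changeForm_algebraMap] at h2
  exact (ExteriorAlgebra.algebraMap_leftInverse V).injective h2

/-- Take the product of the localizations at all maximal ideals. It contains `R`, and in each factor
`I` is trivialized by some `α₀` and its dual by evaluation at `a₀` divided by `α₀ a₀`. -/
theorem exists_trivializing_algebra (R : Type u) [CommRing R] (I : Type v) [AddCommGroup I]
    [Module R I] [Module.Invertible R I] :
    ∃ (A : Type u) (_ : CommRing A) (_ : Algebra R A) (w : I →ₗ[R] A)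
      (w' : Module.Dual R I →ₗ[R] A), Function.Injective (algebraMap R A) ∧
      ∀ a α, w a * w' α = algebraMap R A (α a) := by
  have hloc : ∀ m : MaximalSpectrum R, ∃ (a₀ : I) (α₀ : Module.Dual R I)
      (t : Localization.AtPrime m.asIdeal), t * algebraMap R _ (α₀ a₀) = 1 := by
    intro m
    obtain ⟨α₀, a₀, h⟩ := exists_dual_notMem (R := R) (P := I) m.isMaximal
    obtain ⟨t, ht⟩ := (IsLocalization.map_units (Localization.AtPrime m.asIdeal)
      (⟨α₀ a₀, h⟩ : m.asIdeal.primeCompl)).exists_left_inv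
    exact ⟨a₀, α₀, t, ht⟩
  choose a₀ α₀ t ht using hloc
  refine ⟨∀ m : MaximalSpectrum R, Localization.AtPrime m.asIdeal, inferInstance, inferInstance,
    LinearMap.pi fun m => Algebra.linearMap R _ ∘ₗ α₀ m,
    LinearMap.pi fun m => LinearMap.mulLeft R (t m) ∘ₗ Algebra.linearMap R _ ∘ₗ
      LinearMap.applyₗ (a₀ m), ?_, fun a α => ?_⟩
  · exact MaximalSpectrum.toPiLocalization_injective R
  · ext m
    have h := congrArg α (dual_smul_comm (α₀ m) a (a₀ m))
    simp only [map_smul, smul_eq_mul] at h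
    have h' := congrArg (algebraMap R (Localization.AtPrime m.asIdeal)) h
    rw [map_mul, map_mul] at h'
    change algebraMap R _ (α₀ m a) * (t m * algebraMap R _ (α (a₀ m))) = algebraMap R _ (α a)
    linear_combination (t m) * h' + algebraMap R _ (α a) * ht m

variable {R : Type u} {M I : Type v} [CommRing R] [AddCommGroup M] [Module R M]
  [Module.Finite R M] [Module.Projective R M] [AddCommGroup I] [Module R I]
  [Module.Invertible R I] {q : QuadraticMap R M I}

omit [Module.Finite R M] in
/-- An alternating form `η` yields a linear map on the Clifford algebra that sends `x y α` to
`α (η x y)`. -/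
theorem Clifford.exists_linearMap {η : M →ₗ[R] M →ₗ[R] I} (hη : ∀ x, η x x = 0) :
    ∃ (C : Type (max u v)) (_ : AddCommGroup C) (_ : Module R C) (G : R →ₗ[R] C)
      (F : Clifford q →ₗ[R] C), Function.Injective G ∧ F 1 = 0 ∧
      ∀ x y α, F (bivector q x y α) = G (α (η x y)) := by
  obtain ⟨A, _, _, w, w', hA, hw⟩ := exists_trivializing_algebra R I
  let QA : QuadraticForm A (A ⊗[R] M) :=
    (w.liftBaseChange A).compQuadraticMap (quadraticBaseChange A q)
  let ηA : LinearMap.BilinForm A (A ⊗[R] M) :=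
    (LinearMap.BilinMap.baseChange A η).compr₂ (w.liftBaseChange A)
  have hηA : ∀ s x s' x', ηA (s ⊗ₜ x) (s' ⊗ₜ x') = s * s' * w (η x x') := by
    intro s x s' x'
    simp [ηA]
  have hη' : ∀ x y, η x y + η y x = 0 := fun x y => by
    have := hη (x + y)
    simpa [hη] using this
  have hz : LinearMap.BilinMap.toQuadraticMap ηA = 0 := by
    refine quadraticMap_tensor_ext (fun s x => ?_) (fun s x s' x' => ?_)
    · rw [LinearMap.BilinMap.toQuadraticMap_apply, hηA, hη, map_zero, mul_zero]
      rfl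
    · rw [LinearMap.BilinMap.polar_toQuadraticMap, hηA, hηA, mul_comm s', ← mul_add, ← map_add,
        hη', map_zero, mul_zero]
      simp [QuadraticMap.polar]
  -- Since `ηA` is alternating, deforming by it leaves `QA` unchanged. The deformation `D` is then a
  -- linear endomorphism of one Clifford algebra sending `v v'` to `v v' - ηA v v'`, and `id - D`
  -- extracts `ηA`.
  have h0 : LinearMap.BilinMap.toQuadraticMap ηA = QA - QA := hz.trans (sub_self QA).symm
  have hQA : ∀ x, QA (1 ⊗ₜ x) = w (q x) := fun x => by
    change w.liftBaseChange A (quadraticBaseChange A q (1 ⊗ₜ x)) = _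
    rw [quadraticBaseChange_tmul, LinearMap.liftBaseChange_tmul, mul_one, one_smul]
  obtain ⟨Θ, h1, -, h3⟩ := Clifford.exists_lift q (A := CliffordAlgebra QA)
    ((CliffordAlgebra.ι QA).restrictScalars R ∘ₗ TensorProduct.mk R A M 1)
    ((Algebra.linearMap A (CliffordAlgebra QA)).restrictScalars R ∘ₗ w)
    ((Algebra.linearMap A (CliffordAlgebra QA)).restrictScalars R ∘ₗ w')
    (fun a => Subalgebra.mem_center_iff.mpr fun c => (Algebra.commutes (w a) c).symm)
    (fun a => Subalgebra.mem_center_iff.mpr fun c => (Algebra.commutes (w' a) c).symm)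
    (fun a α => by
      change algebraMap A _ _ * algebraMap A _ _ = _
      rw [← map_mul, hw, ← IsScalarTower.algebraMap_apply])
    (fun x => (CliffordAlgebra.ι_sq_scalar QA _).trans (congrArg _ (hQA x)))
  let D := CliffordAlgebra.changeForm h0
  refine ⟨CliffordAlgebra QA, inferInstance, inferInstance, Algebra.linearMap R _,
    (LinearMap.id - D).restrictScalars R ∘ₗ Θ.toLinearMap, ?_, ?_, fun x y α => ?_⟩
  · change Function.Injective (algebraMap R (CliffordAlgebra QA))
    rw [IsScalarTower.algebraMap_eq R A]
    exact (algebraMap_cliffordAlgebra_injective QA).comp hA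
  · change Θ 1 - D (Θ 1) = 0
    rw [map_one, CliffordAlgebra.changeForm_one, sub_self]
  · change Θ (bivector q x y α) - D (Θ (bivector q x y α)) = algebraMap R _ _
    have : Θ (bivector q x y α) =
        w' α • (CliffordAlgebra.ι QA (1 ⊗ₜ x) * CliffordAlgebra.ι QA (1 ⊗ₜ y)) := by
      rw [bivector, map_mul, map_mul, h1, h1, h3, Algebra.smul_def]
      exact (Algebra.commutes (w' α) _).symm
    rw [this, map_smul, CliffordAlgebra.changeForm_ι_mul_ι, ← smul_sub, sub_sub_cancel, hηA,
      one_mul, one_mul, Algebra.smul_def, ← map_mul, mul_comm, hw, ← IsScalarTower.algebraMap_apply]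

omit [Module.Invertible R I] in
theorem evenClifford_ext (hM : ∀ p : PrimeSpectrum R, Module.rankAtStalk (R := R) M p = 3)
    {N : Type*} [AddCommGroup N] [Module R N] {F G : evenClifford q →ₗ[R] N} (h1 : F 1 = G 1)
    (h2 : ∀ x y α, F ⟨_, Clifford.bivector_mem q x y α⟩ = G ⟨_, Clifford.bivector_mem q x y α⟩) :
    F = G := by
  ext ⟨c, hc⟩
  have hc' : c ∈ Clifford.evenSpan q := by rwa [← evenClifford_toSubmodule hM]
  have hle : Clifford.evenSpan q ≤ (LinearMap.eqLocus F G).map (evenClifford q).val.toLinearMap := by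
    rw [Clifford.evenSpan, Submodule.span_le]
    rintro _ (rfl | ⟨x, y, α, rfl⟩)
    · exact ⟨1, h1, rfl⟩
    · exact ⟨_, h2 x y α, rfl⟩
  obtain ⟨c', h, rfl⟩ := hle hc'
  exact h

/-- On the spanning set of the even part the map of `Clifford.exists_linearMap` takes values in the
injective image of `R`, so it descends to `R`. This replaces a proof that the even part is locally
free of rank four. -/
theorem exists_functional (hM : ∀ p : PrimeSpectrum R, Module.rankAtStalk (R := R) M p = 3)
    {η : M →ₗ[R] M →ₗ[R] I} (hη : ∀ x, η x x = 0) :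
    ∃ l : evenClifford q →ₗ[R] R, l 1 = 0 ∧
      ∀ x y α, l ⟨_, Clifford.bivector_mem q x y α⟩ = α (η x y) := by
  obtain ⟨C, _, _, G, F, hG, hF1, hF⟩ := Clifford.exists_linearMap (q := q) hη
  have hrange : ∀ c : evenClifford q, F c ∈ LinearMap.range G := by
    rintro ⟨c, hc⟩
    have hle : Clifford.evenSpan q ≤ (LinearMap.range G).comap F := by
      rw [Clifford.evenSpan, Submodule.span_le]
      rintro _ (rfl | ⟨x, y, α, rfl⟩)
      · change F 1 ∈ LinearMap.range G
        rw [hF1]; exact zero_mem _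
      · exact ⟨_, (hF x y α).symm⟩
    exact hle (by rwa [← evenClifford_toSubmodule hM])
  let F₀ : evenClifford q →ₗ[R] LinearMap.range G :=
    (F ∘ₗ (evenClifford q).val.toLinearMap).codRestrict _ hrange
  let e := LinearEquiv.ofInjective G hG
  refine ⟨e.symm.toLinearMap ∘ₗ F₀, ?_, fun x y α => ?_⟩
  · change e.symm (F₀ 1) = 0
    rw [e.symm.map_eq_zero_iff]
    exact Subtype.ext hF1
  · change e.symm (F₀ _) = _
    rw [LinearEquiv.symm_apply_eq]
    exact Subtype.ext (hF x y α)

end Functional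

/-! ### Orientations -/

section Orientation

variable {R : Type*} [CommRing R] {M I : Type*} [AddCommGroup M] [Module R M]
  [AddCommGroup I] [Module R I]

/-- An alternating trilinear map to an invertible module whose values generate that module. -/
def IsOrientation (ω : M →ₗ[R] M →ₗ[R] M →ₗ[R] I) : Prop :=
  IsAlt₃ ω ∧ ∀ m : Ideal R, m.IsMaximal → ∃ (α : Module.Dual R I) (x y z : M), α (ω x y z) ∉ m

theorem eq_zero_of_dual [Module.Invertible R I] {a : I} (h : ∀ α : Module.Dual R I, α a = 0) :
    a = 0 := by
  refine eq_zero_of_local (R := R) fun m hm => ?_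
  obtain ⟨f, x, hx⟩ := exists_dual_notMem (R := R) (P := I) hm
  exact ⟨f x, hx, by rw [dual_smul_comm, h, zero_smul]⟩

theorem IsAlt₃.compr {N : Type*} [AddCommGroup N] [Module R N] {ω : M →ₗ[R] M →ₗ[R] M →ₗ[R] I}
    (h : IsAlt₃ ω) (α : I →ₗ[R] N) : IsAlt₃ (ω.compr₂ (LinearMap.llcomp R M I N α)) :=
  ⟨fun x y => by simp [h.1], fun x y => by simp [h.2]⟩

variable [Module.Finite R M] [Module.Projective R M]
  (hM : ∀ p : PrimeSpectrum R, Module.rankAtStalk (R := R) M p = 3)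
  {ω : M →ₗ[R] M →ₗ[R] M →ₗ[R] I} (hω : IsOrientation ω)

include hM hω

theorem IsOrientation.exists_frame {m : Ideal R} (hm : m.IsMaximal) :
    ∃ (s : R) (fr : Frame M s) (γ : Module.Dual R I), s ∉ m ∧
      γ (ω (fr.e 0) (fr.e 1) (fr.e 2)) ∉ m := by
  obtain ⟨s, hs, ⟨fr⟩⟩ := QuaternionRings.exists_frame hM hm
  obtain ⟨γ, x, y, z, h⟩ := hω.2 m hm
  refine ⟨s, fr, γ, hs, fun h' => mul_notMem hm (pow_notMem hm hs 3) h ?_⟩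
  rw [← smul_eq_mul, ← map_smul, fr.alt₃ hω.1, map_smul]
  exact m.mul_mem_left _ h'

/-- Pairing `s • x` with two frame vectors isolates one coordinate of `x` times the volume of the
frame, a scalar outside `m` after applying `γ`. -/
theorem IsOrientation.eq_zero [Module.Invertible R I] {x : M} (h : ∀ y z, ω x y z = 0) :
    x = 0 := by
  refine eq_zero_of_local (R := R) fun m hm => ?_
  obtain ⟨s, fr, γ, hs, ht⟩ := hω.exists_frame hM hm
  set t := γ (ω (fr.e 0) (fr.e 1) (fr.e 2)) with ht'
  have key : ∀ y z, γ (ω (s • x) y z) = 0 := fun y z => by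
    rw [map_smul, LinearMap.smul_apply, LinearMap.smul_apply, h, smul_zero, map_zero]
  have h120 := hω.1.swap_right (fr.e 1) (fr.e 0) (fr.e 2)
  have h102 := hω.1.swap_left (fr.e 0) (fr.e 1) (fr.e 2)
  have h201 := hω.1.swap_left (fr.e 0) (fr.e 2) (fr.e 1)
  have h021 := hω.1.swap_right (fr.e 0) (fr.e 1) (fr.e 2)
  have h0 := key (fr.e 1) (fr.e 2)
  have h1 := key (fr.e 2) (fr.e 0)
  have h2 := key (fr.e 0) (fr.e 1)
  rw [← fr.sum_smul] at h0 h1 h2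
  simp [hω.1.1, hω.1.self_mid, h120, h102, h201, h021, ← ht'] at h0 h1 h2
  refine ⟨t * s, mul_notMem hm ht hs, ?_⟩
  rw [mul_smul, ← fr.sum_smul]
  simp only [smul_add, smul_smul, mul_comm t, h0, h1, h2, zero_smul, add_zero]

/-- An alternating trilinear map factors through an orientation. -/
theorem IsOrientation.exists_factor {N : Type*} [AddCommGroup N] [Module R N]
    {θ : M →ₗ[R] M →ₗ[R] M →ₗ[R] N} (hθ : IsAlt₃ θ) :
    ∃ g : I →ₗ[R] N, ∀ x y z, g (ω x y z) = θ x y z := by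
  -- The scalars `r` for which `r • θ` factors form an ideal. It contains each `α (ω x' y' z')`,
  -- through `a ↦ α a • θ x' y' z'`, by proportionality of alternating forms; these values lie in no
  -- common maximal ideal.
  let J : Ideal R :=
    { carrier := {r | ∃ g : I →ₗ[R] N, ∀ x y z, g (ω x y z) = r • θ x y z}
      zero_mem' := ⟨0, by simp⟩
      add_mem' := fun ⟨g, hg⟩ ⟨g', hg'⟩ => ⟨g + g', by simp [hg, hg', add_smul]⟩
      smul_mem' := fun c r ⟨g, hg⟩ => ⟨c • g, by simp [hg, mul_smul]⟩ }
  have h1 : (1 : R) ∈ J := mem_of_local J fun m hm => by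
    obtain ⟨α, x', y', z', h⟩ := hω.2 m hm
    refine ⟨_, h, α.smulRight (θ x' y' z'), fun x y z => ?_⟩
    rw [smul_eq_mul, mul_one]
    exact (alt₃_smul_comm hM hθ (hω.1.compr α) x y z x' y' z').symm
  obtain ⟨g, hg⟩ := h1
  exact ⟨g, by simpa using hg⟩

omit [Module.Finite R M] [Module.Projective R M] hM in
theorem IsOrientation.hom_ext [Module.Invertible R I] {N : Type*} [AddCommGroup N] [Module R N]
    {g g' : I →ₗ[R] N} (h : ∀ x y z, g (ω x y z) = g' (ω x y z)) : g = g' := by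
  ext a
  rw [← sub_eq_zero]
  refine eq_zero_of_local (R := R) fun m hm => ?_
  obtain ⟨α, x, y, z, hα⟩ := hω.2 m hm
  refine ⟨_, hα, ?_⟩
  rw [smul_sub, ← map_smul, ← map_smul, dual_smul_comm, map_smul, map_smul, h, sub_self]

/-- An isomorphism between oriented modules induces an isomorphism between the targets of the
orientations. -/
theorem IsOrientation.exists_equiv [Module.Invertible R I] {M' I' : Type*} [AddCommGroup M']
    [Module R M'] [AddCommGroup I'] [Module R I'] [Module.Invertible R I'] [Module.Finite R M']
    [Module.Projective R M']
    (hM' : ∀ p : PrimeSpectrum R, Module.rankAtStalk (R := R) M' p = 3)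
    {ω' : M' →ₗ[R] M' →ₗ[R] M' →ₗ[R] I'} (hω' : IsOrientation ω') (f : M ≃ₗ[R] M') :
    ∃ g : I ≃ₗ[R] I', ∀ x y z, g (ω x y z) = ω' (f x) (f y) (f z) := by
  obtain ⟨g, hg⟩ := hω.exists_factor hM
    (θ := (ω'.compl₁₂ f.toLinearMap f.toLinearMap).compr₂ (LinearMap.lcomp R I' f.toLinearMap))
    ⟨fun x y => by simp [hω'.1.1], fun x y => by simp [hω'.1.2]⟩
  obtain ⟨g', hg'⟩ := hω'.exists_factor hM'
    (θ := (ω.compl₁₂ f.symm.toLinearMap f.symm.toLinearMap).compr₂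
      (LinearMap.lcomp R I f.symm.toLinearMap))
    ⟨fun x y => by simp [hω.1.1], fun x y => by simp [hω.1.2]⟩
  simp only [LinearMap.compr₂_apply, LinearMap.compl₁₂_apply, LinearMap.lcomp_apply,
    LinearEquiv.coe_coe] at hg hg'
  exact ⟨LinearEquiv.ofLinearMap g g' (hω'.hom_ext fun x y z => by simp [hg, hg'])
    (hω.hom_ext fun x y z => by simp [hg, hg']), hg⟩

end Orientation

/-! ### The module as the dual of the even Clifford algebra modulo scalars -/

section OrientationMap

variable {R : Type u} {M I : Type v} [CommRing R] [AddCommGroup M] [Module R M]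
  [AddCommGroup I] [Module R I]

/-- The element `x y α` of the even Clifford algebra, as a trilinear map. -/
noncomputable def evenBivector (q : QuadraticMap R M I) :
    M →ₗ[R] M →ₗ[R] Module.Dual R I →ₗ[R] evenClifford q :=
  LinearMap.mk₂ R
    (fun x y =>
      { toFun := fun α => ⟨_, Clifford.bivector_mem q x y α⟩
        map_add' := fun α β => Subtype.ext (by simp [Clifford.bivector, mul_add])
        map_smul' := fun r α => Subtype.ext (by simp [Clifford.bivector]) })
    (fun x x' y => LinearMap.ext fun α => Subtype.ext (by simp [Clifford.bivector, add_mul]))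
    (fun r x y => LinearMap.ext fun α => Subtype.ext (by simp [Clifford.bivector]))
    (fun x y y' => LinearMap.ext fun α => Subtype.ext
      (by simp [Clifford.bivector, add_mul, mul_add]))
    (fun r x y => LinearMap.ext fun α => Subtype.ext (by simp [Clifford.bivector]))

theorem evenBivector_self (q : QuadraticMap R M I) (x : M) (α : Module.Dual R I) :
    evenBivector q x x α = algebraMap R _ (α (q x)) :=
  Subtype.ext (Clifford.bivector_self q x α)

theorem evenBivector_mul (q : QuadraticMap R M I) (x y z : M) (α β : Module.Dual R I) :
    evenBivector q x y α * evenBivector q y z β = α (q y) • evenBivector q x z β :=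
  Subtype.ext (Clifford.bivector_mul q x y z α β)

/-- `Ω` sends `x : M` to the functional `1 ↦ 0`, `y z α ↦ α (ω x y z)`. -/
def IsOrientationMap (q : QuadraticMap R M I) (ω : M →ₗ[R] M →ₗ[R] M →ₗ[R] I)
    (Ω : M →ₗ[R] Module.Dual R (evenClifford q)) : Prop :=
  ∀ x, Ω x 1 = 0 ∧ ∀ y z α, Ω x (evenBivector q y z α) = α (ω x y z)

variable {q : QuadraticMap R M I} [Module.Finite R M] [Module.Projective R M]
  [Module.Invertible R I] (hM : ∀ p : PrimeSpectrum R, Module.rankAtStalk (R := R) M p = 3)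

include hM

/-- A functional on the even part is determined by its values on `1` and the bivectors, so the
functionals chosen for each `x` depend linearly on `x`. -/
theorem exists_orientationMap {ω : M →ₗ[R] M →ₗ[R] M →ₗ[R] I} (hω : IsAlt₃ ω) :
    ∃ Ω, IsOrientationMap q ω Ω := by
  choose l h1 h2 using fun x => exists_functional (q := q) hM (η := ω x) (hω.2 x)
  exact ⟨{ toFun := l
           map_add' := fun x y => evenClifford_ext hM (by simp [h1]) fun _ _ _ => by simp [h2]
           map_smul' := fun r x => evenClifford_ext hM (by simp [h1]) fun _ _ _ => by simp [h2] },
    fun x => ⟨h1 x, h2 x⟩⟩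

variable {ω : M →ₗ[R] M →ₗ[R] M →ₗ[R] I} (hω : IsOrientation ω)
  {Ω : M →ₗ[R] Module.Dual R (evenClifford q)} (hΩ : IsOrientationMap q ω Ω)

include hω hΩ

theorem IsOrientationMap.injective : Function.Injective Ω :=
  (injective_iff_map_eq_zero Ω).mpr fun x hx => hω.eq_zero hM fun y z =>
    eq_zero_of_dual fun α => by rw [← (hΩ x).2, hx, LinearMap.zero_apply]

/-- A functional killing `1` makes `(y, z) ↦ w (y z α)` alternating, and in rank three an
alternating bilinear form is the contraction of the volume form with a vector. -/
theorem IsOrientationMap.mem_range {w : Module.Dual R (evenClifford q)} (hw : w 1 = 0) :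
    w ∈ LinearMap.range Ω := by
  refine mem_of_local _ fun m hm => ?_
  obtain ⟨s, fr, γ, hs, ht⟩ := hω.exists_frame hM hm
  set a := ω (fr.e 0) (fr.e 1) (fr.e 2) with ha
  have hs2 : s ^ 2 * γ a ∉ m := mul_notMem hm (pow_notMem hm hs 2) ht
  -- The coefficient of each frame vector is the value of `w` on the bivector of the other two, in
  -- cyclic order. The factor `γ a` is the volume of the frame, and `s ^ 2` comes from expanding `y`
  -- and `z`.
  refine ⟨s ^ 2 * γ a, hs2, s ^ 2 • (w (evenBivector q (fr.e 1) (fr.e 2) γ) • fr.e 0 +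
    w (evenBivector q (fr.e 2) (fr.e 0) γ) • fr.e 1 +
    w (evenBivector q (fr.e 0) (fr.e 1) γ) • fr.e 2), ?_⟩
  set x := w (evenBivector q (fr.e 1) (fr.e 2) γ) • fr.e 0 +
    w (evenBivector q (fr.e 2) (fr.e 0) γ) • fr.e 1 +
    w (evenBivector q (fr.e 0) (fr.e 1) γ) • fr.e 2 with hx
  have hself : ∀ y α, w (evenBivector q y y α) = 0 := fun y α => by
    rw [evenBivector_self, Algebra.algebraMap_eq_smul_one, map_smul, hw, smul_zero]
  have hswap : ∀ y z α, w (evenBivector q z y α) = -w (evenBivector q y z α) := fun y z α => by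
    have := hself (y + z) α
    simp only [map_add, LinearMap.add_apply, hself, zero_add, add_zero] at this
    exact eq_neg_of_add_eq_zero_left this
  refine evenClifford_ext hM (by simp [(hΩ x).1, hw]) fun y z α => ?_
  change Ω (s ^ 2 • x) (evenBivector q y z α) = (s ^ 2 * γ a) • w (evenBivector q y z α)
  rw [map_smul, LinearMap.smul_apply, (hΩ x).2, mul_smul, ← sub_eq_zero, ← smul_sub]
  have hcomm : ∀ i j, γ a * w (evenBivector q (fr.e i) (fr.e j) α) =
      α a * w (evenBivector q (fr.e i) (fr.e j) γ) := fun i j => by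
    simpa using congrArg (fun β => w (evenBivector q (fr.e i) (fr.e j) β)) (dual_apply_smul α γ a)
  let F : M →ₗ[R] M →ₗ[R] R := (ω x).compr₂ α -
    γ a • (evenBivector q).compr₂ (w ∘ₗ LinearMap.applyₗ α)
  have hF : ∀ y z, F y z = α (ω x y z) - γ a • w (evenBivector q y z α) := fun _ _ => rfl
  have h120 := hω.1.swap_right (fr.e 1) (fr.e 0) (fr.e 2)
  have h102 := hω.1.swap_left (fr.e 0) (fr.e 1) (fr.e 2)
  have h201 := hω.1.swap_left (fr.e 0) (fr.e 2) (fr.e 1)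
  have h021 := hω.1.swap_right (fr.e 0) (fr.e 1) (fr.e 2)
  have h210 := hω.1.swap_right (fr.e 2) (fr.e 0) (fr.e 1)
  have := fr.mem₂ ⊥ F (fun i j => ?_) y z
  · simpa [hF] using this
  · rw [Submodule.mem_bot, hF, smul_eq_mul, hcomm, hx]
    fin_cases i <;> fin_cases j <;>
      simp [hω.1.1, hω.1.2, hω.1.self_mid, h120, h102, h201, h021, h210, hself, ← ha,
        hswap (fr.e 0) (fr.e 2), hswap (fr.e 0) (fr.e 1), hswap (fr.e 1) (fr.e 2)] <;> ring

/-- Up to a scalar outside `m`, the even part is spanned by `1` and the three bivectors of a frame;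
evaluating `Ω` at the frame vectors reads off the coefficients of the bivectors. -/
theorem IsOrientationMap.mem_scalars {b : evenClifford q} (hb : ∀ x, Ω x b = 0) :
    b ∈ LinearMap.range (Algebra.linearMap R (evenClifford q)) := by
  refine mem_of_local _ fun m hm => ?_
  obtain ⟨s, fr, γ, hs, ht⟩ := hω.exists_frame hM hm
  set a := ω (fr.e 0) (fr.e 1) (fr.e 2) with ha
  let L : Submodule R (evenClifford q) := Submodule.span R {1, evenBivector q (fr.e 1) (fr.e 2) γ,
    evenBivector q (fr.e 2) (fr.e 0) γ, evenBivector q (fr.e 0) (fr.e 1) γ}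
  have h1L : (1 : evenClifford q) ∈ L := Submodule.subset_span (by simp)
  have hswap : ∀ y z α, evenBivector q y z α ∈ L → evenBivector q z y α ∈ L := fun y z α h => by
    have := evenBivector_self q (y + z) α
    simp only [map_add, LinearMap.add_apply, evenBivector_self, Algebra.algebraMap_eq_smul_one]
      at this
    have h2 : evenBivector q z y α = α (q (y + z)) • (1 : evenClifford q) - α (q y) • 1 -
        α (q z) • 1 - evenBivector q y z α := by
      rw [← this]; abel
    rw [h2]
    exact L.sub_mem (L.sub_mem (L.sub_mem (L.smul_mem _ h1L) (L.smul_mem _ h1L))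
      (L.smul_mem _ h1L)) h
  have h12 : evenBivector q (fr.e 1) (fr.e 2) γ ∈ L := Submodule.subset_span (by simp)
  have h20 : evenBivector q (fr.e 2) (fr.e 0) γ ∈ L := Submodule.subset_span (by simp)
  have h01 : evenBivector q (fr.e 0) (fr.e 1) γ ∈ L := Submodule.subset_span (by simp)
  have hself : ∀ y, evenBivector q y y γ ∈ L := fun y => by
    rw [evenBivector_self, Algebra.algebraMap_eq_smul_one]
    exact L.smul_mem _ h1L
  have hij : ∀ i j, evenBivector q (fr.e i) (fr.e j) γ ∈ L := by
    intro i j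
    fin_cases i <;> fin_cases j
    exacts [hself _, h01, hswap _ _ _ h20, hswap _ _ _ h01, hself _, h12, h20, hswap _ _ _ h12,
      hself _]
  have hL : ∀ c, (s ^ 2 * γ a) • c ∈ L := by
    have : L.mkQ ∘ₗ LinearMap.lsmul R _ (s ^ 2 * γ a) = 0 := by
      refine evenClifford_ext hM ?_ fun y z α => ?_
      · exact (Submodule.Quotient.mk_eq_zero L).mpr (L.smul_mem _ h1L)
      · change L.mkQ ((s ^ 2 * γ a) • evenBivector q y z α) = 0
        rw [Submodule.mkQ_apply, Submodule.Quotient.mk_eq_zero, mul_smul, ← map_smul,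
          dual_apply_smul α γ a, map_smul, smul_comm]
        exact L.smul_mem _ (fr.mem₂ L ((evenBivector q).compr₂ (LinearMap.applyₗ γ)) hij y z)
    exact fun c => (Submodule.Quotient.mk_eq_zero L).mp (LinearMap.congr_fun this c)
  have hbL := hL b
  simp only [L, Submodule.mem_span_insert, Submodule.mem_span_singleton] at hbL
  obtain ⟨r, _, ⟨c₀, _, ⟨c₁, _, ⟨c₂, rfl⟩, rfl⟩, rfl⟩, hbr⟩ := hbL
  have hc : ∀ x, c₀ * γ (ω x (fr.e 1) (fr.e 2)) + (c₁ * γ (ω x (fr.e 2) (fr.e 0)) +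
      c₂ * γ (ω x (fr.e 0) (fr.e 1))) = 0 := fun x => by
    have := congrArg (Ω x) hbr
    simp only [map_add, map_smul, hb, (hΩ x).1, (hΩ x).2, smul_eq_mul, mul_zero, zero_add] at this
    exact this.symm
  have h120 := hω.1.swap_right (fr.e 1) (fr.e 0) (fr.e 2)
  have h102 := hω.1.swap_left (fr.e 0) (fr.e 1) (fr.e 2)
  have h201 := hω.1.swap_left (fr.e 0) (fr.e 2) (fr.e 1)
  have h021 := hω.1.swap_right (fr.e 0) (fr.e 1) (fr.e 2)
  have hc0 := hc (fr.e 0)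
  have hc1 := hc (fr.e 1)
  have hc2 := hc (fr.e 2)
  simp [hω.1.1, hω.1.self_mid, h120, h102, h201, h021, ← ha] at hc0 hc1 hc2
  -- The evaluations only give `cᵢ * γ a = 0`, so a second factor `γ a` is needed to remove the
  -- bivector terms.
  refine ⟨γ a * (s ^ 2 * γ a), mul_notMem hm ht (mul_notMem hm (pow_notMem hm hs 2) ht),
    γ a * r, ?_⟩
  rw [mul_smul, hbr]
  simp only [smul_add, smul_smul, mul_comm (γ a), hc0, hc1, hc2, zero_smul, add_zero]
  rw [Algebra.linearMap_apply, Algebra.algebraMap_eq_smul_one]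

end OrientationMap

/-! ### Recovering an oriented quadratic module from its even Clifford algebra -/

section Reconstruction

variable {R : Type u} [CommRing R] {M I M' I' : Type v}
  [AddCommGroup M] [Module R M] [Module.Finite R M] [Module.Projective R M]
  [AddCommGroup I] [Module R I] [Module.Invertible R I]
  [AddCommGroup M'] [Module R M'] [Module.Finite R M'] [Module.Projective R M']
  [AddCommGroup I'] [Module R I'] [Module.Invertible R I']
  (hM : ∀ p : PrimeSpectrum R, Module.rankAtStalk (R := R) M p = 3)
  (hM' : ∀ p : PrimeSpectrum R, Module.rankAtStalk (R := R) M' p = 3)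
  {q : QuadraticMap R M I} {q' : QuadraticMap R M' I'}
  {ω : M →ₗ[R] M →ₗ[R] M →ₗ[R] I} (hω : IsOrientation ω)
  {ω' : M' →ₗ[R] M' →ₗ[R] M' →ₗ[R] I'} (hω' : IsOrientation ω')

omit [Module.Invertible R I] in
include hM hω in
/-- A quadratic map vanishes if its product with every value of an orientation does. -/
theorem IsOrientation.quadraticMap_eq_zero {N : Type*} [AddCommGroup N] [Module R N]
    [Module.Invertible R N] {Δ : QuadraticMap R M N}
    (h : ∀ x y z (α : Module.Dual R N) (β : Module.Dual R I), α (Δ x) * β (ω x y z) = 0) : Δ = 0 := by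
  ext x
  refine eq_zero_of_local (R := R) fun m hm => ?_
  obtain ⟨s, fr, γ, hs, ht⟩ := hω.exists_frame hM hm
  set t := γ (ω (fr.e 0) (fr.e 1) (fr.e 2)) with ht'
  have h102 := hω.1.swap_left (fr.e 0) (fr.e 1) (fr.e 2)
  have h120 := hω.1.swap_right (fr.e 1) (fr.e 0) (fr.e 2)
  have h021 := hω.1.swap_right (fr.e 0) (fr.e 1) (fr.e 2)
  have h201 := hω.1.swap_left (fr.e 0) (fr.e 2) (fr.e 1)
  -- The scalar `t` kills `Δ` at any vector belonging to a triple of volume `t`. The `e i` and the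
  -- sums `e i + e j` are such vectors, and they determine a quadratic map on the span of the frame.
  have key : ∀ x y z, γ (ω x y z) = t → t • Δ x = 0 := fun x y z hxyz =>
    eq_zero_of_dual fun α => by rw [map_smul, smul_eq_mul, mul_comm, ← hxyz, h]
  have k0 := key (fr.e 0) (fr.e 1) (fr.e 2) rfl
  have k1 := key (fr.e 1) (fr.e 2) (fr.e 0) (by simp [h120, h102, ← ht'])
  have k2 := key (fr.e 2) (fr.e 0) (fr.e 1) (by simp [h201, h021, ← ht'])
  have k01 := key (fr.e 0 + fr.e 1) (fr.e 1) (fr.e 2) (by simp [hω.1.1, ← ht'])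
  have k12 := key (fr.e 1 + fr.e 2) (fr.e 2) (fr.e 0) (by simp [hω.1.1, h120, h102, ← ht'])
  have k02 := key (fr.e 0 + fr.e 2) (fr.e 1) (fr.e 2) (by simp [hω.1.self_mid, ← ht'])
  refine ⟨t * s ^ 2, mul_notMem hm ht (pow_notMem hm hs 2), ?_⟩
  rw [mul_smul, sq, ← QuadraticMap.map_smul, ← fr.sum_smul]
  rw [QuadraticMap.map_add Δ, smul_add, smul_add] at k01 k12 k02
  rw [k0, k1, zero_add, zero_add] at k01
  rw [k1, k2, zero_add, zero_add] at k12
  rw [k0, k2, zero_add, zero_add] at k02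
  rw [QuadraticMap.map_add Δ, QuadraticMap.map_add Δ]
  simp only [QuadraticMap.map_smul, QuadraticMap.polar_add_left, QuadraticMap.polar_smul_left,
    QuadraticMap.polar_smul_right]
  linear_combination (norm := module) (fr.c 0 x * fr.c 0 x) • k0 + (fr.c 1 x * fr.c 1 x) • k1 +
    (fr.c 2 x * fr.c 2 x) • k2 + (fr.c 0 x * fr.c 1 x) • k01 + (fr.c 1 x * fr.c 2 x) • k12 +
    (fr.c 0 x * fr.c 2 x) • k02

include hM hM' hω hω' in
/-- The orientation maps turn an isomorphism of even Clifford algebras into an isomorphism of the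
underlying modules. -/
theorem IsOrientationMap.exists_equiv {Ω : M →ₗ[R] Module.Dual R (evenClifford q)}
    (hΩ : IsOrientationMap q ω Ω) {Ω' : M' →ₗ[R] Module.Dual R (evenClifford q')}
    (hΩ' : IsOrientationMap q' ω' Ω') (ψ : evenClifford q ≃ₐ[R] evenClifford q') :
    ∃ f : M ≃ₗ[R] M', ∀ x b, Ω' (f x) (ψ b) = Ω x b := by
  -- Both ranges consist of the functionals that vanish at `1`, a condition preserved by `ψ`.
  have hmap : (LinearMap.range Ω').map ψ.toLinearEquiv.dualMap.toLinearMap =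
      LinearMap.range Ω := by
    apply le_antisymm
    · rintro _ ⟨_, ⟨x, rfl⟩, rfl⟩
      refine hΩ.mem_range hM hω ?_
      change Ω' x (ψ 1) = 0
      rw [map_one, (hΩ' x).1]
    · rintro _ ⟨x, rfl⟩
      refine ⟨Ω x ∘ₗ ψ.symm.toLinearMap, hΩ'.mem_range hM' hω' ?_, ?_⟩
      · change Ω x (ψ.symm 1) = 0
        rw [map_one, (hΩ x).1]
      · ext b
        change Ω x (ψ.symm (ψ b)) = _
        rw [AlgEquiv.symm_apply_apply]
  let f : M' ≃ₗ[R] M := (LinearEquiv.ofInjective Ω' (hΩ'.injective hM' hω')).trans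
    ((ψ.toLinearEquiv.dualMap.ofSubmodules _ _ hmap).trans
      (LinearEquiv.ofInjective Ω (hΩ.injective hM hω)).symm)
  have hf : ∀ x, Ω (f x) = ψ.toLinearEquiv.dualMap (Ω' x) := fun x => by
    have := LinearEquiv.apply_symm_apply (LinearEquiv.ofInjective Ω (hΩ.injective hM hω))
      (ψ.toLinearEquiv.dualMap.ofSubmodules _ _ hmap
        (LinearEquiv.ofInjective Ω' (hΩ'.injective hM' hω') x))
    exact congrArg Subtype.val this
  refine ⟨f.symm, fun x b => ?_⟩
  have := hf (f.symm x)
  rw [LinearEquiv.apply_symm_apply] at this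
  rw [this]
  rfl

include hM hM' hω hω' in
/-- Oriented ternary quadratic modules with isomorphic even Clifford algebras are isometric. -/
theorem IsOrientation.exists_isometry (ψ : evenClifford q ≃ₐ[R] evenClifford q') :
    ∃ (f : M ≃ₗ[R] M') (g : I ≃ₗ[R] I'), ∀ x, q' (f x) = g (q x) := by
  obtain ⟨Ω, hΩ⟩ := exists_orientationMap (q := q) hM hω.1
  obtain ⟨Ω', hΩ'⟩ := exists_orientationMap (q := q') hM' hω'.1
  obtain ⟨f, hf⟩ := hΩ.exists_equiv hM hM' hω hω' hΩ' ψ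
  obtain ⟨g, hg⟩ := hω.exists_equiv hM hM' hω' f
  -- The functionals `Ω'` agree on the two bivectors, since `g` carries `ω` to `ω'`; hence these
  -- differ by a scalar.
  have hψ : ∀ x y α, ∃ r, ψ (evenBivector q x y (α ∘ₗ g.toLinearMap)) =
      evenBivector q' (f x) (f y) α + algebraMap R _ r := by
    intro x y α
    obtain ⟨r, hr⟩ := hΩ'.mem_scalars hM' hω' (b := ψ (evenBivector q x y (α ∘ₗ g.toLinearMap)) -
      evenBivector q' (f x) (f y) α) fun z => by
        obtain ⟨z, rfl⟩ := f.surjective z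
        rw [map_sub, hf, (hΩ z).2, (hΩ' _).2, ← hg]
        exact sub_self _
    exact ⟨r, by rw [← Algebra.linearMap_apply, hr]; abel⟩
  have hΔ : g.toLinearMap.compQuadraticMap q - q'.comp f.toLinearMap = 0 := by
    refine hω.quadraticMap_eq_zero hM fun y x z α β => ?_
    obtain ⟨r₁, h₁⟩ := hψ x y α
    obtain ⟨r₂, h₂⟩ := hψ y z (β ∘ₗ g.symm.toLinearMap)
    obtain ⟨r₃, h₃⟩ := hψ x z (β ∘ₗ g.symm.toLinearMap)
    -- The middle vector `y` is the right one to test with: `Ω' (f y)` kills scalars and every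
    -- bivector containing `f y`, hence all error terms from `r₁`, `r₂`, `r₃`. What remains is `α (g
    -- (q y))` against `α (q' (f y))`, each times `β (ω y x z)`.
    have h := congrArg (fun b => Ω' (f y) (ψ b)) (evenBivector_mul q x y z (α ∘ₗ g.toLinearMap)
      ((β ∘ₗ g.symm.toLinearMap) ∘ₗ g.toLinearMap))
    simp only [map_mul, map_smul, h₁, h₂, h₃] at h
    simp only [Algebra.algebraMap_eq_smul_one, add_mul, mul_add, smul_mul_assoc, mul_smul_comm,
      one_mul, mul_one, evenBivector_mul, map_add, map_smul, (hΩ' _).1, (hΩ' _).2, hω'.1.1,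
      hω'.1.self_mid, ← hg] at h
    simp at h
    change α (g (q y) - q' (f y)) * β (ω y x z) = 0
    rw [map_sub, sub_mul, sub_eq_zero, h]
  exact ⟨f, g, fun x => (sub_eq_zero.mp (congrArg (fun Q => Q x) hΔ)).symm⟩

end Reconstruction

/-! ### Every ternary quadratic module has an oriented twist -/

section AltForms

set_option maxSynthPendingDepth 3

/-- The hypothesis says that `p₀` generates `P` near `m` with coordinate `l`. Then `(l p₀)²` times
any tensor in `P^∨ ⊗ P` is a multiple of `l ⊗ p₀` by its evaluation, which gives injectivity, and
the values `l p₀` give surjectivity. -/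
theorem invertible_of_local {R P : Type*} [CommRing R] [AddCommGroup P] [Module R P]
    (h : ∀ m : Ideal R, m.IsMaximal → ∃ (l : Module.Dual R P) (p₀ : P), l p₀ ∉ m ∧
      ∀ p, l p • p₀ = l p₀ • p) : Module.Invertible R P := by
  refine ⟨(injective_iff_map_eq_zero _).mpr fun z hz => ?_, fun r => ?_⟩
  · refine eq_zero_of_local (R := R) fun m hm => ?_
    obtain ⟨l, p₀, hl, hp⟩ := h m hm
    have key : ∀ z, (l p₀ * l p₀) • z = (l p₀ * contractLeft R P z) • (l ⊗ₜ[R] p₀) := by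
      intro z
      induction z with
      | zero => simp
      | add x y hx hy => rw [smul_add, hx, hy, map_add, mul_add, add_smul]
      | tmul φ p =>
        have hφ : l p₀ • φ = φ p₀ • l := by
          ext p
          have := congrArg φ (hp p)
          rw [map_smul, map_smul, smul_eq_mul] at this
          simp only [LinearMap.smul_apply, smul_eq_mul] at this ⊢
          rw [← this, mul_comm]
        have hlp : l p₀ * φ p = l p * φ p₀ := by
          simpa using (congrArg φ (hp p)).symm
        calc (l p₀ * l p₀) • φ ⊗ₜ[R] p = (l p₀ • φ) ⊗ₜ[R] (l p₀ • p) := by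
              rw [TensorProduct.tmul_smul, ← TensorProduct.smul_tmul', mul_smul]
          _ = (φ p₀ • l) ⊗ₜ[R] (l p • p₀) := by rw [hφ, hp]
          _ = _ := by
              rw [TensorProduct.tmul_smul, ← TensorProduct.smul_tmul', smul_smul,
                contractLeft_apply, hlp]
    exact ⟨_, mul_notMem hm hl hl, by rw [key, hz, mul_zero, zero_smul]⟩
  · have : (1 : R) ∈ LinearMap.range (contractLeft R P) := mem_of_local _ fun m hm => by
      obtain ⟨l, p₀, hl, -⟩ := h m hm
      exact ⟨l p₀, hl, l ⊗ₜ p₀, by simp⟩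
    obtain ⟨z, hz⟩ := this
    exact ⟨r • z, by rw [map_smul, hz, smul_eq_mul, mul_one]⟩

variable {R : Type u} [CommRing R] {M I : Type v} [AddCommGroup M] [Module R M]
  [AddCommGroup I] [Module R I]

variable (R M I) in
/-- The module of alternating trilinear maps. -/
def altForms : Submodule R (M →ₗ[R] M →ₗ[R] M →ₗ[R] I) where
  carrier := {ω | IsAlt₃ ω}
  zero_mem' := ⟨fun _ _ => rfl, fun _ _ => rfl⟩
  add_mem' h h' := ⟨fun x y => by simp [h.1, h'.1], fun x y => by simp [h.2, h'.2]⟩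
  smul_mem' r _ h := ⟨fun x y => by simp [h.1], fun x y => by simp [h.2]⟩

/-- The form is the determinant of the coordinates `fr.c`, written as a signed sum over
permutations. -/
theorem Frame.exists_isAlt₃ {s : R} (fr : Frame M s) :
    ∃ κ : M →ₗ[R] M →ₗ[R] M →ₗ[R] R, IsAlt₃ κ ∧ κ (fr.e 0) (fr.e 1) (fr.e 2) = s ^ 3 := by
  let θ : Fin 3 → Fin 3 → Fin 3 → M →ₗ[R] M →ₗ[R] M →ₗ[R] R := fun i j k =>
    (fr.c i).smulRight ((fr.c j).smulRight (fr.c k))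
  have hθ : ∀ i j k x y z, θ i j k x y z = fr.c i x * (fr.c j y * fr.c k z) := fun _ _ _ _ _ _ => rfl
  refine ⟨θ 0 1 2 - θ 0 2 1 + θ 1 2 0 - θ 1 0 2 + θ 2 0 1 - θ 2 1 0,
    ⟨fun x y => ?_, fun x y => ?_⟩, ?_⟩
  · simp only [LinearMap.add_apply, LinearMap.sub_apply, hθ]; ring
  · simp only [LinearMap.add_apply, LinearMap.sub_apply, hθ]; ring
  · simp [hθ, fr.apply_self]; ring

/-- Only `p₁` acts as a form, while `p₂` and `p₃` are carried along. The expression becomes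
alternating because `P` has rank one in the application. -/
theorem exists_tensorForm {P : Type*} [AddCommGroup P] [Module R P]
    (Λ : P →ₗ[R] M →ₗ[R] M →ₗ[R] M →ₗ[R] I) :
    ∃ ω : M ⊗[R] P →ₗ[R] M ⊗[R] P →ₗ[R] M ⊗[R] P →ₗ[R] I ⊗[R] (P ⊗[R] P),
      ∀ x y z p₁ p₂ p₃, ω (x ⊗ₜ p₁) (y ⊗ₜ p₂) (z ⊗ₜ p₃) = Λ p₁ x y z ⊗ₜ (p₂ ⊗ₜ p₃) :=
  ⟨LinearMap.BilinMap.tensorDistrib R R ∘ₗ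
    (TensorProduct.mk R (LinearMap.BilinMap R M I) (LinearMap.BilinMap R P (P ⊗[R] P))).flip
      (TensorProduct.mk R P P) ∘ₗ TensorProduct.lift Λ.flip, fun _ _ _ _ _ _ => rfl⟩

/-- If the module `P` of alternating forms has local generators, then `M ⊗ P` carries the orientation
`(x ⊗ p₁, y ⊗ p₂, z ⊗ p₃) ↦ p₁ (x, y, z) ⊗ (p₂ ⊗ p₃)`. -/
theorem exists_isOrientation_tensor {P : Type*} [AddCommGroup P] [Module R P]
    {Λ : P →ₗ[R] M →ₗ[R] M →ₗ[R] M →ₗ[R] I} (hΛ : ∀ p, IsAlt₃ (Λ p))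
    (hP : ∀ m : Ideal R, m.IsMaximal → ∃ (α : Module.Dual R I) (x y z : M) (p₀ : P),
      α (Λ p₀ x y z) ∉ m ∧ ∀ p, α (Λ p x y z) • p₀ = α (Λ p₀ x y z) • p) :
    ∃ ω : M ⊗[R] P →ₗ[R] M ⊗[R] P →ₗ[R] M ⊗[R] P →ₗ[R] I ⊗[R] (P ⊗[R] P), IsOrientation ω := by
  obtain ⟨ω, hω⟩ := exists_tensorForm Λ
  -- Near `m` all tensors become pure with one common second factor `p`, so alternation of `ω`
  -- reduces to that of the single form `Λ p`.
  have hloc : ∀ m : Ideal R, m.IsMaximal → ∃ r ∉ m, ∃ p : P, ∀ z : M ⊗[R] P, ∃ x : M,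
      r • z = x ⊗ₜ p := fun m hm => by
    obtain ⟨α, x, y, z, ω₀, h1, h2⟩ := hP m hm
    refine ⟨_, h1, ω₀, fun w => ?_⟩
    induction w with
    | zero => exact ⟨0, by simp⟩
    | add w w' hw hw' =>
      obtain ⟨x, hx⟩ := hw
      obtain ⟨x', hx'⟩ := hw'
      exact ⟨x + x', by rw [smul_add, hx, hx', TensorProduct.add_tmul]⟩
    | tmul x' p =>
      exact ⟨α (Λ p x y z) • x', by
        rw [← TensorProduct.tmul_smul, ← h2, TensorProduct.tmul_smul, TensorProduct.smul_tmul']⟩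
  refine ⟨ω, ⟨fun w w' => ?_, fun w w' => ?_⟩, fun m hm => ?_⟩
  · refine eq_zero_of_local (R := R) fun m hm => ?_
    obtain ⟨r, hr, p, h⟩ := hloc m hm
    obtain ⟨x, hx⟩ := h w
    obtain ⟨y, hy⟩ := h w'
    refine ⟨r * (r * r), mul_notMem hm hr (mul_notMem hm hr hr), ?_⟩
    have : (r * (r * r)) • ω w w w' = ω (r • w) (r • w) (r • w') := by
      simp [mul_smul]
    rw [this, hx, hy, hω, (hΛ p).1, TensorProduct.zero_tmul]
  · refine eq_zero_of_local (R := R) fun m hm => ?_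
    obtain ⟨r, hr, p, h⟩ := hloc m hm
    obtain ⟨x, hx⟩ := h w
    obtain ⟨y, hy⟩ := h w'
    refine ⟨r * (r * r), mul_notMem hm hr (mul_notMem hm hr hr), ?_⟩
    have : (r * (r * r)) • ω w w' w' = ω (r • w) (r • w') (r • w') := by
      simp [mul_smul]
    rw [this, hx, hy, hω, (hΛ p).2, TensorProduct.zero_tmul]
  · obtain ⟨α, x, y, z, p, h1, -⟩ := hP m hm
    let l : Module.Dual R (P) := α ∘ₗ LinearMap.applyₗ z ∘ₗ LinearMap.applyₗ y ∘ₗ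
      LinearMap.applyₗ x ∘ₗ Λ
    refine ⟨LinearMap.mul' R R ∘ₗ TensorProduct.map α (LinearMap.mul' R R ∘ₗ TensorProduct.map l l),
      x ⊗ₜ p, y ⊗ₜ p, z ⊗ₜ p, ?_⟩
    rw [hω]
    exact mul_notMem hm h1 (mul_notMem hm h1 h1)

variable [Module.Finite R M] [Module.Projective R M] [Module.Invertible R I]
  (hM : ∀ p : PrimeSpectrum R, Module.rankAtStalk (R := R) M p = 3)

include hM

/-- The determinant form of a frame times a local generator `a` of `I` generates the alternating
forms near `m`; its coordinate is evaluation on the frame followed by `α`. -/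
theorem exists_altForm {m : Ideal R} (hm : m.IsMaximal) :
    ∃ (α : Module.Dual R I) (x y z : M) (ω₀ : altForms R M I), α (ω₀.1 x y z) ∉ m ∧
      ∀ ω : altForms R M I, α (ω.1 x y z) • ω₀ = α (ω₀.1 x y z) • ω := by
  obtain ⟨s, hs, ⟨fr⟩⟩ := exists_frame hM hm
  obtain ⟨α, a, hα⟩ := exists_dual_notMem (R := R) (P := I) hm
  obtain ⟨κ, hκ, hs3⟩ := fr.exists_isAlt₃
  refine ⟨α, fr.e 0, fr.e 1, fr.e 2, ⟨_, hκ.compr (LinearMap.toSpanSingleton R I a)⟩, ?_,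
    fun ω => Subtype.ext ?_⟩
  · change α (κ _ _ _ • a) ∉ m
    rw [map_smul, hs3]
    exact mul_notMem hm (pow_notMem hm hs 3) hα
  · ext x y z
    change α (ω.1 _ _ _) • κ x y z • a = α (κ _ _ _ • a) • ω.1 x y z
    rw [smul_comm, dual_smul_comm, map_smul, smul_assoc, smul_comm _ (α a), smul_comm _ (α a),
      alt₃_smul_comm hM ω.2 hκ x y z]

theorem altForms_invertible : Module.Invertible R (altForms R M I) :=
  invertible_of_local fun m hm => by
    obtain ⟨α, x, y, z, ω₀, h1, h2⟩ := exists_altForm (I := I) hM hm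
    exact ⟨α ∘ₗ LinearMap.applyₗ z ∘ₗ LinearMap.applyₗ y ∘ₗ LinearMap.applyₗ x ∘ₗ
      (altForms R M I).subtype, ω₀, h1, h2⟩

end AltForms

set_option maxSynthPendingDepth 3 in
theorem TernaryQuadraticModule.exists_oriented_twist {R : Type u} [CommRing R]
    (X : TernaryQuadraticModule R) : ∃ Z : TernaryQuadraticModule R, X.TwistedIsometric Z ∧
      ∃ ω : Z.M →ₗ[R] Z.M →ₗ[R] Z.M →ₗ[R] Z.I, IsOrientation ω := by
  have := altForms_invertible (I := X.I) X.rank_eq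
  -- This choice makes the third exterior power of `M ⊗ P` isomorphic to `I ⊗ Q`: one of the three
  -- factors `P` cancels against `Λ³M` to give `I`, and the other two form `Q`.
  let D : TwistedDiscriminantModule R :=
    { P := altForms R X.M X.I
      Q := altForms R X.M X.I ⊗[R] altForms R X.M X.I
      d := .refl R _ }
  exact ⟨X.twist D, ⟨D, .refl R _, .refl R _, fun _ => rfl⟩,
    exists_isOrientation_tensor (Λ := (altForms R X.M X.I).subtype) (fun p => p.2) fun _ hm =>
      exists_altForm X.rank_eq hm⟩

/-- Ternary quadratic modules are twisted isometric if and only if their even Clifford algebras are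
isomorphic. -/
theorem TernaryQuadraticModule.twistedIsometric_iff {R : Type u} [CommRing R]
    {X Y : TernaryQuadraticModule R} :
    X.TwistedIsometric Y ↔ Nonempty (evenClifford X.q ≃ₐ[R] evenClifford Y.q) := by
  refine ⟨TwistedIsometric.evenClifford, fun ⟨ψ⟩ => ?_⟩
  obtain ⟨Z, hZ, ω, hω⟩ := X.exists_oriented_twist
  obtain ⟨Z', hZ', ω', hω'⟩ := Y.exists_oriented_twist
  obtain ⟨φ⟩ := hZ.evenClifford
  obtain ⟨φ'⟩ := hZ'.evenClifford
  -- The oriented twists inherit an isomorphism of even Clifford algebras, so they are isometric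
  -- without further twisting.
  have h : Z.Isometric Z' :=
    hω.exists_isometry Z.rank_eq Z'.rank_eq hω' (φ.symm.trans (ψ.trans φ'))
  exact twistedIsometric_equivalence.trans hZ
    (twistedIsometric_equivalence.trans ⟨_, Z.twist_unit.trans h⟩
      (twistedIsometric_equivalence.symm hZ'))

end QuaternionRings

/-! ### The bijection and its naturality -/

theorem mainTheorem3 :
    ∃ Φ : ∀ (R : Type u) [CommRing R], TwistedIsometryClasses R ≃ QuaternionRingClasses R,
      -- the twisted isometry class of `(M, I, q)` corresponds to the class of `C⁰(M, I, q)`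
      (∀ (R : Type u) [CommRing R] (X : TernaryQuadraticModule R),
        Φ R ⟦X⟧ = ⟦X.evenCliffordRing⟧) ∧
      -- for every ring homomorphism `R → S`, extension of scalars is well defined on both sides,
      -- and the bijections over `R` and `S` commute with it
      ∀ (R S : Type u) [CommRing R] [CommRing S] [Algebra R S],
        ∃ (βM : TwistedIsometryClasses R → TwistedIsometryClasses S)
          (βB : QuaternionRingClasses R → QuaternionRingClasses S),
          (∀ X : TernaryQuadraticModule R, βM ⟦X⟧ = ⟦X.baseChange S⟧) ∧
          (∀ B : QuaternionRing R, ∃ h : IsQuaternionRing S (S ⊗[R] B.B),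
            βB ⟦B⟧ = ⟦({ B := S ⊗[R] B.B, isQuaternionRing := h } : QuaternionRing S)⟧) ∧
          ∀ c : TwistedIsometryClasses R, Φ S (βM c) = βB (Φ R c) := by
  have hΦ : ∀ (R : Type u) [CommRing R], Function.Bijective
      (Quotient.map TernaryQuadraticModule.evenCliffordRing fun _ _ =>
        TernaryQuadraticModule.TwistedIsometric.evenClifford :
        TwistedIsometryClasses R → QuaternionRingClasses R) := by
    intro R _
    refine ⟨?_, ?_⟩
    · rintro ⟨X⟩ ⟨Y⟩ h
      exact Quotient.sound (TernaryQuadraticModule.twistedIsometric_iff.mpr (Quotient.exact h))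
    · rintro ⟨B⟩
      obtain ⟨X, ⟨e⟩⟩ := B.isQuaternionRing
      exact ⟨⟦X⟧, Quotient.sound ⟨e.symm⟩⟩
  refine ⟨fun R _ => Equiv.ofBijective _ (hΦ R), fun _ _ _ => rfl, fun R S _ _ _ => ?_⟩
  have hB : ∀ {B C : Type u} [Ring B] [Algebra R B] [Ring C] [Algebra R C], (B ≃ₐ[R] C) →
      Nonempty (S ⊗[R] B ≃ₐ[S] S ⊗[R] C) := fun e => ⟨Algebra.TensorProduct.congr .refl e⟩
  have hC : ∀ X : TernaryQuadraticModule R,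
      Nonempty (S ⊗[R] evenClifford X.q ≃ₐ[S] evenClifford (X.baseChange S).q) :=
    fun X => evenClifford_baseChange S X.q
  have hQ : ∀ B : QuaternionRing R, IsQuaternionRing S (S ⊗[R] B.B) := by
    intro B
    obtain ⟨X, ⟨e⟩⟩ := B.isQuaternionRing
    obtain ⟨e'⟩ := hB e
    obtain ⟨e''⟩ := hC X
    exact ⟨X.baseChange S, ⟨e'.trans e''⟩⟩
  refine ⟨Quotient.map (fun X => X.baseChange S) fun X Y h => ?_,
    Quotient.map (fun B => { B := S ⊗[R] B.B, isQuaternionRing := hQ B }) fun _ _ ⟨e⟩ => hB e,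
    fun _ => rfl, fun B => ⟨hQ B, rfl⟩, ?_⟩
  · obtain ⟨e⟩ := TernaryQuadraticModule.TwistedIsometric.evenClifford h
    obtain ⟨e'⟩ := hB e
    obtain ⟨eX⟩ := hC X
    obtain ⟨eY⟩ := hC Y
    exact TernaryQuadraticModule.twistedIsometric_iff.mpr ⟨eX.symm.trans (e'.trans eY)⟩
  · rintro ⟨X⟩
    obtain ⟨e⟩ := hC X
    exact Quotient.sound ⟨e.symm⟩
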